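/- **Quantum Sylvester theorem for twisted Yangians.** Treat the orthogonal and the symplectic case simultaneously; in a double sign the upper sign is for the orthogonal case. Let $0\le m<n$ be integers and let either $N=2n$, $M=2m$ (both cases), or $N=2n+1$, $M=2m+1$ (orthogonal case only). Let $\mathcal I$ be $\{-n,\dots,-1,1,\dots,n\}$ if $N=2n$ and $\{-n,\dots,n\}$ if $N=2n+1$; let $\mathcal B=\{i\in\mathcal I: |i|\le m\}$ and $\mathcal A=\mathcal I\setminus\mathcal B$, so $|\mathcal B|=M$ and $|\mathcal A|=N-M$. Put $\theta_{ij}=1$ in the orthogonal case and $\theta_{ij}=\operatorname{sgn} i\cdot\operatorname{sgn} j$ in the symplectic case. For a finite set $\mathcal J\subset\mathbb Z$ with $-\mathcal J=\mathcal J$ (and $0\notin\mathcal J$ in the symplectic case), the twisted Yangian with index set $\mathcal J$ is the associative unital $\mathbb C$-algebra with generators $s_{ij}^{(r)}$, $i,j\in\mathcal J$, $r\ge1$, and the following relations for the series $s_{ij}(u)=\delta_{ij}+\sum_{r\ge1}s_{ij}^{(r)}u^{-r}$: $$\begin{aligned}(u^2-v^2)[s_{ij}(u),s_{kl}(v)]={}&(u+v)\big(s_{kj}(u)s_{il}(v)-s_{kj}(v)s_{il}(u)\big)\\&-(u-v)\big(\theta_{k,-j}s_{i,-k}(u)s_{-j,l}(v)-\theta_{i,-l}s_{k,-i}(v)s_{-l,j}(u)\big)\\&+\theta_{i,-j}\big(s_{k,-i}(u)s_{-j,l}(v)-s_{k,-i}(v)s_{-j,l}(u)\big),\end{aligned}$$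 $$\theta_{ij}\,s_{-j,-i}(-u)=s_{ij}(u)\pm\frac{s_{ij}(u)-s_{ij}(-u)}{2u}.$$ Write $\mathrm Y(\mathfrak g_N)$ for the algebra with index set $\mathcal I$ and $\mathrm Y(\mathfrak g_{N-M})$ for the one with index set $\mathcal A$. All rational functions of $u$ and all shifts of $u$ are expanded in powers of $u^{-1}$. For a matrix $T(u)=(t_{ij}(u))_{i,j\in\mathcal J}$ with entries in $R[[u^{-1}]]$, where $R$ is a $\mathbb C$-algebra, set $u_a=u-a+1$, let $T_a=T_a(u_a)$ be the matrix $T(u_a)$ acting in the $a$-th factor of $(\mathbb C^{\mathcal J})^{\otimes k}$, and put $R^t_{ab}=1+Q_{ab}/(u_a+u_b)$ with $Q=\sum_{i,j}\theta_{ij}\,e_{-j,-i}\otimes e_{ji}$, and $A_k=\sum_{\sigma\in\mathfrak S_k}\operatorname{sgn}\sigma\cdot P_\sigma$. The Sklyanin minor $t^{a_1\cdots a_k}_{b_1\cdots b_k}(u)$ is the coefficient of $e_{a_1b_1}\otimes\cdots\otimes e_{a_kb_k}$ in $$A_k\,T_1(R^t_{12}\cdots R^t_{1k})\,T_2(R^t_{23}\cdots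 R^t_{2k})\cdots T_k ,$$ and the Sklyanin determinant $\operatorname{sdet}T(u)$ is the minor whose upper and lower indices are both all the elements of $\mathcal J$ in increasing order. Let $S(u)=(s_{ij}(u))_{i,j\in\mathcal I}$ be the generator matrix of $\mathrm Y(\mathfrak g_N)$, let $S_{\mathcal B\mathcal B}(u)$ be its submatrix with rows and columns in $\mathcal B$, and let $S^\sharp(u)=(s^\sharp_{ab}(u))_{a,b\in\mathcal A}$ with $$s^\sharp_{ab}(u)=s^{-m\cdots m,\,a}_{-m\cdots m,\,b}(u+M/2),$$ where $-m\cdots m$ lists the elements of $\mathcal B$ in increasing order. Put $\alpha_{-m}(u)=1$ in the orthogonal case and $\alpha_{-m}(u)=\dfrac{u+1/2}{u+m+1/2}$ in the symplectic case. Then the mapping $$s_{ab}(u)\mapsto\alpha_{-m}(u)\,s^\sharp_{ab}(u),\qquad a,b\in\mathcal A,$$ defines an algebra homomorphism $\mathrm Y(\mathfrak g_{N-M})\to\mathrm Y(\mathfrak g_N)$; that is, there is exactly one homomorphism of unital $\mathbb C$-algebras acting in this way on the generator series. Moreover, in $\mathrm Y(\mathfrak g_N)[[u^{-1}]]$, $$\operatorname{sdet}\big[\alpha_{-m}(u)S^\sharp(u)\big]=\alpha(u)\cdot\operatorname{sdet}S(u+M/2)\cdot\operatorname{sdet}S_{\mathcal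 B\mathcal B}(u+M/2-1)\cdots\operatorname{sdet}S_{\mathcal B\mathcal B}(u+M/2-N+M+1),$$ where $\alpha(u)=\alpha_{-m}(u)\,\alpha_{-m}(u-1)\cdots\alpha_{-m}(u-N+M+1)$. -/

import Mathlib

open PowerSeries

noncomputable section

namespace TwistedYangian

/-- The two series of classical Lie algebras `𝔤_N`. -/
inductive Kind
  | orthogonal
  | symplectic

/-- The upper (orthogonal) or lower (symplectic) sign in a double sign `±`. -/
def Kind.pm : Kind → ℂ
  | .orthogonal => 1
  | .symplectic => -1

/-- `θ_{ij}` is `1` in the orthogonal case and `sgn i * sgn j` in the symplectic case. -/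
def theta : Kind → ℤ → ℤ → ℂ
  | .orthogonal, _, _ => 1
  | .symplectic, i, j => ((i.sign * j.sign : ℤ) : ℂ)

/-! ### Index sets

Rows and columns are numbered by a finite set of integers that is stable under `i ↦ -i`;
such a set is given by the set `K` of absolute values of its elements. -/

/-- The integers whose absolute value belongs to `K`. -/
def Idx (K : Finset ℕ) : Type := {i : ℤ // i.natAbs ∈ K}

instance (K : Finset ℕ) : LinearOrder (Idx K) :=
  inferInstanceAs (LinearOrder {i : ℤ // i.natAbs ∈ K})

instance (K : Finset ℕ) : Fintype (Idx K) :=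
  Fintype.subtype (K.image (fun k : ℕ => (k : ℤ)) ∪ K.image (fun k : ℕ => -(k : ℤ))) (by
    intro x
    simp only [Finset.mem_union, Finset.mem_image]
    constructor
    · rintro (⟨k, hk, rfl⟩ | ⟨k, hk, rfl⟩) <;> simpa using hk
    · intro h
      rcases Int.natAbs_eq x with hx | hx
      · exact Or.inl ⟨_, h, hx.symm⟩
      · exact Or.inr ⟨_, h, hx.symm⟩)

instance (K : Finset ℕ) : Neg (Idx K) := ⟨fun i => ⟨-i.1, by simpa using i.2⟩⟩

/-- Inclusion of index sets. -/
def Idx.incl {K L : Finset ℕ} (h : K ⊆ L) (i : Idx K) : Idx L := ⟨i.1, h i.2⟩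

/-- The absolute values of the indices of `N × N` matrices, `N = 2 n + e`: the index set is
`{-n, …, -1, 1, …, n}` for `e = 0` and `{-n, …, -1, 0, 1, …, n}` for `e = 1`. -/
def absIdx (e n : ℕ) : Finset ℕ := (Finset.range (n + 1)).filter (fun a => a = 0 → e = 1)

theorem absIdx_mono (e : ℕ) {m n : ℕ} (h : m ≤ n) : absIdx e m ⊆ absIdx e n := by
  intro a ha
  simp only [absIdx, Finset.mem_filter, Finset.mem_range] at ha ⊢
  exact ⟨by omega, ha.2⟩

/-- The elements of an index set in increasing order. -/
def Idx.enum (K : Finset ℕ) : Fin (Fintype.card (Idx K)) → Idx K :=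
  (Finset.univ : Finset (Idx K)).orderEmbOfFin rfl

/-! ### Formal series in `u⁻¹`

A series `f(u) = f₀ + f₁ u⁻¹ + f₂ u⁻² + ⋯` is the power series whose variable `X` stands
for `u⁻¹`. -/

/-- The expansion `u⁻¹ / (1 + c u⁻¹)` of `(u + c)⁻¹`. -/
def invLin (c : ℂ) : ℂ⟦X⟧ := X * (1 + C c * X)⁻¹

section Series

variable {R : Type*} [Ring R] [Algebra ℂ R]

/-- A scalar series, viewed as a series with coefficients in `R`. -/
def scal (R : Type*) [Ring R] [Algebra ℂ R] : ℂ⟦X⟧ →+* R⟦X⟧ := PowerSeries.map (algebraMap ℂ R)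

/-- `f(u) ↦ f(u + c)`: each `u⁻ʳ` is replaced by the expansion of `(u + c)⁻ʳ` in `u⁻¹`. -/
def shift (c : ℂ) (f : R⟦X⟧) : R⟦X⟧ :=
  PowerSeries.mk fun p => ∑ r ∈ Finset.range (p + 1), coeff p (invLin c ^ r) • coeff r f

/-- `f(u) ↦ f(-u)`. -/
def reflect (f : R⟦X⟧) : R⟦X⟧ := PowerSeries.mk fun p => ((-1 : ℂ) ^ p) • coeff p f

/-- `f(u)` as a series in the two variables `u⁻¹` (inner) and `v⁻¹` (outer). -/
def inU (f : R⟦X⟧) : R⟦X⟧⟦X⟧ := C f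

/-- `f(v)` as a series in the two variables `u⁻¹` (inner) and `v⁻¹` (outer). -/
def inV (f : R⟦X⟧) : R⟦X⟧⟦X⟧ := PowerSeries.map C f

/-- A complex number as a constant series in `u⁻¹` and `v⁻¹`. -/
def const₂ (R : Type*) [Ring R] [Algebra ℂ R] (c : ℂ) : R⟦X⟧⟦X⟧ := C (C (algebraMap ℂ R c))

variable (t : Kind) {K : Finset ℕ} (s : Matrix (Idx K) (Idx K) R⟦X⟧)

/-- `(u² - v²) [s_{ij}(u), s_{kl}(v)]`, multiplied by `u⁻² v⁻²`. -/
def quadLHS (i j k l : Idx K) : R⟦X⟧⟦X⟧ :=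
  let x : R⟦X⟧⟦X⟧ := inU X
  let y : R⟦X⟧⟦X⟧ := inV X
  (y ^ 2 - x ^ 2) * (inU (s i j) * inV (s k l) - inV (s k l) * inU (s i j))

/-- The right-hand side of the quadratic defining relation of the extended twisted Yangian,
`(u + v) (s_{kj}(u) s_{il}(v) - s_{kj}(v) s_{il}(u))`
`- (u - v) (θ_{k,-j} s_{i,-k}(u) s_{-j,l}(v) - θ_{i,-l} s_{k,-i}(v) s_{-l,j}(u))`
`+ θ_{i,-j} (s_{k,-i}(u) s_{-j,l}(v) - s_{k,-i}(v) s_{-j,l}(u))`,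
multiplied by `u⁻² v⁻²`. -/
def quadRHS (i j k l : Idx K) : R⟦X⟧⟦X⟧ :=
  let x : R⟦X⟧⟦X⟧ := inU X
  let y : R⟦X⟧⟦X⟧ := inV X
  x * y * (y + x) * (inU (s k j) * inV (s i l) - inV (s k j) * inU (s i l))
    - x * y * (y - x) *
      (const₂ R (theta t k.1 (-j).1) * (inU (s i (-k)) * inV (s (-j) l))
        - const₂ R (theta t i.1 (-l).1) * (inV (s k (-i)) * inU (s (-l) j)))
    + x ^ 2 * y ^ 2 *
      (const₂ R (theta t i.1 (-j).1) *
        (inU (s k (-i)) * inV (s (-j) l) - inV (s k (-i)) * inU (s (-j) l)))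

/-- `θ_{ij} s_{-j,-i}(-u)`. -/
def symLHS (i j : Idx K) : R⟦X⟧ :=
  scal R (C (theta t i.1 j.1)) * reflect (s (-j) (-i))

/-- `s_{ij}(u) ± (s_{ij}(u) - s_{ij}(-u)) / (2 u)`. -/
def symRHS (i j : Idx K) : R⟦X⟧ :=
  s i j + scal R (C (t.pm / 2) * X) * (s i j - reflect (s i j))

end Series

/-! ### The twisted Yangian -/

/-- Free generators `s_{ij}^{(r+1)}`, labelled by `(i, j, r)`. -/
abbrev Free (K : Finset ℕ) : Type := FreeAlgebra ℂ (Idx K × Idx K × ℕ)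

/-- `s_{ij}(u) = δ_{ij} + s_{ij}^{(1)} u⁻¹ + s_{ij}^{(2)} u⁻² + ⋯` over the free algebra. -/
def freeS (K : Finset ℕ) : Matrix (Idx K) (Idx K) (Free K)⟦X⟧ := fun i j =>
  PowerSeries.mk fun p => match p with
    | 0 => if i = j then 1 else 0
    | r + 1 => FreeAlgebra.ι ℂ (i, j, r)

/-- The defining relations, coefficient by coefficient: `quad` are those of the extended twisted
Yangian, `symm` is the symmetry relation, which defines the twisted Yangian as its quotient. -/
inductive Rel (t : Kind) (K : Finset ℕ) : Free K → Free K → Prop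
  | quad (i j k l : Idx K) (p q : ℕ) :
      Rel t K (coeff p (coeff q (quadLHS (freeS K) i j k l)))
        (coeff p (coeff q (quadRHS t (freeS K) i j k l)))
  | symm (i j : Idx K) (p : ℕ) :
      Rel t K (coeff p (symLHS t (freeS K) i j)) (coeff p (symRHS t (freeS K) i j))

/-- The twisted Yangian whose generators are numbered by the index set given by `K`. -/
def Y (t : Kind) (K : Finset ℕ) : Type := RingQuot (Rel t K)

instance (t : Kind) (K : Finset ℕ) : Ring (Y t K) := inferInstanceAs (Ring (RingQuot (Rel t K)))

instance (t : Kind) (K : Finset ℕ) : Algebra ℂ (Y t K) :=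
  inferInstanceAs (Algebra ℂ (RingQuot (Rel t K)))

/-- The quotient map from the free algebra. -/
def mkY (t : Kind) (K : Finset ℕ) : Free K →ₐ[ℂ] Y t K := RingQuot.mkAlgHom ℂ (Rel t K)

/-- The matrix `S(u)` of the generating series of the twisted Yangian. -/
def S (t : Kind) (K : Finset ℕ) : Matrix (Idx K) (Idx K) (Y t K)⟦X⟧ := fun i j =>
  PowerSeries.map (mkY t K : Free K →+* Y t K) (freeS K i j)

/-! ### Sklyanin minors

Elements of `R[[u⁻¹]] ⊗ (End ℂ^N)^{⊗ k}` are matrices over `R[[u⁻¹]]` whose rows and columns are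
numbered by `k`-tuples of indices. The tensor factors are numbered by `0, …, k - 1`, so that the
spectral parameters are `u_a = u - a`. -/

section Minors

variable {R : Type*} [Ring R] [Algebra ℂ R] (t : Kind) {K : Finset ℕ} {k : ℕ}

/-- `T_a(u_a)`: the matrix `T(u - a)` acting on the `a`-th tensor factor. -/
def onFactor (T : Matrix (Idx K) (Idx K) R⟦X⟧) (a : Fin k) :
    Matrix (Fin k → Idx K) (Fin k → Idx K) R⟦X⟧ := fun f g =>
  if ∀ b, b ≠ a → f b = g b then shift (-((a : ℕ) : ℂ)) (T (f a) (g a)) else 0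

/-- `Q_{ab}` for `Q = ∑_{i,j} θ_{ij} e_{-j,-i} ⊗ e_{ji}`. -/
def Qmat (K : Finset ℕ) (a b : Fin k) : Matrix (Fin k → Idx K) (Fin k → Idx K) ℂ := fun f g =>
  if (∀ c, c ≠ a → c ≠ b → f c = g c) ∧ f a = -f b ∧ g a = -g b
    then theta t (g b).1 (f b).1 else 0

/-- `Rᵗ_{ab} = Rᵗ_{ab}(-u_a - u_b) = 1 + Q_{ab} / (u_a + u_b)`, where `u_a + u_b = 2 u - a - b`. -/
def Rt (R : Type*) [Ring R] [Algebra ℂ R] (K : Finset ℕ) (a b : Fin k) :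
    Matrix (Fin k → Idx K) (Fin k → Idx K) R⟦X⟧ :=
  1 + (Qmat t K a b).map fun z =>
    scal R (C (z / 2) * invLin (-((((a : ℕ) : ℂ) + ((b : ℕ) : ℂ)) / 2)))

/-- The product `⟨T_1, …, T_k⟩ = T_1 (Rᵗ_{12} ⋯ Rᵗ_{1k}) T_2 (Rᵗ_{23} ⋯ Rᵗ_{2k}) ⋯ T_k`. -/
def bracket (k : ℕ) (T : Matrix (Idx K) (Idx K) R⟦X⟧) :
    Matrix (Fin k → Idx K) (Fin k → Idx K) R⟦X⟧ :=
  ((List.finRange k).map fun a =>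
    onFactor T a * (((List.finRange k).filter (fun b => a < b)).map fun b => Rt t R K a b).prod).prod

/-- The antisymmetrizer `A_k = ∑_σ sgn σ · P_σ` on `(ℂ^N)^{⊗ k}`. -/
def antisymmetrizer (R : Type*) [Ring R] (K : Finset ℕ) (k : ℕ) :
    Matrix (Fin k → Idx K) (Fin k → Idx K) R⟦X⟧ := fun f g =>
  ∑ σ : Equiv.Perm (Fin k), if f = g ∘ σ.symm then ((Equiv.Perm.sign σ : ℤ) : R⟦X⟧) else 0

/-- The Sklyanin minor with upper indices `a` and lower indices `b` of a matrix `T(u)` of series: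
the coefficient of `e_{a_1 b_1} ⊗ ⋯ ⊗ e_{a_k b_k}` in `A_k ⟨T_1, …, T_k⟩`. -/
def minor (T : Matrix (Idx K) (Idx K) R⟦X⟧) (a b : Fin k → Idx K) : R⟦X⟧ :=
  (antisymmetrizer R K k * bracket t k T) a b

/-- The Sklyanin determinant of `T(u)`: all indices in increasing order, above and below. -/
def sdet (T : Matrix (Idx K) (Idx K) R⟦X⟧) : R⟦X⟧ :=
  minor t T (Idx.enum K) (Idx.enum K)

end Minors

/-- `α_p(u)`: equal to `1` in the orthogonal case, and to `(u + 1/2) / (u - p + 1/2)`,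
that is, `(1 + u⁻¹/2) / (1 + (1/2 - p) u⁻¹)`, in the symplectic case. -/
def alpha (t : Kind) (p : ℤ) : ℂ⟦X⟧ :=
  match t with
  | .orthogonal => 1
  | .symplectic => (1 + C (1 / 2 : ℂ) * X) * (1 + C (1 / 2 - (p : ℂ)) * X)⁻¹

/-- The absolute values `m + 1, …, n` of the elements of the complement `𝒜` of
`ℬ = {-m, …, m}` in the index set `{-n, …, n}`. -/
def absCompl (e m n : ℕ) : Finset ℕ := absIdx e n \ absIdx e m

section Sylvester

variable (t : Kind) (e : ℕ) {m n : ℕ} (h : m ≤ n)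

/-- The index tuple `-m, …, m, a`. -/
def extend (a : Idx (absCompl e m n)) :
    Fin (Fintype.card (Idx (absIdx e m)) + 1) → Idx (absIdx e n) :=
  Fin.snoc (α := fun _ => Idx (absIdx e n))
    (fun i => Idx.incl (absIdx_mono e h) (Idx.enum (absIdx e m) i))
    (Idx.incl Finset.sdiff_subset a)

/-- The matrix `S♯(u)` of the minors `s♯_{ab}(u) = s^{-m ⋯ m, a}_{-m ⋯ m, b}(u + M / 2)`,
for `a, b` in `𝒜` and `M = 2 m + e`. -/
def Ssharp : Matrix (Idx (absCompl e m n)) (Idx (absCompl e m n)) (Y t (absIdx e n))⟦X⟧ :=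
  fun a b => shift (((2 * m + e : ℕ) : ℂ) / 2)
    (minor t (S t (absIdx e n)) (extend e h a) (extend e h b))

/-- The submatrix `S_{ℬℬ}(u)` of `S(u)`. -/
def SBB : Matrix (Idx (absIdx e m)) (Idx (absIdx e m)) (Y t (absIdx e n))⟦X⟧ :=
  (S t (absIdx e n)).submatrix (Idx.incl (absIdx_mono e h)) (Idx.incl (absIdx_mono e h))

/-- The matrix `α_{-m}(u) S♯(u)`. -/
def imageMatrix :
    Matrix (Idx (absCompl e m n)) (Idx (absCompl e m n)) (Y t (absIdx e n))⟦X⟧ :=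
  fun a b => scal (Y t (absIdx e n)) (alpha t (-(m : ℤ))) * Ssharp t e h a b

end Sylvester

end TwistedYangian

end

noncomputable section

namespace TwistedYangian

set_option linter.unusedSectionVars false

/-! ### Substitutions into power series -/

section Substitution

variable {R : Type*} [Ring R] [Algebra ℂ R]

/-- Scalar series act on series with coefficients in an algebra. -/
instance seriesAlgebra {Z A : Type*} [CommRing Z] [Ring A] [Algebra Z A] : Algebra Z⟦X⟧ A⟦X⟧ :=
  RingHom.toAlgebra' (PowerSeries.map (algebraMap Z A)) (by
    intro c f
    ext n
    rw [coeff_mul, coeff_mul, ← Finset.Nat.sum_antidiagonal_swap]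
    refine Finset.sum_congr rfl fun x _ => ?_
    simp only [coeff_map, Prod.fst_swap, Prod.snd_swap]
    exact Algebra.commutes _ _)

theorem series_algebraMap {Z A : Type*} [CommRing Z] [Ring A] [Algebra Z A] (c : Z⟦X⟧) :
    algebraMap Z⟦X⟧ A⟦X⟧ c = PowerSeries.map (algebraMap Z A) c := rfl

theorem algebraMap_eq_scal (c : ℂ⟦X⟧) : algebraMap ℂ⟦X⟧ R⟦X⟧ c = scal R c := rfl

theorem scal_mul_eq_smul (c : ℂ⟦X⟧) (f : R⟦X⟧) : scal R c * f = c • f := rfl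

theorem coeff_pow_eq_zero {g : ℂ⟦X⟧} (hg : constantCoeff g = 0) {p r : ℕ} (h : p < r) :
    coeff p (g ^ r) = 0 :=
  X_pow_dvd_iff.1 (pow_dvd_pow_of_dvd (X_dvd_iff.2 hg) r) p h

/-- The substitution `X ↦ g` for a scalar series `g` without constant term. -/
def subst₁ (g : ℂ⟦X⟧) (f : R⟦X⟧) : R⟦X⟧ :=
  PowerSeries.mk fun p => ∑ r ∈ Finset.range (p + 1), coeff p (g ^ r) • coeff r f

theorem coeff_subst₁ {g : ℂ⟦X⟧} (hg : constantCoeff g = 0) (f : R⟦X⟧) {p n : ℕ} (h : p < n) :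
    coeff p (subst₁ g f) = ∑ r ∈ Finset.range n, coeff p (g ^ r) • coeff r f := by
  rw [subst₁, coeff_mk]
  refine Finset.sum_subset (Finset.range_subset_range.2 h) fun r _ hr => ?_
  rw [coeff_pow_eq_zero hg (by simpa using hr), zero_smul]

theorem sum_range_antidiagonal {M : Type*} [AddCommMonoid M] (F : ℕ → ℕ → M) (n : ℕ)
    (hF : ∀ a b, n ≤ a + b → F a b = 0) :
    ∑ r ∈ Finset.range n, ∑ x ∈ Finset.HasAntidiagonal.antidiagonal r, F x.1 x.2 =
      ∑ a ∈ Finset.range n, ∑ b ∈ Finset.range n, F a b := by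
  rw [← Finset.sum_product' (Finset.range n) (Finset.range n) F]
  rw [← Finset.sum_subset (Finset.filter_subset (fun x : ℕ × ℕ => x.1 + x.2 ∈ Finset.range n)
    (Finset.range n ×ˢ Finset.range n))]
  · rw [← Finset.sum_fiberwise_of_maps_to (t := Finset.range n) (g := fun x : ℕ × ℕ => x.1 + x.2)
      (fun x hx => (Finset.mem_filter.1 hx).2)]
    refine Finset.sum_congr rfl fun r hr => Finset.sum_congr ?_ fun _ _ => rfl
    ext ⟨a, b⟩
    simp only [Finset.HasAntidiagonal.mem_antidiagonal, Finset.mem_filter, Finset.mem_product,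
      Finset.mem_range] at hr ⊢
    omega
  · intro x hx hx'
    apply hF
    simp only [Finset.mem_filter, hx, true_and, Finset.mem_range] at hx'
    omega

theorem subst₁_mul {g : ℂ⟦X⟧} (hg : constantCoeff g = 0) (f h : R⟦X⟧) :
    subst₁ g (f * h) = subst₁ g f * subst₁ g h := by
  ext p
  have h1 : coeff p (subst₁ g f * subst₁ g h) = ∑ a ∈ Finset.range (p + 1),
      ∑ b ∈ Finset.range (p + 1), coeff p (g ^ (a + b)) • (coeff a f * coeff b h) := by
    rw [coeff_mul]
    calc _ = ∑ x ∈ Finset.HasAntidiagonal.antidiagonal p, ∑ a ∈ Finset.range (p + 1),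
          ∑ b ∈ Finset.range (p + 1),
            (coeff x.1 (g ^ a) * coeff x.2 (g ^ b)) • (coeff a f * coeff b h) := by
          refine Finset.sum_congr rfl fun x hx => ?_
          rw [Finset.HasAntidiagonal.mem_antidiagonal] at hx
          rw [coeff_subst₁ hg f (n := p + 1) (by omega), coeff_subst₁ hg h (n := p + 1) (by omega),
            Finset.sum_mul]
          refine Finset.sum_congr rfl fun a _ => ?_
          rw [Finset.mul_sum]
          refine Finset.sum_congr rfl fun b _ => ?_
          rw [smul_mul_smul_comm]
      _ = _ := by
          rw [Finset.sum_comm]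
          refine Finset.sum_congr rfl fun a _ => ?_
          rw [Finset.sum_comm]
          refine Finset.sum_congr rfl fun b _ => ?_
          rw [← Finset.sum_smul, pow_add, coeff_mul]
  rw [h1, ← sum_range_antidiagonal (fun a b => coeff p (g ^ (a + b)) • (coeff a f * coeff b h))
    (p + 1) (fun a b hab => by
      show coeff p (g ^ (a + b)) • (coeff a f * coeff b h) = 0
      rw [coeff_pow_eq_zero hg (by omega), zero_smul]), subst₁, coeff_mk]
  refine Finset.sum_congr rfl fun r _ => ?_
  rw [coeff_mul, Finset.smul_sum]
  refine Finset.sum_congr rfl fun x hx => ?_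
  rw [Finset.HasAntidiagonal.mem_antidiagonal.1 hx]

theorem subst₁_C {g : ℂ⟦X⟧} (a : R) : subst₁ g (C a) = C a := by
  ext p
  rw [subst₁, coeff_mk, Finset.sum_eq_single 0]
  · simp [coeff_C, coeff_one]
  · intro r _ hr
    rw [coeff_C_of_ne_zero hr, smul_zero]
  · simp

/-- The substitution `X ↦ g` as a ring homomorphism. -/
def substHom (g : ℂ⟦X⟧) (hg : constantCoeff g = 0) : R⟦X⟧ →+* R⟦X⟧ where
  toFun := subst₁ g
  map_one' := by simpa using subst₁_C (g := g) (1 : R)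
  map_mul' := subst₁_mul hg
  map_zero' := by simpa using subst₁_C (g := g) (0 : R)
  map_add' f h := by
    ext p
    simp [subst₁, smul_add, Finset.sum_add_distrib]

theorem substHom_apply (g : ℂ⟦X⟧) (hg : constantCoeff g = 0) (f : R⟦X⟧) :
    substHom g hg f = subst₁ g f := rfl

theorem subst₁_scal (g : ℂ⟦X⟧) (f : ℂ⟦X⟧) : subst₁ g (scal R f) = scal R (subst₁ g f) := by
  ext p
  simp [subst₁, scal, Algebra.smul_def]

theorem subst₁_X (g : ℂ⟦X⟧) (hg : constantCoeff g = 0) : subst₁ g (X : ℂ⟦X⟧) = g := by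
  ext p
  rw [coeff_subst₁ hg _ (n := p + 2) (by omega), Finset.sum_eq_single 1]
  · simp
  · intro r _ hr
    simp [coeff_X, hr]
  · simp

theorem constantCoeff_subst₁ (g : ℂ⟦X⟧) (f : R⟦X⟧) :
    constantCoeff (subst₁ g f) = constantCoeff f := by
  rw [← coeff_zero_eq_constantCoeff_apply, subst₁, coeff_mk]
  simp

theorem subst₁_subst₁ {g h : ℂ⟦X⟧} (hg : constantCoeff g = 0) (hh : constantCoeff h = 0)
    (f : R⟦X⟧) : subst₁ g (subst₁ h f) = subst₁ (subst₁ g h) f := by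
  ext p
  have hgh : constantCoeff (subst₁ g h) = 0 := by rw [constantCoeff_subst₁, hh]
  rw [coeff_subst₁ hg _ (Nat.lt_succ_self p), coeff_subst₁ hgh _ (Nat.lt_succ_self p)]
  calc _ = ∑ r ∈ Finset.range (p + 1), ∑ s ∈ Finset.range (p + 1),
        (coeff p (g ^ r) * coeff r (h ^ s)) • coeff s f := by
        refine Finset.sum_congr rfl fun r hr => ?_
        rw [coeff_subst₁ hh _ (Finset.mem_range.1 hr), Finset.smul_sum]
        exact Finset.sum_congr rfl fun s _ => smul_smul _ _ _
    _ = _ := by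
        rw [Finset.sum_comm]
        refine Finset.sum_congr rfl fun s _ => ?_
        rw [← Finset.sum_smul]
        congr 1
        have := map_pow (substHom g hg : ℂ⟦X⟧ →+* ℂ⟦X⟧) h s
        rw [substHom_apply, substHom_apply] at this
        rw [← this, coeff_subst₁ hg _ (Nat.lt_succ_self p)]
        rfl

theorem constantCoeff_invLin (c : ℂ) : constantCoeff (invLin c) = 0 := by
  simp [invLin]

theorem one_add_C_mul_X_mul_inv (c : ℂ) :
    (1 + C c * X : ℂ⟦X⟧) * (1 + C c * X : ℂ⟦X⟧)⁻¹ = 1 :=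
  PowerSeries.mul_inv_cancel _ (by simp)

theorem one_add_C_mul_X_mul_invLin (c : ℂ) : (1 + C c * X : ℂ⟦X⟧) * invLin c = X := by
  rw [invLin, mul_left_comm, one_add_C_mul_X_mul_inv, mul_one]

theorem one_add_C_mul_X_ne_zero (c : ℂ) : (1 + C c * X : ℂ⟦X⟧) ≠ 0 := by
  intro h
  have := congrArg constantCoeff h
  simp at this

theorem subst₁_invLin (g : ℂ⟦X⟧) (hg : constantCoeff g = 0) (c : ℂ) :
    (1 + C c * g) * subst₁ g (invLin c) = g := by
  have := congrArg (substHom g hg) (one_add_C_mul_X_mul_invLin c)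
  simpa only [map_mul, map_add, map_one, substHom_apply, subst₁_C, subst₁_X g hg] using this

/-- `f(u) ↦ f(u + c)` as a ring homomorphism. -/
def shiftHom (c : ℂ) : R⟦X⟧ →+* R⟦X⟧ := substHom (invLin c) (constantCoeff_invLin c)

theorem shiftHom_apply (c : ℂ) (f : R⟦X⟧) : shiftHom c f = shift c f := rfl

theorem constantCoeff_neg_X : constantCoeff (-X : ℂ⟦X⟧) = 0 := by simp

/-- `f(u) ↦ f(-u)` as a ring homomorphism. -/
def reflectHom : R⟦X⟧ →+* R⟦X⟧ := substHom (-X) constantCoeff_neg_X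

theorem reflectHom_apply (f : R⟦X⟧) : reflectHom f = reflect f := by
  ext p
  rw [reflectHom, substHom_apply, subst₁, reflect, coeff_mk, coeff_mk, Finset.sum_eq_single p]
  · rw [neg_pow]
    have : ((-1 : ℂ⟦X⟧) ^ p) = C ((-1) ^ p) := by simp
    rw [this, coeff_C_mul, coeff_X_pow_self, mul_one]
  · intro r _ hr
    rw [neg_pow]
    have : ((-1 : ℂ⟦X⟧) ^ r) = C ((-1) ^ r) := by simp
    rw [this, coeff_C_mul, coeff_X_pow, if_neg (Ne.symm hr), mul_zero, zero_smul]
  · simp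

theorem subst₁_invLin_invLin (a b : ℂ) : subst₁ (invLin a) (invLin b) = invLin (a + b) := by
  have h1 := subst₁_invLin (invLin a) (constantCoeff_invLin a) b
  have h2 := one_add_C_mul_X_mul_invLin a
  have h3 := one_add_C_mul_X_mul_invLin (a + b)
  have h4 : (1 + C (a + b) * X : ℂ⟦X⟧) * subst₁ (invLin a) (invLin b) = X := by
    rw [map_add]
    calc _ = (1 + C a * X) * ((1 + C b * invLin a) * subst₁ (invLin a) (invLin b))
          + C b * (X - (1 + C a * X) * invLin a) * subst₁ (invLin a) (invLin b) := by ring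
      _ = _ := by rw [h1, h2]; ring
  exact mul_left_cancel₀ (one_add_C_mul_X_ne_zero (a + b)) (h4.trans h3.symm)

theorem shift_shift (a b : ℂ) (f : R⟦X⟧) : shift a (shift b f) = shift (a + b) f := by
  have := subst₁_subst₁ (constantCoeff_invLin a) (constantCoeff_invLin b) f
  rw [subst₁_invLin_invLin] at this
  exact this

theorem subst₁_id (f : R⟦X⟧) : subst₁ X f = f := by
  ext p
  rw [subst₁, coeff_mk, Finset.sum_eq_single p]
  · simp
  · intro r _ hr
    simp [coeff_X_pow, Ne.symm hr]
  · simp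

theorem shift_zero (f : R⟦X⟧) : shift 0 f = f := by
  have : invLin 0 = X := by
    have := one_add_C_mul_X_mul_invLin 0
    simpa using this
  show subst₁ (invLin 0) f = f
  rw [this, subst₁_id]

theorem subst₁_neg_X_invLin (c : ℂ) : subst₁ (-X) (invLin c) = -invLin (-c) := by
  have h1 := subst₁_invLin (-X) constantCoeff_neg_X c
  have h3 := one_add_C_mul_X_mul_invLin (-c)
  refine mul_left_cancel₀ (one_add_C_mul_X_ne_zero (-c)) ?_
  rw [mul_neg, h3, map_neg, neg_mul, ← sub_eq_add_neg]
  linear_combination h1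

theorem reflect_shift (c : ℂ) (f : R⟦X⟧) : reflect (shift c f) = shift (-c) (reflect f) := by
  rw [← reflectHom_apply, ← reflectHom_apply]
  have h1 := subst₁_subst₁ constantCoeff_neg_X (constantCoeff_invLin c) f
  have h2 := subst₁_subst₁ (constantCoeff_invLin (-c)) constantCoeff_neg_X f
  have h3 : subst₁ (invLin (-c)) (-X : ℂ⟦X⟧) = -invLin (-c) := by
    have := map_neg (substHom (R := ℂ) (invLin (-c)) (constantCoeff_invLin (-c))) X
    simpa only [substHom_apply, subst₁_X _ (constantCoeff_invLin (-c))] using this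
  rw [subst₁_neg_X_invLin] at h1
  rw [h3] at h2
  exact h1.trans h2.symm

theorem reflect_reflect (f : R⟦X⟧) : reflect (reflect f) = f := by
  ext p
  simp only [reflect, coeff_mk, smul_smul, ← mul_pow]
  simp

theorem shift_mul (c : ℂ) (f g : R⟦X⟧) : shift c (f * g) = shift c f * shift c g :=
  map_mul (shiftHom c) f g

theorem shift_scal (c : ℂ) (f : ℂ⟦X⟧) : shift c (scal R f) = scal R (shift c f) :=
  subst₁_scal _ f

theorem shift_X (c : ℂ) : shift c (X : ℂ⟦X⟧) = invLin c :=
  subst₁_X _ (constantCoeff_invLin c)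

theorem shift_C (c : ℂ) (a : R) : shift c (C a) = C a := subst₁_C a

theorem reflect_X : reflect (X : ℂ⟦X⟧) = -X := by
  rw [← reflectHom_apply]
  exact subst₁_X _ constantCoeff_neg_X

theorem constantCoeff_shift (c : ℂ) (f : R⟦X⟧) :
    constantCoeff (shift c f) = constantCoeff f := constantCoeff_subst₁ _ f

theorem shift_invLin (a b : ℂ) : shift a (invLin b) = invLin (a + b) := subst₁_invLin_invLin a b

end Substitution

/-! ### Series in two variables -/

section Diagonal

variable {R : Type*} [Ring R]

/-- Specialization of a series in two variables to equal variables. -/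
def diag (F : R⟦X⟧⟦X⟧) : R⟦X⟧ :=
  PowerSeries.mk fun n => ∑ x ∈ Finset.HasAntidiagonal.antidiagonal n, coeff x.1 (coeff x.2 F)

theorem diag_mul (F G : R⟦X⟧⟦X⟧) : diag (F * G) = diag F * diag G := by
  ext n
  simp only [diag, coeff_mul, coeff_mk, map_sum, Finset.sum_mul_sum, ← Finset.sum_product']
  simp only [Finset.sum_sigma']
  refine Finset.sum_nbij'
    (fun z => ⟨(z.2.2.1 + z.2.1.1, z.2.2.2 + z.2.1.2), ((z.2.2.1, z.2.1.1), (z.2.2.2, z.2.1.2))⟩)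
    (fun z => ⟨(z.2.1.1 + z.2.2.1, z.2.1.2 + z.2.2.2), ⟨(z.2.1.2, z.2.2.2), (z.2.1.1, z.2.2.1)⟩⟩)
    ?_ ?_ ?_ ?_ ?_
  · rintro ⟨⟨a, b⟩, ⟨⟨c, d⟩, ⟨e, f⟩⟩⟩ h
    rw [Finset.mem_sigma, Finset.mem_product, Finset.HasAntidiagonal.mem_antidiagonal,
      Finset.HasAntidiagonal.mem_antidiagonal, Finset.HasAntidiagonal.mem_antidiagonal] at h ⊢
    dsimp only at h ⊢
    omega
  · rintro ⟨⟨a, b⟩, ⟨⟨c, d⟩, ⟨e, f⟩⟩⟩ h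
    rw [Finset.mem_sigma, Finset.mem_product, Finset.HasAntidiagonal.mem_antidiagonal,
      Finset.HasAntidiagonal.mem_antidiagonal, Finset.HasAntidiagonal.mem_antidiagonal] at h ⊢
    dsimp only at h ⊢
    omega
  · rintro ⟨⟨a, b⟩, ⟨⟨c, d⟩, ⟨e, f⟩⟩⟩ h
    rw [Finset.mem_sigma, Finset.mem_product, Finset.HasAntidiagonal.mem_antidiagonal,
      Finset.HasAntidiagonal.mem_antidiagonal, Finset.HasAntidiagonal.mem_antidiagonal] at h
    obtain ⟨h1, h2, h3⟩ := h
    dsimp only at h1 h2 h3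
    subst h2 h3
    rfl
  · rintro ⟨⟨a, b⟩, ⟨⟨c, d⟩, ⟨e, f⟩⟩⟩ h
    rw [Finset.mem_sigma, Finset.mem_product, Finset.HasAntidiagonal.mem_antidiagonal,
      Finset.HasAntidiagonal.mem_antidiagonal, Finset.HasAntidiagonal.mem_antidiagonal] at h
    obtain ⟨h1, h2, h3⟩ := h
    dsimp only at h1 h2 h3
    subst h2 h3
    rfl
  · rintro ⟨⟨a, b⟩, ⟨⟨c, d⟩, ⟨e, f⟩⟩⟩ h
    rfl

/-- Specialization to equal variables as a ring homomorphism. -/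
def diagHom : R⟦X⟧⟦X⟧ →+* R⟦X⟧ where
  toFun := diag
  map_one' := by
    ext n
    rw [diag, coeff_mk, Finset.sum_eq_single (n, 0)]
    · simp
    · rintro ⟨a, b⟩ h hne
      have hb : b ≠ 0 := by
        rintro rfl
        simp only [Finset.HasAntidiagonal.mem_antidiagonal] at h
        exact hne (by rw [← h]; rfl)
      simp [coeff_one, hb]
    · simp
  map_mul' := diag_mul
  map_zero' := by
    ext n
    simp [diag]
  map_add' F G := by
    ext n
    simp [diag, Finset.sum_add_distrib]

theorem diagHom_inU (f : R⟦X⟧) : diagHom (inU f) = f := by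
  ext n
  show coeff n (diag (inU f)) = _
  rw [diag, coeff_mk, Finset.sum_eq_single (n, 0)]
  · simp [inU]
  · rintro ⟨a, b⟩ h hne
    have hb : b ≠ 0 := by
      rintro rfl
      simp only [Finset.HasAntidiagonal.mem_antidiagonal] at h
      exact hne (by rw [← h]; rfl)
    simp [inU, coeff_C, hb]
  · simp

theorem diagHom_inV (f : R⟦X⟧) : diagHom (inV f) = f := by
  ext n
  show coeff n (diag (inV f)) = _
  rw [diag, coeff_mk, Finset.sum_eq_single (0, n)]
  · simp [inV]
  · rintro ⟨a, b⟩ h hne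
    have ha : a ≠ 0 := by
      rintro rfl
      simp only [Finset.HasAntidiagonal.mem_antidiagonal] at h
      exact hne (by rw [← h]; simp)
    simp [inV, coeff_C, ha]
  · simp

variable [Algebra ℂ R]

/-- The substitution `x ↦ g(x)`, `y ↦ h(y)` in a series in two variables. -/
def substHom₂ (g h : ℂ⟦X⟧) (hg : constantCoeff g = 0) (hh : constantCoeff h = 0) :
    R⟦X⟧⟦X⟧ →+* R⟦X⟧⟦X⟧ :=
  (substHom h hh).comp (PowerSeries.map (substHom g hg))

theorem subst₁_map {A : Type*} [Ring A] [Algebra ℂ A] (φ : R →+* A)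
    (hφ : ∀ (c : ℂ) (a : R), φ (c • a) = c • φ a) (g : ℂ⟦X⟧) (f : R⟦X⟧) :
    subst₁ g (PowerSeries.map φ f) = PowerSeries.map φ (subst₁ g f) := by
  ext1 p
  rw [subst₁, coeff_mk, coeff_map, subst₁, coeff_mk, map_sum]
  refine Finset.sum_congr rfl fun r _ => ?_
  rw [coeff_map, hφ]

theorem substHom₂_inU (g h : ℂ⟦X⟧) (hg : constantCoeff g = 0) (hh : constantCoeff h = 0)
    (f : R⟦X⟧) : substHom₂ g h hg hh (inU f) = inU (subst₁ g f) := by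
  rw [substHom₂, RingHom.comp_apply, inU, map_C, substHom_apply, subst₁_C]
  rfl

theorem substHom₂_inV (g h : ℂ⟦X⟧) (hg : constantCoeff g = 0) (hh : constantCoeff h = 0)
    (f : R⟦X⟧) : substHom₂ g h hg hh (inV f) = inV (subst₁ h f) := by
  have : PowerSeries.map (substHom g hg) (inV f) = inV f := by
    ext1 n
    simp only [inV, coeff_map, substHom_apply, subst₁_C]
  rw [substHom₂, RingHom.comp_apply, this, substHom_apply, inV, subst₁_map]
  · rfl
  · intro c a
    ext p
    rw [show coeff p (c • C a) = c • coeff p (C a) from rfl, coeff_C, coeff_C]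
    split_ifs <;> simp

/-- The specialization of a series in two variables at `x ↦ g`, `y ↦ h`. -/
def evalHom₂ (g h : ℂ⟦X⟧) (hg : constantCoeff g = 0) (hh : constantCoeff h = 0) :
    R⟦X⟧⟦X⟧ →+* R⟦X⟧ :=
  diagHom.comp (substHom₂ g h hg hh)

theorem evalHom₂_inU (g h : ℂ⟦X⟧) (hg : constantCoeff g = 0) (hh : constantCoeff h = 0)
    (f : R⟦X⟧) : evalHom₂ g h hg hh (inU f) = subst₁ g f := by
  rw [evalHom₂, RingHom.comp_apply, substHom₂_inU, diagHom_inU]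

theorem evalHom₂_inV (g h : ℂ⟦X⟧) (hg : constantCoeff g = 0) (hh : constantCoeff h = 0)
    (f : R⟦X⟧) : evalHom₂ g h hg hh (inV f) = subst₁ h f := by
  rw [evalHom₂, RingHom.comp_apply, substHom₂_inV, diagHom_inV]

end Diagonal

section Regular

variable {A : Type*} [Ring A]

theorem eq_zero_of_mul_eq_zero_of_constantCoeff {f g : A⟦X⟧}
    (hf : ∀ a, constantCoeff f * a = 0 → a = 0) (h : f * g = 0) : g = 0 := by
  ext n
  induction n using Nat.strong_induction_on with
  | _ n ih =>
    apply hf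
    have h1 := congrArg (coeff n) h
    rw [coeff_mul, Finset.sum_eq_single (0, n)] at h1
    · simpa using h1
    · rintro ⟨a, b⟩ hab hne
      rw [Finset.HasAntidiagonal.mem_antidiagonal] at hab
      have hb : b < n := by
        rcases Nat.eq_zero_or_pos a with rfl | ha
        · exact absurd (by rw [← hab]; simp) hne
        · simp only at hab; omega
      rw [ih b hb]
      simp
    · simp

/-- All coefficients of `f` commute with all coefficients of `g`. -/
def CoeffCommute (f g : A⟦X⟧) : Prop := ∀ p q, Commute (coeff p f) (coeff q g)

theorem CoeffCommute.symm {f g : A⟦X⟧} (h : CoeffCommute f g) : CoeffCommute g f :=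
  fun p q => (h q p).symm

theorem coeffCommute_iff {f g : A⟦X⟧} : CoeffCommute f g ↔ inU f * inV g = inV g * inU f := by
  constructor
  · intro h
    ext q p
    rw [inU, inV, coeff_C_mul, coeff_mul_C, coeff_map, coeff_mul_C, coeff_C_mul]
    exact h p q
  · intro h p q
    have := congrArg (fun F => coeff p (coeff q F)) h
    simp only [inU, inV, coeff_C_mul, coeff_mul_C, coeff_map] at this
    exact this

theorem CoeffCommute.mul_right {f g h : A⟦X⟧} (hg : CoeffCommute f g) (hh : CoeffCommute f h) :
    CoeffCommute f (g * h) := by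
  intro p q
  rw [coeff_mul]
  exact Commute.sum_right _ _ _ fun x _ => (hg p x.1).mul_right (hh p x.2)

theorem CoeffCommute.add_right {f g h : A⟦X⟧} (hg : CoeffCommute f g) (hh : CoeffCommute f h) :
    CoeffCommute f (g + h) := fun p q => by
  rw [map_add]
  exact (hg p q).add_right (hh p q)

theorem CoeffCommute.neg_right {f g : A⟦X⟧} (hg : CoeffCommute f g) :
    CoeffCommute f (-g) := fun p q => by
  rw [map_neg]
  exact (hg p q).neg_right

theorem CoeffCommute.sub_right {f g h : A⟦X⟧} (hg : CoeffCommute f g) (hh : CoeffCommute f h) :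
    CoeffCommute f (g - h) := by
  rw [sub_eq_add_neg]
  exact hg.add_right hh.neg_right

theorem CoeffCommute.zero_right (f : A⟦X⟧) : CoeffCommute f 0 := fun p q => by
  rw [map_zero]
  exact Commute.zero_right _

theorem CoeffCommute.sum_right {ι : Type*} {f : A⟦X⟧} {s : Finset ι} {g : ι → A⟦X⟧}
    (h : ∀ i ∈ s, CoeffCommute f (g i)) : CoeffCommute f (∑ i ∈ s, g i) := fun p q => by
  rw [map_sum]
  exact Commute.sum_right _ _ _ fun i hi => h i hi p q

theorem CoeffCommute.commute {f g : A⟦X⟧} (h : CoeffCommute f g) : f * g = g * f := by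
  ext n
  rw [coeff_mul, coeff_mul, ← Finset.Nat.sum_antidiagonal_swap]
  exact Finset.sum_congr rfl fun x _ => h x.2 x.1

theorem CoeffCommute.inv_right {f g g' : A⟦X⟧} (h : CoeffCommute f g) (h1 : g * g' = 1)
    (h2 : g' * g = 1) : CoeffCommute f g' := by
  rw [coeffCommute_iff] at h ⊢
  have e1 : inV g * inV g' = 1 := by
    rw [inV, inV, ← map_mul, h1, map_one]
  have e2 : inV g' * inV g = 1 := by
    rw [inV, inV, ← map_mul, h2, map_one]
  calc inU f * inV g' = inV g' * (inV g * inU f) * inV g' := by rw [← mul_assoc (inV g'), e2, one_mul]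
    _ = inV g' * inU f := by rw [← h, mul_assoc, mul_assoc, e1, mul_one]

variable [Algebra ℂ A]

theorem CoeffCommute.subst_right {f g : A⟦X⟧} (h : CoeffCommute f g) (φ : ℂ⟦X⟧) :
    CoeffCommute f (subst₁ φ g) := fun p q => by
  rw [subst₁, coeff_mk]
  exact Commute.sum_right _ _ _ fun i _ => (h p i).smul_right _

theorem CoeffCommute.shift_right {f g : A⟦X⟧} (h : CoeffCommute f g) (c : ℂ) :
    CoeffCommute f (shift c g) := h.subst_right _

theorem CoeffCommute.reflect_right {f g : A⟦X⟧} (h : CoeffCommute f g) :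
    CoeffCommute f (reflect g) := by
  rw [← reflectHom_apply]
  exact h.subst_right _

theorem coeffCommute_scal (f : A⟦X⟧) (c : ℂ⟦X⟧) : CoeffCommute f (scal A c) := fun p q => by
  rw [scal, coeff_map]
  exact (Algebra.commutes _ _).symm

theorem CoeffCommute.smul_right {f g : A⟦X⟧} (h : CoeffCommute f g) (c : ℂ⟦X⟧) :
    CoeffCommute f (c • g) := (coeffCommute_scal f c).mul_right h

theorem CoeffCommute.shift_left {f g : A⟦X⟧} (h : CoeffCommute f g) (c : ℂ) :
    CoeffCommute (shift c f) g := (h.symm.shift_right c).symm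

theorem CoeffCommute.reflect_left {f g : A⟦X⟧} (h : CoeffCommute f g) :
    CoeffCommute (reflect f) g := h.symm.reflect_right.symm

end Regular

/-! ### The reflection equation on two tensor factors -/

section TwoFactors

variable {Z A : Type*} [CommRing Z] [Ring A] [Algebra Z A]
variable {I : Type*} [Fintype I] [DecidableEq I]

/-- The reflection equation for matrices `S = S(u)`, `T = S(v)`, with `u - v = α / γ` and
`u + v = β / η`, in terms of matrix elements and without the sign factors. -/
def Reflection (α γ β η : Z) (S T : Matrix I I A) : Prop := ∀ i j k l,
  (α * β) • (S i j * T k l - T k l * S i j) =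
    (γ * β) • (S k j * T i l - T k j * S i l) - (α * η) • (S i k * T j l - T k i * S l j)
      + (γ * η) • (S k i * T j l - T k i * S j l)

theorem Reflection.submatrix {J : Type*} {α γ β η : Z} {S T : Matrix I I A}
    (h : Reflection α γ β η S T) (f : J → I) :
    Reflection α γ β η (S.submatrix f f) (T.submatrix f f) :=
  fun i j k l => h (f i) (f j) (f k) (f l)

/-- `S` acting in the first tensor factor of `A ⊗ ℂ^I ⊗ ℂ^I`, viewed as a space of matrices. -/
def actFst (Z : Type*) [CommRing Z] [Algebra Z A] (S : Matrix I I A) :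
    Module.End Z (Matrix I I A) where
  toFun M := S * M
  map_add' := Matrix.mul_add S
  map_smul' c M := by simp

/-- The permutation of the two tensor factors. -/
def actSwap (Z A I : Type*) [CommRing Z] [Ring A] [Algebra Z A] :
    Module.End Z (Matrix I I A) where
  toFun M := M.transpose
  map_add' _ _ := rfl
  map_smul' _ _ := rfl

/-- `S` acting in the second tensor factor. -/
def actSnd (Z : Type*) [CommRing Z] [Algebra Z A] (S : Matrix I I A) :
    Module.End Z (Matrix I I A) where
  toFun M := (S * M.transpose).transpose
  map_add' M N := by simp [Matrix.mul_add]
  map_smul' c M := by simp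

/-- The partial transpose of the permutation of the tensor factors. -/
def actContract (Z A I : Type*) [CommRing Z] [Ring A] [Algebra Z A] [Fintype I] [DecidableEq I] :
    Module.End Z (Matrix I I A) where
  toFun M := Matrix.diagonal fun _ => M.trace
  map_add' M N := by simp
  map_smul' c M := by
    ext i j
    by_cases h : i = j <;> simp [h, Matrix.diagonal]

theorem actFst_apply (S M : Matrix I I A) : actFst Z S M = S * M := rfl

theorem actSnd_apply (S M : Matrix I I A) :
    actSnd Z S M = (S * M.transpose).transpose := rfl

theorem actSwap_apply (M : Matrix I I A) : actSwap Z A I M = M.transpose := rfl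

theorem actContract_apply (M : Matrix I I A) :
    actContract Z A I M = Matrix.diagonal fun _ => M.trace := rfl

theorem actFst_mul (S T : Matrix I I A) : actFst Z S * actFst Z T = actFst Z (S * T) := by
  ext1 M
  exact (Matrix.mul_assoc S T M).symm

theorem actSnd_mul (S T : Matrix I I A) : actSnd Z S * actSnd Z T = actSnd Z (S * T) := by
  ext1 M
  simp [actSnd_apply, Matrix.mul_assoc]

theorem actFst_one : actFst Z (1 : Matrix I I A) = 1 := by
  ext1 M
  exact Matrix.one_mul M

theorem actSnd_one : actSnd Z (1 : Matrix I I A) = 1 := by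
  ext1 M
  simp [actSnd_apply]

theorem actSwap_mul_self : actSwap Z A I * actSwap Z A I = 1 := rfl

theorem actContract_mul_self :
    actContract Z A I * actContract Z A I = (Fintype.card I : Z) • actContract Z A I := by
  ext1 M
  ext i j
  show (Matrix.diagonal fun _ => Matrix.trace (Matrix.diagonal fun _ => M.trace)) i j =
    (Fintype.card I : Z) • (Matrix.diagonal fun _ => M.trace) i j
  by_cases h : i = j <;> simp [h, Nat.cast_smul_eq_nsmul, Matrix.trace, Matrix.diagonal]

theorem smul_one_sub_apply (α γ : Z) (p : Module.End Z (Matrix I I A)) (M : Matrix I I A) :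
    (α • (1 : Module.End Z (Matrix I I A)) - γ • p) M = α • M - γ • p M := rfl

theorem smul_one_add_apply (α γ : Z) (p : Module.End Z (Matrix I I A)) (M : Matrix I I A) :
    (α • (1 : Module.End Z (Matrix I I A)) + γ • p) M = α • M + γ • p M := rfl

theorem reflection_left_apply (α γ β η : Z) (S T M : Matrix I I A) (i k : I) :
    ((α • 1 - γ • actSwap Z A I) * actFst Z S * (β • 1 + η • actContract Z A I) *
      actSnd Z T) M i k = ∑ j, ∑ l, (α • (β • (S i j * T k l) + η • (S i k * T j l))
        - γ • (β • (S k j * T i l) + η • (S k i * T j l))) * M j l := by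
  have h : ∀ i k, (actFst Z S ((β • (1 : Module.End Z (Matrix I I A)) + η • actContract Z A I)
      (actSnd Z T M))) i k
      = ∑ j, ∑ l, (β • (S i j * T k l) + η • (S i k * T j l)) * M j l := by
    intro i k
    rw [actFst_apply, smul_one_add_apply, Matrix.mul_add, Matrix.add_apply, actContract_apply,
      Matrix.mul_smul, Matrix.mul_smul, Matrix.smul_apply, Matrix.smul_apply,
      Matrix.mul_diagonal, Matrix.mul_apply, actSnd_apply, Matrix.trace_transpose]
    simp only [Matrix.transpose_apply, Matrix.mul_apply, Matrix.trace, Matrix.diag_apply,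
      Finset.mul_sum, Finset.smul_sum, add_mul, Finset.sum_add_distrib, smul_mul_assoc, mul_assoc]
  show ((α • (1 : Module.End Z (Matrix I I A)) - γ • actSwap Z A I) (actFst Z S
    ((β • (1 : Module.End Z (Matrix I I A)) + η • actContract Z A I) (actSnd Z T M)))) i k = _
  rw [smul_one_sub_apply, Matrix.sub_apply, Matrix.smul_apply, Matrix.smul_apply, actSwap_apply,
    Matrix.transpose_apply, h, h]
  simp only [Finset.smul_sum, sub_mul, Finset.sum_sub_distrib, smul_mul_assoc]

theorem reflection_right_apply (α γ β η : Z) (S T M : Matrix I I A) (i k : I) :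
    (actSnd Z T * (β • 1 + η • actContract Z A I) * actFst Z S *
      (α • 1 - γ • actSwap Z A I)) M i k =
      ∑ j, ∑ l, (α • (β • (T k l * S i j) + η • (T k i * S l j))
        - γ • (β • (T k j * S i l) + η • (T k i * S j l))) * M j l := by
  have h : ∀ N : Matrix I I A, (actSnd Z T ((β • (1 : Module.End Z (Matrix I I A)) +
      η • actContract Z A I) (actFst Z S N))) i k
      = ∑ j, ∑ l, (β • (T k l * S i j) + η • (T k i * S l j)) * N j l := by
    intro N
    rw [actFst_apply, smul_one_add_apply, actSnd_apply, Matrix.transpose_apply,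
      Matrix.transpose_add, Matrix.mul_add, Matrix.add_apply, actContract_apply,
      Matrix.transpose_smul, Matrix.transpose_smul, Matrix.diagonal_transpose,
      Matrix.mul_smul, Matrix.mul_smul, Matrix.smul_apply, Matrix.smul_apply,
      Matrix.mul_diagonal, Matrix.mul_apply]
    simp only [Matrix.transpose_apply, Matrix.mul_apply, Matrix.trace, Matrix.diag_apply,
      Finset.mul_sum, Finset.smul_sum, add_mul, Finset.sum_add_distrib, smul_mul_assoc, mul_assoc]
    congr 1
    · rw [Finset.sum_comm]
    · rw [Finset.sum_comm]
  show (actSnd Z T ((β • (1 : Module.End Z (Matrix I I A)) + η • actContract Z A I)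
    (actFst Z S ((α • (1 : Module.End Z (Matrix I I A)) - γ • actSwap Z A I) M)))) i k = _
  rw [h]
  have h2 : ∀ j l, ((α • (1 : Module.End Z (Matrix I I A)) - γ • actSwap Z A I) M) j l =
      α • M j l - γ • M l j := fun j l => rfl
  simp only [h2, mul_sub, sub_mul, Finset.sum_sub_distrib]
  congr 1
  · simp only [smul_mul_assoc, mul_smul_comm]
  · rw [Finset.sum_comm]
    simp only [smul_mul_assoc, mul_smul_comm]

theorem reflection_iff (α γ β η : Z) (S T : Matrix I I A) : Reflection α γ β η S T ↔
    (α • 1 - γ • actSwap Z A I) * actFst Z S * (β • 1 + η • actContract Z A I) * actSnd Z T =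
      actSnd Z T * (β • 1 + η • actContract Z A I) * actFst Z S *
        (α • 1 - γ • actSwap Z A I) := by
  have key : ∀ i j k l, ((α * β) • (S i j * T k l - T k l * S i j) =
    (γ * β) • (S k j * T i l - T k j * S i l) - (α * η) • (S i k * T j l - T k i * S l j)
      + (γ * η) • (S k i * T j l - T k i * S j l)) ↔
      (α • (β • (S i j * T k l) + η • (S i k * T j l))
        - γ • (β • (S k j * T i l) + η • (S k i * T j l))) =
      (α • (β • (T k l * S i j) + η • (T k i * S l j))
        - γ • (β • (T k j * S i l) + η • (T k i * S j l))) := by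
    intro i j k l
    rw [← sub_eq_zero, ← sub_eq_zero (a := α • _ - _)]
    refine Eq.congr ?_ rfl
    module
  constructor
  · intro h
    ext1 M
    ext i k
    rw [reflection_left_apply, reflection_right_apply]
    refine Finset.sum_congr rfl fun j _ => Finset.sum_congr rfl fun l _ => ?_
    rw [(key i j k l).1 (h i j k l)]
  · intro h i j k l
    rw [key]
    have := congrFun (congrFun (LinearMap.congr_fun h (Matrix.single j l (1 : A))) i) k
    rw [reflection_left_apply, reflection_right_apply] at this
    simpa [Matrix.single_apply, ite_and, Finset.sum_ite_eq] using this

theorem end_smul_cancel {ν : Z} (hν : ∀ x : A, ν • x = 0 → x = 0)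
    {X Y : Module.End Z (Matrix I I A)} (h : ν • X = ν • Y) : X = Y := by
  ext1 M
  ext i k
  have := congrFun (congrFun (LinearMap.congr_fun h M) i) k
  rw [← sub_eq_zero]
  apply hν
  rw [smul_sub, sub_eq_zero]
  exact this

theorem smul_one_sub_mul_smul_one_add {E : Type*} [Ring E] [Algebra Z E] {p : E} (hp : p * p = 1)
    (α γ : Z) : (α • 1 - γ • p) * (α • 1 + γ • p) = (α ^ 2 - γ ^ 2) • (1 : E) := by
  simp only [sub_mul, mul_add, smul_mul_assoc, mul_smul_comm, one_mul, mul_one, hp]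
  module

theorem smul_one_add_mul_smul_one_sub {E : Type*} [Ring E] [Algebra Z E] {p : E} (hp : p * p = 1)
    (α γ : Z) : (α • 1 + γ • p) * (α • 1 - γ • p) = (α ^ 2 - γ ^ 2) • (1 : E) := by
  simp only [add_mul, mul_sub, smul_mul_assoc, mul_smul_comm, one_mul, mul_one, hp]
  module

theorem smul_one_add_mul_of_sq {E : Type*} [Ring E] [Algebra Z E] {k : E} {N : Z}
    (hk : k * k = N • k) (β η : Z) :
    (β • 1 + η • k) * ((β + N * η) • 1 - η • k) = (β * (β + N * η)) • (1 : E) := by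
  simp only [add_mul, mul_sub, smul_mul_assoc, mul_smul_comm, one_mul, mul_one, hk]
  module

theorem smul_one_sub_mul_of_sq {E : Type*} [Ring E] [Algebra Z E] {k : E} {N : Z}
    (hk : k * k = N • k) (β η : Z) :
    ((β + N * η) • 1 - η • k) * (β • 1 + η • k) = (β * (β + N * η)) • (1 : E) := by
  simp only [sub_mul, mul_add, smul_mul_assoc, mul_smul_comm, one_mul, mul_one, hk]
  module

/-- The inverse matrices satisfy the reflection equation with other parameters. -/
theorem Reflection.inverse {α γ β η : Z} {S T S' T' : Matrix I I A}
    (h : Reflection α γ β η S T) (hS : S * S' = 1) (hS' : S' * S = 1) (hT : T * T' = 1)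
    (hT' : T' * T = 1)
    (hν : ∀ x : A, ((α ^ 2 - γ ^ 2) * (β * (β + Fintype.card I * η))) • x = 0 → x = 0) :
    Reflection α (-γ) (β + Fintype.card I * η) (-η) S' T' := by
  rw [reflection_iff] at h ⊢
  set p := actSwap Z A I
  set k := actContract Z A I
  have hs : actFst Z S * actFst Z S' = 1 := by rw [actFst_mul, hS, actFst_one]
  have hs' : actFst Z S' * actFst Z S = 1 := by rw [actFst_mul, hS', actFst_one]
  have ht : actSnd Z T * actSnd Z T' = 1 := by rw [actSnd_mul, hT, actSnd_one]
  have ht' : actSnd Z T' * actSnd Z T = 1 := by rw [actSnd_mul, hT', actSnd_one]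
  have hp := smul_one_sub_mul_smul_one_add (Z := Z) (actSwap_mul_self (Z := Z) (A := A) (I := I)) α γ
  have hp' := smul_one_add_mul_smul_one_sub (Z := Z) (actSwap_mul_self (Z := Z) (A := A) (I := I)) α γ
  have hk := smul_one_add_mul_of_sq (actContract_mul_self (Z := Z) (A := A) (I := I)) β η
  have hk' := smul_one_sub_mul_of_sq (actContract_mul_self (Z := Z) (A := A) (I := I)) β η
  have e1 : (-γ) • p = -(γ • p) := neg_smul γ p
  have e2 : (-η) • k = -(η • k) := neg_smul η k
  rw [e1, sub_neg_eq_add, e2, ← sub_eq_add_neg]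
  set a := α • (1 : Module.End Z (Matrix I I A)) - γ • p
  set a' := α • (1 : Module.End Z (Matrix I I A)) + γ • p
  set b := β • (1 : Module.End Z (Matrix I I A)) + η • k
  set b' := (β + Fintype.card I * η) • (1 : Module.End Z (Matrix I I A)) - η • k
  set s := actFst Z S
  set s' := actFst Z S'
  set t := actSnd Z T
  set t' := actSnd Z T'
  set ν := (α ^ 2 - γ ^ 2) * (β * (β + Fintype.card I * η)) with hνdef
  have h1 : (t' * b' * s' * a') * (a * s * b * t) = ν • 1 := by
    calc _ = t' * b' * s' * (a' * a) * s * b * t := by simp only [mul_assoc]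
      _ = (α ^ 2 - γ ^ 2) • (t' * b' * (s' * s) * b * t) := by
        rw [hp']; simp only [mul_smul_comm, smul_mul_assoc, mul_one, mul_assoc]
      _ = (α ^ 2 - γ ^ 2) • (t' * (b' * b) * t) := by
        rw [hs']; simp only [mul_one, mul_assoc]
      _ = _ := by
        rw [hk']; simp only [mul_smul_comm, smul_mul_assoc, mul_one, ht', smul_smul, ν]
  have h2 : (t * b * s * a) * (a' * s' * b' * t') = ν • 1 := by
    calc _ = t * b * s * (a * a') * s' * b' * t' := by simp only [mul_assoc]
      _ = (α ^ 2 - γ ^ 2) • (t * b * (s * s') * b' * t') := by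
        rw [hp]; simp only [mul_smul_comm, smul_mul_assoc, mul_one, mul_assoc]
      _ = (α ^ 2 - γ ^ 2) • (t * (b * b') * t') := by
        rw [hs]; simp only [mul_one, mul_assoc]
      _ = _ := by
        rw [hk]; simp only [mul_smul_comm, smul_mul_assoc, mul_one, ht, smul_smul, ν]
  refine (end_smul_cancel hν ?_).symm
  calc ν • (t' * b' * s' * a') = (t' * b' * s' * a') * ((t * b * s * a) * (a' * s' * b' * t')) := by
        rw [h2, mul_smul_comm, mul_one]
    _ = ((t' * b' * s' * a') * (a * s * b * t)) * (a' * s' * b' * t') := by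
        rw [h]; simp only [mul_assoc]
    _ = ν • (a' * s' * b' * t') := by rw [h1, smul_mul_assoc, one_mul]

/-- The elements of `S(u)` with indices off those of an element of `S(v)⁻¹` commute with it. -/
theorem Reflection.commute_inverse {α γ β η : Z} {S T T' : Matrix I I A}
    (h : Reflection α γ β η S T) (hT : T * T' = 1) (hT' : T' * T = 1)
    (hν : ∀ x : A, (α * β) • x = 0 → x = 0) {i j a b : I} (hia : i ≠ a) (hib : i ≠ b)
    (hja : j ≠ a) (hjb : j ≠ b) : S i j * T' a b = T' a b * S i j := by
  rw [reflection_iff] at h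
  have ht : actSnd Z T * actSnd Z T' = 1 := by rw [actSnd_mul, hT, actSnd_one]
  have ht' : actSnd Z T' * actSnd Z T = 1 := by rw [actSnd_mul, hT', actSnd_one]
  have h1 : actSnd Z T' * ((α • 1 - γ • actSwap Z A I) * actFst Z S *
      (β • 1 + η • actContract Z A I)) = (β • 1 + η • actContract Z A I) * actFst Z S *
        (α • 1 - γ • actSwap Z A I) * actSnd Z T' := by
    calc _ = actSnd Z T' * ((α • 1 - γ • actSwap Z A I) * actFst Z S *
      (β • 1 + η • actContract Z A I) * actSnd Z T) * actSnd Z T' := by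
          simp only [mul_assoc, ht, mul_one]
      _ = (actSnd Z T' * actSnd Z T) * (β • 1 + η • actContract Z A I) * actFst Z S *
        (α • 1 - γ • actSwap Z A I) * actSnd Z T' := by rw [h]; simp only [mul_assoc]
      _ = _ := by rw [ht', one_mul]
  have h2 := congrFun (congrFun (LinearMap.congr_fun h1 (Matrix.single j b (1 : A))) i) a
  have e1 : actContract Z A I (Matrix.single j b (1 : A)) = 0 := by
    rw [actContract_apply, Matrix.trace_single_eq_of_ne _ _ _ hjb, Matrix.diagonal_zero]
  have h3 : (α * β) • (T' a b * S i j) = (α * β) • (S i j * T' a b) := by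
    have l1 : (actSnd Z T' * ((α • 1 - γ • actSwap Z A I) * actFst Z S *
      (β • 1 + η • actContract Z A I))) (Matrix.single j b (1 : A)) i a =
        (α * β) • (T' a b * S i j) := by
      show actSnd Z T' ((α • (1 : Module.End Z (Matrix I I A)) - γ • actSwap Z A I)
        (actFst Z S ((β • (1 : Module.End Z (Matrix I I A)) + η • actContract Z A I)
          (Matrix.single j b (1 : A))))) i a = _
      rw [smul_one_add_apply, e1, smul_zero, add_zero, smul_one_sub_apply, actSwap_apply,
        actFst_apply, actSnd_apply]
      simp [Matrix.mul_sub, Matrix.mul_apply, Matrix.single_apply, Finset.sum_ite_eq,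
        ite_and, mul_smul, smul_comm α β, hib.symm]
    have l2 : ((β • 1 + η • actContract Z A I) * actFst Z S *
        (α • 1 - γ • actSwap Z A I) * actSnd Z T') (Matrix.single j b (1 : A)) i a =
        (α * β) • (S i j * T' a b) := by
      show (β • (1 : Module.End Z (Matrix I I A)) + η • actContract Z A I) (actFst Z S
        ((α • (1 : Module.End Z (Matrix I I A)) - γ • actSwap Z A I)
        (actSnd Z T' (Matrix.single j b (1 : A))))) i a = _
      rw [smul_one_add_apply, Matrix.add_apply, actContract_apply, Matrix.smul_apply,
        Matrix.smul_apply, Matrix.diagonal_apply_ne _ hia, smul_zero, add_zero,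
        smul_one_sub_apply, actSwap_apply, actFst_apply, actSnd_apply]
      simp [Matrix.mul_apply, Matrix.single_apply, Finset.sum_ite_eq,
        ite_and, mul_smul, smul_comm α β, hja]
    rw [← l1, ← l2]
    exact h2
  rw [← sub_eq_zero]
  apply hν
  rw [smul_sub, h3, sub_self]

end TwoFactors

section Quasideterminants

variable {Z A : Type*} [CommRing Z] [Ring A] [Algebra Z A]

theorem Reflection.smul_fst {I : Type*} {α γ β η : Z} {S T : Matrix I I A}
    (h : Reflection α γ β η S T) (c : Z) : Reflection (c * α) (c * γ) β η S T := by
  intro i j k l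
  have := congrArg (fun x => c • x) (h i j k l)
  simp only [smul_add, smul_sub, smul_smul] at this ⊢
  simpa only [mul_assoc] using this

theorem Reflection.smul_snd {I : Type*} {α γ β η : Z} {S T : Matrix I I A}
    (h : Reflection α γ β η S T) (c : Z) : Reflection α γ (c * β) (c * η) S T := by
  intro i j k l
  have := congrArg (fun x => c • x) (h i j k l)
  simp only [smul_add, smul_sub, smul_smul] at this ⊢
  simpa only [mul_left_comm] using this

theorem Reflection.of_smul {I : Type*} {α γ β η : Z} {S T : Matrix I I A} {c d : Z}
    (h : Reflection (c * α) (c * γ) (d * β) (d * η) S T)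
    (hcd : ∀ x : A, (c * d) • x = 0 → x = 0) : Reflection α γ β η S T := by
  intro i j k l
  rw [← sub_eq_zero]
  apply hcd
  have := h i j k l
  rw [← sub_eq_zero] at this
  rw [← this]
  module

/-- The reflection equation for products with elements commuting with everything. -/
theorem Reflection.mul {I : Type*} {α γ β η : Z} {S T : Matrix I I A} {f g : A}
    (h : Reflection α γ β η S T) (hfg : Commute f g) (hgS : ∀ i j, Commute g (S i j))
    (hfT : ∀ i j, Commute f (T i j)) :
    Reflection α γ β η (fun i j => f * S i j) (fun i j => g * T i j) := by
  intro i j k l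
  have e1 : ∀ i j k l, f * S i j * (g * T k l) = f * g * (S i j * T k l) := fun i j k l => by
    rw [mul_assoc, ← mul_assoc (S i j), ← (hgS i j).eq, mul_assoc, ← mul_assoc]
  have e2 : ∀ i j k l, g * T k l * (f * S i j) = f * g * (T k l * S i j) := fun i j k l => by
    rw [mul_assoc, ← mul_assoc (T k l), ← (hfT k l).eq, mul_assoc, ← mul_assoc, hfg.eq]
  simp only [e1, e2, ← mul_sub, ← mul_smul_comm, ← mul_add]
  rw [h i j k l]

variable {P Q : Type*} [Fintype P] [DecidableEq P] [Fintype Q] [DecidableEq Q]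

open Matrix in
/-- The crossing relation satisfied by quasideterminants. -/
theorem Reflection.crossing {α γ : Z} {S T : Matrix (P ⊕ Q) (P ⊕ Q) A}
    (h : Reflection α γ (-(Fintype.card P : Z)) 1 S T) {YS YT : Matrix P P A} {κ : A}
    (hYS' : YS * S.toBlocks₁₁ = 1) (hYT : T.toBlocks₁₁ * YT = 1)
    (hYT' : YT * T.toBlocks₁₁ = 1)
    (hκ : S.toBlocks₁₁ * (α • YTᵀ - γ • YT) = Matrix.diagonal fun _ => κ)
    (hM : ∀ x : A, (Fintype.card P : Z) • x = 0 → x = 0) (hα : ∀ x : A, α • x = 0 → x = 0)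
    (a b : Q) :
    α • (S.toBlocks₂₂ - S.toBlocks₂₁ * YS * S.toBlocks₁₂) b a
      - γ • (S.toBlocks₂₂ - S.toBlocks₂₁ * YS * S.toBlocks₁₂) a b
      = (T.toBlocks₂₂ - T.toBlocks₂₁ * YT * T.toBlocks₁₂) a b * κ := by
  obtain ⟨S11, S12, S21, S22, rfl⟩ : ∃ a b c d, S = fromBlocks a b c d :=
    ⟨_, _, _, _, (fromBlocks_toBlocks S).symm⟩
  obtain ⟨T11, T12, T21, T22, rfl⟩ : ∃ a b c d, T = fromBlocks a b c d :=
    ⟨_, _, _, _, (fromBlocks_toBlocks T).symm⟩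
  simp only [toBlocks_fromBlocks₁₁, toBlocks_fromBlocks₁₂, toBlocks_fromBlocks₂₁,
    toBlocks_fromBlocks₂₂] at *
  set W : Matrix Q P A := T21 * YT with hW
  set M : Z := (Fintype.card P : Z) with hMdef
  rw [reflection_iff] at h
  have h1 := LinearMap.congr_fun h (fromBlocks YTᵀ 0 0 0)
  have hscal : ∀ x : A, M • x = (Fintype.card P : A) * x :=
    fun x => by rw [hMdef, Nat.cast_smul_eq_nsmul, nsmul_eq_mul]
  have trace_fromBlocks : ∀ (a : Matrix P P A) (b : Matrix P Q A) (c : Matrix Q P A)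
      (d : Matrix Q Q A), (fromBlocks a b c d).trace = a.trace + d.trace := fun a b c d => by
    simp [trace, Fintype.sum_sum_type]
  have hL : ((α • 1 - γ • actSwap Z A (P ⊕ Q)) * actFst Z (fromBlocks S11 S12 S21 S22) *
      (-M • 1 + (1 : Z) • actContract Z A (P ⊕ Q)) * actSnd Z (fromBlocks T11 T12 T21 T22))
      (fromBlocks YTᵀ 0 0 0) = M • fromBlocks 0 (α • (S12 - S11 * Wᵀ))
        (-γ • (S12 - S11 * Wᵀ)ᵀ) (α • (S22 - S21 * Wᵀ) - γ • (S22 - S21 * Wᵀ)ᵀ) := by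
    show (α • (1 : Module.End Z (Matrix (P ⊕ Q) (P ⊕ Q) A)) - γ • actSwap Z A (P ⊕ Q))
      (actFst Z (fromBlocks S11 S12 S21 S22) ((-M • (1 : Module.End Z (Matrix (P ⊕ Q) (P ⊕ Q) A)) +
        (1 : Z) • actContract Z A (P ⊕ Q)) (actSnd Z (fromBlocks T11 T12 T21 T22)
          (fromBlocks YTᵀ 0 0 0)))) = _
    have e1 : actSnd Z (fromBlocks T11 T12 T21 T22) (fromBlocks YTᵀ 0 0 0) =
        fromBlocks 1 Wᵀ 0 0 := by
      rw [actSnd_apply, fromBlocks_transpose, fromBlocks_multiply, fromBlocks_transpose]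
      simp [hYT, hW]
    have e2 : (-M • (1 : Module.End Z (Matrix (P ⊕ Q) (P ⊕ Q) A)) +
        (1 : Z) • actContract Z A (P ⊕ Q)) (fromBlocks 1 Wᵀ 0 0) =
        M • fromBlocks 0 (-Wᵀ) 0 1 := by
      rw [smul_one_add_apply, one_smul, actContract_apply, trace_fromBlocks, trace_one,
        trace_zero, add_zero]
      ext i j
      rcases i with i | i <;> rcases j with j | j <;>
        simp [hscal, Matrix.diagonal, Matrix.one_apply, Matrix.neg_apply]
    rw [e1, e2, LinearMap.map_smul, LinearMap.map_smul, actFst_apply, fromBlocks_multiply,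
      smul_one_sub_apply, actSwap_apply, fromBlocks_transpose]
    congr 1
    ext i j
    rcases i with i | i <;> rcases j with j | j <;> simp [sub_eq_add_neg, add_comm]
  have hκ' : (S11 * (α • YTᵀ - γ • YT)).trace = M • κ := by
    rw [hκ, trace_diagonal]
    simp [hscal]
  have hR : (actSnd Z (fromBlocks T11 T12 T21 T22) * (-M • 1 + (1 : Z) • actContract Z A (P ⊕ Q)) *
      actFst Z (fromBlocks S11 S12 S21 S22) * (α • 1 - γ • actSwap Z A (P ⊕ Q)))
      (fromBlocks YTᵀ 0 0 0) = M • (fromBlocks T11 T12 T21 T22 *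
        fromBlocks 0 (-(S21 * (α • YTᵀ - γ • YT))ᵀ) 0 (diagonal fun _ => κ))ᵀ := by
    show actSnd Z (fromBlocks T11 T12 T21 T22) ((-M • (1 : Module.End Z (Matrix (P ⊕ Q) (P ⊕ Q) A)) +
        (1 : Z) • actContract Z A (P ⊕ Q)) (actFst Z (fromBlocks S11 S12 S21 S22)
      ((α • (1 : Module.End Z (Matrix (P ⊕ Q) (P ⊕ Q) A)) - γ • actSwap Z A (P ⊕ Q))
        (fromBlocks YTᵀ 0 0 0)))) = _
    have e1 : (α • (1 : Module.End Z (Matrix (P ⊕ Q) (P ⊕ Q) A)) - γ • actSwap Z A (P ⊕ Q))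
        (fromBlocks YTᵀ 0 0 0) = fromBlocks (α • YTᵀ - γ • YT) 0 0 0 := by
      rw [smul_one_sub_apply, actSwap_apply, fromBlocks_transpose]
      ext i j
      rcases i with i | i <;> rcases j with j | j <;> simp
    have e2 : (-M • (1 : Module.End Z (Matrix (P ⊕ Q) (P ⊕ Q) A)) +
        (1 : Z) • actContract Z A (P ⊕ Q)) (fromBlocks (S11 * (α • YTᵀ - γ • YT)) 0
          (S21 * (α • YTᵀ - γ • YT)) 0) =
        M • (fromBlocks 0 (-(S21 * (α • YTᵀ - γ • YT))ᵀ) 0 (diagonal fun _ => κ))ᵀ := by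
      rw [smul_one_add_apply, one_smul, actContract_apply, trace_fromBlocks, hκ', trace_zero,
        add_zero, hκ, fromBlocks_transpose, diagonal_transpose]
      ext i j
      rcases i with i | i <;> rcases j with j | j <;>
        simp [Matrix.diagonal]
    rw [e1, actFst_apply, fromBlocks_multiply]
    simp only [Matrix.mul_zero, add_zero]
    rw [e2, LinearMap.map_smul, actSnd_apply, transpose_transpose]
  rw [hL, hR, fromBlocks_multiply, fromBlocks_transpose] at h1
  simp only [Matrix.mul_zero, add_zero, transpose_zero] at h1
  have key : ∀ i j, fromBlocks 0 (α • (S12 - S11 * Wᵀ))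
        (-γ • (S12 - S11 * Wᵀ)ᵀ) (α • (S22 - S21 * Wᵀ) - γ • (S22 - S21 * Wᵀ)ᵀ) i j =
      fromBlocks 0 0
        (T11 * -(S21 * (α • YTᵀ - γ • YT))ᵀ + T12 * (diagonal fun _ => κ : Matrix Q Q A))ᵀ
        (T21 * -(S21 * (α • YTᵀ - γ • YT))ᵀ + T22 * (diagonal fun _ => κ : Matrix Q Q A))ᵀ i j := by
    intro i j
    have h2 := congrFun (congrFun h1 i) j
    rw [Matrix.smul_apply, Matrix.smul_apply, ← sub_eq_zero, ← smul_sub] at h2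
    exact sub_eq_zero.1 (hM _ h2)
  have hF : S12 = S11 * Wᵀ := by
    rw [← sub_eq_zero]
    ext i j
    have := key (Sum.inl i) (Sum.inr j)
    simp at this
    apply hα
    simpa using this
  have hWS : Wᵀ = YS * S12 := by rw [hF, ← Matrix.mul_assoc, hYS', Matrix.one_mul]
  have hG : (S21 * (α • YTᵀ - γ • YT))ᵀ = YT * T12 * (diagonal fun _ => κ : Matrix Q Q A) := by
    have : T11 * -(S21 * (α • YTᵀ - γ • YT))ᵀ + T12 * (diagonal (fun _ => κ) : Matrix Q Q A) = 0 := by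
      ext i j
      have := key (Sum.inr j) (Sum.inl i)
      rw [hF, sub_self] at this
      simpa using this.symm
    rw [Matrix.mul_neg, neg_add_eq_zero] at this
    rw [Matrix.mul_assoc, ← this, ← Matrix.mul_assoc, hYT', Matrix.one_mul]
  have h3 := key (Sum.inr b) (Sum.inr a)
  rw [hG] at h3
  rw [Matrix.mul_assoc, ← hWS]
  have h4 : T21 * -(YT * T12 * (diagonal fun _ => κ : Matrix Q Q A)) + T22 * (diagonal (fun _ => κ) : Matrix Q Q A) =
      (T22 - T21 * YT * T12) * (diagonal fun _ => κ : Matrix Q Q A) := by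
    rw [Matrix.sub_mul, Matrix.mul_neg]
    simp only [Matrix.mul_assoc]
    abel
  simp only [fromBlocks_apply₂₂, h4, transpose_apply, mul_diagonal] at h3
  rw [← h3]
  simp

/-- The Schur complement is inverse to the corresponding block of the inverse matrix. -/
theorem schur_mul {X S : Matrix (P ⊕ Q) (P ⊕ Q) A} {Y : Matrix P P A}
    (hSX : S * X = 1) (hY' : Y * S.toBlocks₁₁ = 1) :
    (S.toBlocks₂₂ - S.toBlocks₂₁ * Y * S.toBlocks₁₂) * X.toBlocks₂₂ = 1 := by
  obtain ⟨S11, S12, S21, S22, rfl⟩ : ∃ a b c d, S = Matrix.fromBlocks a b c d :=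
    ⟨_, _, _, _, (Matrix.fromBlocks_toBlocks S).symm⟩
  obtain ⟨X11, X12, X21, X22, rfl⟩ : ∃ a b c d, X = Matrix.fromBlocks a b c d :=
    ⟨_, _, _, _, (Matrix.fromBlocks_toBlocks X).symm⟩
  rw [Matrix.fromBlocks_multiply, ← Matrix.fromBlocks_one, Matrix.fromBlocks_inj] at hSX
  obtain ⟨-, h12, -, h22⟩ := hSX
  simp only [Matrix.toBlocks_fromBlocks₁₁, Matrix.toBlocks_fromBlocks₁₂,
    Matrix.toBlocks_fromBlocks₂₁, Matrix.toBlocks_fromBlocks₂₂] at *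
  have h1 : X12 = -(Y * (S12 * X22)) := by
    rw [eq_neg_iff_add_eq_zero]
    calc X12 + Y * (S12 * X22) = Y * (S11 * X12 + S12 * X22) := by
          rw [Matrix.mul_add, ← Matrix.mul_assoc Y S11, hY', Matrix.one_mul]
      _ = 0 := by rw [h12, Matrix.mul_zero]
  rw [h1, Matrix.mul_neg] at h22
  rw [Matrix.sub_mul, ← h22]
  simp only [Matrix.mul_assoc]
  abel

theorem mul_schur {X S : Matrix (P ⊕ Q) (P ⊕ Q) A} {Y : Matrix P P A}
    (hXS : X * S = 1) (hY : S.toBlocks₁₁ * Y = 1) :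
    X.toBlocks₂₂ * (S.toBlocks₂₂ - S.toBlocks₂₁ * Y * S.toBlocks₁₂) = 1 := by
  obtain ⟨S11, S12, S21, S22, rfl⟩ : ∃ a b c d, S = Matrix.fromBlocks a b c d :=
    ⟨_, _, _, _, (Matrix.fromBlocks_toBlocks S).symm⟩
  obtain ⟨X11, X12, X21, X22, rfl⟩ : ∃ a b c d, X = Matrix.fromBlocks a b c d :=
    ⟨_, _, _, _, (Matrix.fromBlocks_toBlocks X).symm⟩
  rw [Matrix.fromBlocks_multiply, ← Matrix.fromBlocks_one, Matrix.fromBlocks_inj] at hXS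
  obtain ⟨-, -, h21, h22⟩ := hXS
  simp only [Matrix.toBlocks_fromBlocks₁₁, Matrix.toBlocks_fromBlocks₁₂,
    Matrix.toBlocks_fromBlocks₂₁, Matrix.toBlocks_fromBlocks₂₂] at *
  have h1 : X21 = -(X22 * S21 * Y) := by
    rw [eq_neg_iff_add_eq_zero]
    calc X21 + X22 * S21 * Y = (X21 * S11 + X22 * S21) * Y := by
          rw [Matrix.add_mul, Matrix.mul_assoc X21, hY, Matrix.mul_one]
      _ = 0 := by rw [h21, Matrix.zero_mul]
  rw [h1, Matrix.neg_mul] at h22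
  rw [Matrix.mul_sub, ← h22]
  simp only [Matrix.mul_assoc]
  abel

end Quasideterminants

section SizeTwo

variable {Z A : Type*} [CommRing Z] [Ring A] [Algebra Z A]

/-- The antisymmetric matrix of size two. -/
def Omega (A : Type*) [Ring A] : Matrix (Fin 2) (Fin 2) A := !![0, 1; -1, 0]

theorem Omega_mul_Omega : Omega A * Omega A = -1 := by
  ext i j
  fin_cases i <;> fin_cases j <;> simp [Omega, Matrix.mul_apply, Fin.sum_univ_two]

theorem mul_Omega_mul_apply (U T : Matrix (Fin 2) (Fin 2) A) (i j : Fin 2) :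
    (U * Omega A * T) i j = U i 0 * T 1 j - U i 1 * T 0 j := by
  simp [Omega, Matrix.mul_apply, Fin.sum_univ_two, Matrix.of_apply]
  abel

/-- The matrix `S(-u) Ω S(u - 1)` is antisymmetric. -/
theorem Reflection.antisymm {x c : Z} {S U T : Matrix (Fin 2) (Fin 2) A}
    (h : Reflection 1 1 (2 - x) x S T)
    (hs : ∀ i j, (2 : Z) • S j i - x • S i j = c • U i j) (i j : Fin 2) :
    c • (U * Omega A * T) i j = -(c • (U * Omega A * T) j i) := by
  have hU : ∀ i j l m, c • (U i j * T l m) = (2 : Z) • (S j i * T l m) - x • (S i j * T l m) := by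
    intro i j l m
    rw [← smul_mul_assoc, ← hs, sub_mul, smul_mul_assoc, smul_mul_assoc]
  have hL : ∀ j l, c • (U * Omega A * T) j l = (2 - x) • (T 1 l * S 0 j - T 1 j * S 0 l)
      + x • (T 1 0 * S l j - T 1 0 * S j l) := by
    intro j l
    have h1 := h 0 j 1 l
    rw [← sub_eq_zero] at h1
    rw [mul_Omega_mul_apply, smul_sub, hU, hU, ← sub_eq_zero, ← h1]
    fin_cases j <;> fin_cases l <;> simp <;> module
  rw [hL, hL, ← sub_eq_zero]
  module

theorem actSnd_Omega_mul_sub :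
    actSnd Z (Omega A) * (1 - actSwap Z A (Fin 2)) =
      actContract Z A (Fin 2) * actSnd Z (Omega A) := by
  ext1 M
  show actSnd Z (Omega A) (M - actSwap Z A (Fin 2) M) =
    actContract Z A (Fin 2) (actSnd Z (Omega A) M)
  rw [actSnd_apply, actSwap_apply, actContract_apply, actSnd_apply]
  ext i j
  fin_cases i <;> fin_cases j <;>
    simp [Omega, Fin.sum_univ_two, Matrix.of_apply, Matrix.vecMul, dotProduct,
      Matrix.trace] <;> abel

theorem actSnd_Omega_mul_contract :
    actSnd Z (Omega A) * actContract Z A (Fin 2) =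
      (1 - actSwap Z A (Fin 2)) * actSnd Z (Omega A) := by
  ext1 M
  show actSnd Z (Omega A) (actContract Z A (Fin 2) M) = actSnd Z (Omega A) M -
    actSwap Z A (Fin 2) (actSnd Z (Omega A) M)
  rw [actSnd_apply, actSwap_apply, actContract_apply, actSnd_apply]
  ext i j
  fin_cases i <;> fin_cases j <;>
    simp [Omega, Fin.sum_univ_two, Matrix.of_apply, Matrix.vecMul, dotProduct,
      Matrix.trace] <;> abel

theorem actFst_mul_actSnd_Omega (S : Matrix (Fin 2) (Fin 2) A) :
    actSnd Z (Omega A) * actFst Z S = actFst Z S * actSnd Z (Omega A) := by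
  ext1 M
  show actSnd Z (Omega A) (actFst Z S M) = actFst Z S (actSnd Z (Omega A) M)
  simp only [actSnd_apply, actFst_apply]
  ext i j
  fin_cases j <;>
    simp [Omega, Matrix.mul_apply, Fin.sum_univ_two, Matrix.of_apply, Matrix.vecMul, dotProduct]

/-- The scalar factor of `S(-u) Ω S(u - 1)` commutes with the elements of `S(v)`. -/
theorem Reflection.commute_scalar {a₀ b₀ γ : Z} {S U T : Matrix (Fin 2) (Fin 2) A} {a : A}
    (h1 : Reflection (a₀ + γ) γ (b₀ - γ) γ S T) (h2 : Reflection b₀ γ a₀ γ S U)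
    (ha : U * Omega A * T = a • Omega A)
    (hν : ∀ x : A, ((b₀ ^ 2 - γ ^ 2) * (a₀ * (a₀ + 2 * γ))) • x = 0 → x = 0)
    (i j : Fin 2) : Commute a (S i j) := by
  rw [reflection_iff] at h1 h2
  set p := actSwap Z A (Fin 2) with hp
  set k := actContract Z A (Fin 2) with hk
  set Om := actSnd Z (Omega A) with hOm
  set s := actFst Z S
  set u := actSnd Z U
  set t := actSnd Z T
  set La : Module.End Z (Matrix (Fin 2) (Fin 2) A) := actFst Z (Matrix.diagonal fun _ => a) with hLa
  have e1 : Om * ((a₀ + γ) • 1 - γ • p) = (a₀ • 1 + γ • k) * Om := by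
    have := actSnd_Omega_mul_sub (Z := Z) (A := A)
    calc Om * ((a₀ + γ) • 1 - γ • p) = a₀ • Om + γ • (Om * (1 - p)) := by
          simp only [mul_sub, mul_smul_comm, mul_one]; module
      _ = _ := by rw [this, add_mul, smul_mul_assoc, smul_mul_assoc, one_mul]
  have e2 : Om * ((b₀ - γ) • 1 + γ • k) = (b₀ • 1 - γ • p) * Om := by
    have := actSnd_Omega_mul_contract (Z := Z) (A := A)
    calc Om * ((b₀ - γ) • 1 + γ • k) = (b₀ - γ) • Om + γ • (Om * k) := by
          simp only [mul_add, mul_smul_comm, mul_one]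
      _ = _ := by rw [this]; simp only [sub_mul, smul_mul_assoc, one_mul]; module
  have e3 : Om * s = s * Om := actFst_mul_actSnd_Omega S
  have e4 : u * Om * t = La * Om := by
    rw [hOm, actSnd_mul, actSnd_mul, ha]
    ext1 M
    show actSnd Z (a • Omega A) M = actFst Z _ (actSnd Z (Omega A) M)
    rw [actSnd_apply, actFst_apply, actSnd_apply]
    ext i j
    rw [Matrix.diagonal_mul, Matrix.smul_mul, Matrix.transpose_smul, Matrix.smul_apply,
      smul_eq_mul]
  have e5 : La * p = p * La := by
    ext1 M
    show actFst Z _ (actSwap Z A _ M) = actSwap Z A _ (actFst Z _ M)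
    simp only [actFst_apply, actSwap_apply]
    ext i j
    simp
  have e6 : La * k = k * La := by
    ext1 M
    show actFst Z _ (actContract Z A _ M) = actContract Z A _ (actFst Z _ M)
    simp only [actFst_apply, actContract_apply]
    ext i j
    fin_cases i <;> fin_cases j <;> simp [Matrix.trace, Fin.sum_univ_two, mul_add]
  have e7 : Om * actSnd Z (-Omega A) = 1 := by
    rw [hOm, actSnd_mul, Matrix.mul_neg, Omega_mul_Omega, neg_neg, actSnd_one]
  have x1 : u * Om * ((a₀ + γ) • 1 - γ • p) * s * ((b₀ - γ) • 1 + γ • k) * t =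
      (b₀ • 1 - γ • p) * s * (a₀ • 1 + γ • k) * La * Om := by
    calc _ = u * (Om * ((a₀ + γ) • 1 - γ • p)) * s * ((b₀ - γ) • 1 + γ • k) * t := by
          simp only [mul_assoc]
      _ = u * (a₀ • 1 + γ • k) * (Om * s) * ((b₀ - γ) • 1 + γ • k) * t := by
          rw [e1]; simp only [mul_assoc]
      _ = u * (a₀ • 1 + γ • k) * s * (Om * ((b₀ - γ) • 1 + γ • k)) * t := by
          rw [e3]; simp only [mul_assoc]
      _ = (u * (a₀ • 1 + γ • k) * s * (b₀ • 1 - γ • p)) * Om * t := by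
          rw [e2]; simp only [mul_assoc]
      _ = (b₀ • 1 - γ • p) * s * (a₀ • 1 + γ • k) * (u * Om * t) := by
          rw [← h2]; simp only [mul_assoc]
      _ = _ := by rw [e4]; simp only [mul_assoc]
  have x2 : u * Om * ((a₀ + γ) • 1 - γ • p) * s * ((b₀ - γ) • 1 + γ • k) * t =
      (b₀ • 1 - γ • p) * La * s * (a₀ • 1 + γ • k) * Om := by
    calc _ = u * Om * (((a₀ + γ) • 1 - γ • p) * s * ((b₀ - γ) • 1 + γ • k) * t) := by
          simp only [mul_assoc]
      _ = (u * Om * t) * ((b₀ - γ) • 1 + γ • k) * s * ((a₀ + γ) • 1 - γ • p) := by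
          rw [h1]; simp only [mul_assoc]
      _ = La * (Om * ((b₀ - γ) • 1 + γ • k)) * s * ((a₀ + γ) • 1 - γ • p) := by
          rw [e4]; simp only [mul_assoc]
      _ = La * (b₀ • 1 - γ • p) * (Om * s) * ((a₀ + γ) • 1 - γ • p) := by
          rw [e2]; simp only [mul_assoc]
      _ = La * (b₀ • 1 - γ • p) * s * (Om * ((a₀ + γ) • 1 - γ • p)) := by
          rw [e3]; simp only [mul_assoc]
      _ = (La * (b₀ • 1 - γ • p)) * s * (a₀ • 1 + γ • k) * Om := by
          rw [e1]; simp only [mul_assoc]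
      _ = _ := by
          congr 3
          simp only [mul_sub, sub_mul, mul_smul_comm, smul_mul_assoc, mul_one, one_mul, e5]
  have e8 : (a₀ • 1 + γ • k) * La = La * (a₀ • 1 + γ • k) := by
    simp only [add_mul, mul_add, mul_smul_comm, smul_mul_assoc, mul_one, one_mul, e6]
  have x3 : (b₀ • 1 - γ • p) * (s * La - La * s) * (a₀ • 1 + γ • k) * Om = 0 := by
    rw [mul_sub, sub_mul, sub_mul, sub_eq_zero]
    calc _ = (b₀ • 1 - γ • p) * s * (La * (a₀ • 1 + γ • k)) * Om := by simp only [mul_assoc]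
      _ = (b₀ • 1 - γ • p) * s * (a₀ • 1 + γ • k) * La * Om := by rw [← e8]; simp only [mul_assoc]
      _ = _ := by rw [← x1, x2]; simp only [mul_assoc]
  have hp2 := smul_one_add_mul_smul_one_sub (Z := Z)
    (actSwap_mul_self (Z := Z) (A := A) (I := Fin 2)) b₀ γ
  have hk2 := smul_one_add_mul_of_sq (actContract_mul_self (Z := Z) (A := A) (I := Fin 2)) a₀ γ
  rw [← hp] at hp2
  rw [← hk] at hk2
  have x4 : ((b₀ ^ 2 - γ ^ 2) * (a₀ * (a₀ + 2 * γ))) • (s * La) =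
      ((b₀ ^ 2 - γ ^ 2) * (a₀ * (a₀ + 2 * γ))) • (La * s) := by
    rw [← sub_eq_zero]
    refine (smul_sub _ (s * La) (La * s)).symm.trans ?_
    have hc : (Fintype.card (Fin 2) : Z) = 2 := by simp
    rw [hc] at hk2
    calc _ = ((b₀ ^ 2 - γ ^ 2) • 1) * (s * La - La * s) * ((a₀ * (a₀ + 2 * γ)) • 1) := by
          rw [mul_smul_comm, mul_one, smul_mul_assoc, one_mul, smul_smul,
            mul_comm (a₀ * (a₀ + 2 * γ))]
      _ = (b₀ • 1 + γ • p) * ((b₀ • 1 - γ • p) * (s * La - La * s) * (a₀ • 1 + γ • k) * Om) *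
          actSnd Z (-Omega A) * ((a₀ + 2 * γ) • 1 - γ • k) := by
          rw [← hp2, ← hk2]
          simp only [mul_assoc]
          rw [← mul_assoc Om (actSnd Z (-Omega A)), e7, one_mul]
      _ = 0 := by rw [x3, mul_zero, zero_mul, zero_mul]
  have x5 := end_smul_cancel hν x4
  have x6 := congrFun (congrFun (LinearMap.congr_fun x5 (1 : Matrix (Fin 2) (Fin 2) A)) i) j
  have x7 : (S * ((Matrix.diagonal fun _ => a : Matrix (Fin 2) (Fin 2) A) *
      (1 : Matrix (Fin 2) (Fin 2) A))) i j = ((Matrix.diagonal fun _ => a :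
      Matrix (Fin 2) (Fin 2) A) * (S * (1 : Matrix (Fin 2) (Fin 2) A))) i j := x6
  rw [Matrix.mul_one, Matrix.mul_one, Matrix.mul_diagonal, Matrix.diagonal_mul] at x7
  exact x7.symm

end SizeTwo

/-! ### Invertible matrices of series -/

section MatrixUnits

variable {A I : Type*} [Ring A] [Fintype I] [DecidableEq I]

/-- A series of matrices as a matrix of series. -/
def seriesToMatrix (F : (Matrix I I A)⟦X⟧) : Matrix I I A⟦X⟧ :=
  fun i j => PowerSeries.mk fun n => coeff n F i j

theorem seriesToMatrix_mul (F G : (Matrix I I A)⟦X⟧) :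
    seriesToMatrix (F * G) = seriesToMatrix F * seriesToMatrix G := by
  ext i j n
  simp only [seriesToMatrix, coeff_mk, coeff_mul, Matrix.sum_apply, Matrix.mul_apply, map_sum]
  rw [Finset.sum_comm]

theorem seriesToMatrix_one : seriesToMatrix (1 : (Matrix I I A)⟦X⟧) = 1 := by
  ext i j n
  rw [seriesToMatrix, coeff_mk, coeff_one, Matrix.one_apply]
  split_ifs with h1 h2 h2 <;> simp [coeff_one, h1, h2, Matrix.one_apply]

theorem exists_matrix_inverse (S : Matrix I I A⟦X⟧) (W : Matrix I I A)
    (h1 : S.map constantCoeff * W = 1) (h2 : W * S.map constantCoeff = 1) :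
    ∃ Y : Matrix I I A⟦X⟧, S * Y = 1 ∧ Y * S = 1 := by
  set F : (Matrix I I A)⟦X⟧ := PowerSeries.mk fun n => S.map (coeff n) with hF
  have hS : seriesToMatrix F = S := by
    ext i j n
    simp [seriesToMatrix, F]
  have h0 : constantCoeff F = S.map constantCoeff := by
    rw [← coeff_zero_eq_constantCoeff_apply, hF, coeff_mk, coeff_zero_eq_constantCoeff]
  have hu : IsUnit F := by
    rw [isUnit_iff_constantCoeff, h0]
    exact ⟨⟨_, W, h1, h2⟩, rfl⟩
  obtain ⟨⟨_, G, hFG, hGF⟩, rfl⟩ := hu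
  refine ⟨seriesToMatrix G, ?_, ?_⟩
  · rw [← hS, ← seriesToMatrix_mul, hFG, seriesToMatrix_one]
  · rw [← hS, ← seriesToMatrix_mul, hGF, seriesToMatrix_one]

end MatrixUnits

/-! ### Torsion -/

section Torsion

/-- No nonzero scalar annihilates a nonzero element. -/
def TorsionFree (Z A : Type*) [CommRing Z] [Ring A] [Algebra Z A] : Prop :=
  ∀ c : Z, c ≠ 0 → ∀ a : A, c • a = 0 → a = 0

variable {Z A : Type*} [CommRing Z] [Ring A] [Algebra Z A]

theorem TorsionFree.series (h : TorsionFree Z A) : TorsionFree Z⟦X⟧ A⟦X⟧ := by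
  intro c hc f hf
  obtain ⟨k, c', hc', rfl⟩ : ∃ (k : ℕ) (c' : Z⟦X⟧), constantCoeff c' ≠ 0 ∧ c = X ^ k * c' := by
    obtain ⟨n, hn⟩ := exists_coeff_ne_zero_iff_ne_zero.2 hc
    induction n generalizing c with
    | zero => exact ⟨0, c, by simpa using hn, by simp⟩
    | succ n ih =>
      by_cases h0 : constantCoeff c = 0
      · obtain ⟨d, rfl⟩ := X_dvd_iff.2 h0
        rw [coeff_succ_X_mul] at hn
        have hd : d ≠ 0 := by
          rintro rfl
          simp at hn
        have hdf : d • f = 0 := by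
          rw [mul_smul] at hf
          ext n
          have := congrArg (coeff (n + 1)) hf
          rw [Algebra.smul_def, series_algebraMap, map_X, coeff_succ_X_mul] at this
          simpa using this
        obtain ⟨k, c', h1, rfl⟩ := ih d hd hdf hn
        exact ⟨k + 1, c', h1, by rw [pow_succ', mul_assoc]⟩
      · exact ⟨0, c, h0, by simp⟩
  have hf' : c' • f = 0 := by
    rw [mul_smul, Algebra.smul_def, series_algebraMap, map_pow, map_X] at hf
    ext n
    have := congrArg (coeff (n + k)) hf
    rwa [coeff_X_pow_mul] at this
  refine eq_zero_of_mul_eq_zero_of_constantCoeff (f := algebraMap Z⟦X⟧ A⟦X⟧ c') ?_ ?_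
  · intro a ha
    refine h _ hc' a ?_
    rwa [series_algebraMap, ← coeff_zero_eq_constantCoeff_apply, coeff_map,
      coeff_zero_eq_constantCoeff_apply, ← Algebra.smul_def] at ha
  · rwa [← Algebra.smul_def]

theorem torsionFree_of_field {F A : Type*} [Field F] [Ring A] [Algebra F A] :
    TorsionFree F A := fun c hc a ha => by
  simpa [smul_smul, inv_mul_cancel₀ hc] using congrArg (fun b => c⁻¹ • b) ha

end Torsion

/-! ### The reflection equation and the symmetry relation for matrices of series -/

section SeriesReflection

theorem Reflection.map {Z W A B I : Type*} [CommRing Z] [CommRing W] [Ring A] [Ring B]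
    [Algebra Z A] [Algebra W B] {α γ β η : Z} {S T : Matrix I I A}
    (h : Reflection α γ β η S T) (ψ : A →+* B) (ψ₀ : Z →+* W)
    (hψ : ∀ (c : Z) (a : A), ψ (c • a) = ψ₀ c • ψ a) :
    Reflection (ψ₀ α) (ψ₀ γ) (ψ₀ β) (ψ₀ η) (S.map ψ) (T.map ψ) := by
  intro i j k l
  have := congrArg ψ (h i j k l)
  simp only [map_add, map_sub, map_mul, hψ] at this
  simpa only [map_add, map_sub, map_mul, Matrix.map_apply] using this

variable {R : Type*} [Ring R] [Algebra ℂ R]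

theorem substHom_smul (g : ℂ⟦X⟧) (hg : constantCoeff g = 0) (c : ℂ⟦X⟧) (f : R⟦X⟧) :
    substHom g hg (c • f) = substHom g hg c • substHom g hg f := by
  rw [← scal_mul_eq_smul, map_mul, substHom_apply, subst₁_scal]
  rfl

theorem smul_const_eq (c : ℂ) (f : R⟦X⟧) : (C c : ℂ⟦X⟧) • f = c • f := by
  ext n
  rw [← scal_mul_eq_smul, scal, map_C, coeff_C_mul, coeff_smul, Algebra.smul_def]

theorem substHom₂_smul (g h : ℂ⟦X⟧) (hg : constantCoeff g = 0) (hh : constantCoeff h = 0)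
    (c : ℂ⟦X⟧⟦X⟧) (f : R⟦X⟧⟦X⟧) :
    substHom₂ g h hg hh (c • f) = substHom₂ g h hg hh c • substHom₂ g h hg hh f := by
  rw [Algebra.smul_def, map_mul, Algebra.smul_def]
  congr 1
  rw [series_algebraMap, series_algebraMap, substHom₂, substHom₂, RingHom.comp_apply,
    RingHom.comp_apply, substHom_apply, substHom_apply]
  have e : PowerSeries.map (substHom g hg) (PowerSeries.map (algebraMap ℂ⟦X⟧ R⟦X⟧) c) =
      PowerSeries.map (algebraMap ℂ⟦X⟧ R⟦X⟧) (PowerSeries.map (substHom g hg) c) := by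
    ext1 n
    simp only [coeff_map, algebraMap_eq_scal]
    exact subst₁_scal g _
  rw [e]
  refine subst₁_map _ (fun a f => ?_) h _
  ext n
  rw [algebraMap_eq_scal, algebraMap_eq_scal, scal, coeff_map, coeff_smul, coeff_smul, coeff_map,
    smul_eq_mul, map_mul, Algebra.smul_def]

theorem diagHom_smul (c : ℂ⟦X⟧⟦X⟧) (f : R⟦X⟧⟦X⟧) :
    diagHom (c • f) = diagHom c • diagHom f := by
  rw [Algebra.smul_def, map_mul, Algebra.smul_def]
  congr 1
  ext n
  rw [series_algebraMap, series_algebraMap]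
  show coeff n (diag _) = coeff n (PowerSeries.map _ (diag _))
  simp [diag, algebraMap_eq_scal, scal]

theorem evalHom₂_smul (g h : ℂ⟦X⟧) (hg : constantCoeff g = 0) (hh : constantCoeff h = 0)
    (c : ℂ⟦X⟧⟦X⟧) (f : R⟦X⟧⟦X⟧) :
    evalHom₂ g h hg hh (c • f) = evalHom₂ g h hg hh c • evalHom₂ g h hg hh f := by
  rw [evalHom₂, evalHom₂, RingHom.comp_apply, substHom₂_smul, diagHom_smul]
  rfl

/-- The variable `u⁻¹` in two variables. -/
abbrev xU : ℂ⟦X⟧⟦X⟧ := inU X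

/-- The variable `v⁻¹` in two variables. -/
abbrev yV : ℂ⟦X⟧⟦X⟧ := inV X

theorem torsionFree_series : TorsionFree ℂ⟦X⟧ R⟦X⟧ := torsionFree_of_field.series

theorem torsionFree_series₂ : TorsionFree ℂ⟦X⟧⟦X⟧ R⟦X⟧⟦X⟧ := torsionFree_series.series

theorem inV_X : (inV X : ℂ⟦X⟧⟦X⟧) = X := by simp [inV]

theorem constantCoeff_yV : constantCoeff yV = 0 := by rw [yV, inV_X]; simp

theorem constantCoeff_xU : constantCoeff xU = X := by rw [xU, inU]; simp

variable {I : Type*} [Fintype I] [DecidableEq I]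

/-- The reflection equation with denominators `u² - v²` cleared; the spectral parameter of the
second factor of the transposed `R`-matrix is shifted by `2 c`. -/
def SeriesReflection (c : ℂ) (S : Matrix I I R⟦X⟧) : Prop :=
  Reflection (yV - xU) (xU * yV) (yV + xU + C (C (2 * c)) * (xU * yV)) (xU * yV)
    (S.map inU) (S.map inV)

/-- The quadratic and the symmetry relations of twisted Yangians, in terms of the matrix of
generators without sign factors. -/
structure IsTwisted (ε : ℂ) (S : Matrix I I R⟦X⟧) : Prop where
  refl : SeriesReflection 0 S
  symm : ∀ i j, (2 : ℂ⟦X⟧) • S j i - (X : ℂ⟦X⟧) • S i j = (C (2 * ε) - X) • reflect (S i j)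

theorem SeriesReflection.submatrix {J : Type*} [Fintype J] [DecidableEq J] {c : ℂ}
    {S : Matrix I I R⟦X⟧}
    (h : SeriesReflection c S) (f : J → I) : SeriesReflection c (S.submatrix f f) :=
  Reflection.submatrix h f

theorem IsTwisted.submatrix {J : Type*} [Fintype J] [DecidableEq J] {ε : ℂ} {S : Matrix I I R⟦X⟧}
    (h : IsTwisted ε S) (f : J → I) : IsTwisted ε (S.submatrix f f) :=
  ⟨h.refl.submatrix f, fun i j => h.symm (f i) (f j)⟩

theorem map_inU_mul (S T : Matrix I I R⟦X⟧) :
    S.map inU * T.map inU = (S * T).map inU := by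
  ext i j : 2
  simp [Matrix.mul_apply, inU]

theorem map_inV_mul (S T : Matrix I I R⟦X⟧) :
    S.map inV * T.map inV = (S * T).map inV := by
  ext i j : 2
  simp [Matrix.mul_apply, inV]

theorem map_inU_one : (1 : Matrix I I R⟦X⟧).map inU = 1 := Matrix.map_one _ (by simp [inU]) (by simp [inU])

theorem map_inV_one : (1 : Matrix I I R⟦X⟧).map inV = 1 := Matrix.map_one _ (by simp [inV]) (by simp [inV])

theorem two_var_ne_zero_sub : (yV - xU) ^ 2 - (xU * yV) ^ 2 ≠ 0 := by
  intro h
  have := congrArg constantCoeff h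
  simp [constantCoeff_yV, constantCoeff_xU] at this

theorem two_var_ne_zero_add (c : ℂ⟦X⟧⟦X⟧) : yV + xU + c * (xU * yV) ≠ 0 := by
  intro h
  have := congrArg constantCoeff h
  simp [constantCoeff_yV, constantCoeff_xU] at this

/-- The submatrix of the inverse of `S`, inverted again, satisfies the reflection equation. -/
theorem SeriesReflection.schur {J : Type*} [Fintype J] [DecidableEq J] {c : ℂ}
    {S Y : Matrix I I R⟦X⟧} (h : SeriesReflection c S) (h1 : S * Y = 1) (h2 : Y * S = 1)
    (f : J → I) {q : Matrix J J R⟦X⟧} (h3 : q * Y.submatrix f f = 1)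
    (h4 : Y.submatrix f f * q = 1) :
    SeriesReflection (c + (Fintype.card I - Fintype.card J) / 2) q := by
  have e1 := Reflection.inverse h (S' := Y.map inU) (T' := Y.map inV)
    (by rw [map_inU_mul, h1, map_inU_one]) (by rw [map_inU_mul, h2, map_inU_one])
    (by rw [map_inV_mul, h1, map_inV_one]) (by rw [map_inV_mul, h2, map_inV_one])
    (torsionFree_series₂ _ (by
      refine mul_ne_zero two_var_ne_zero_sub (mul_ne_zero (two_var_ne_zero_add _) ?_)
      rw [add_assoc, ← add_mul]
      exact two_var_ne_zero_add _))
  have e2 := (e1.submatrix f).inverse (S' := q.map inU) (T' := q.map inV)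
    (by rw [Matrix.submatrix_map, map_inU_mul, h4, map_inU_one])
    (by rw [Matrix.submatrix_map, map_inU_mul, h3, map_inU_one])
    (by rw [Matrix.submatrix_map, map_inV_mul, h4, map_inV_one])
    (by rw [Matrix.submatrix_map, map_inV_mul, h3, map_inV_one])
    (torsionFree_series₂ _ (by
      rw [neg_sq, add_assoc _ (C _ * (xU * yV)), ← add_mul, mul_neg, ← neg_mul, add_assoc _ (_ * _),
        ← add_mul]
      exact mul_ne_zero two_var_ne_zero_sub
        (mul_ne_zero (two_var_ne_zero_add _) (two_var_ne_zero_add _))))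
  have e3 : yV + xU + C (C (2 * c)) * (xU * yV) + (Fintype.card I : ℂ⟦X⟧⟦X⟧) * (xU * yV) +
      (Fintype.card J : ℂ⟦X⟧⟦X⟧) * -(xU * yV) =
      yV + xU + C (C (2 * (c + (Fintype.card I - Fintype.card J) / 2))) * (xU * yV) := by
    have : (C (C (2 * (c + (Fintype.card I - Fintype.card J) / 2))) : ℂ⟦X⟧⟦X⟧) =
        C (C (2 * c)) + (Fintype.card I : ℂ⟦X⟧⟦X⟧) - (Fintype.card J : ℂ⟦X⟧⟦X⟧) := by
      rw [mul_add, mul_div_cancel₀ _ (two_ne_zero' ℂ)]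
      simp [add_sub]
    rw [this]
    ring
  rw [neg_neg, e3] at e2
  exact e2

theorem xU_mul (c : ℂ) : (1 - C (C c) * xU) * inU (invLin (-c)) = xU := by
  have := congrArg (C : ℂ⟦X⟧ →+* ℂ⟦X⟧⟦X⟧) (one_add_C_mul_X_mul_invLin (-c))
  simpa [xU, inU, sub_eq_add_neg] using this

theorem yV_mul (c : ℂ) : (1 - C (C c) * yV) * inV (invLin (-c)) = yV := by
  have := congrArg (PowerSeries.map (C : ℂ →+* ℂ⟦X⟧)) (one_add_C_mul_X_mul_invLin (-c))
  simpa [yV, inV, sub_eq_add_neg] using this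

theorem Reflection.congr_param {Z A I : Type*} [CommRing Z] [Ring A] [Algebra Z A]
    {α γ β η α' γ' β' η' : Z} {S T S' T' : Matrix I I A} (h : Reflection α γ β η S T)
    (h1 : α = α') (h2 : γ = γ') (h3 : β = β') (h4 : η = η') (h5 : S = S') (h6 : T = T') :
    Reflection α' γ' β' η' S' T' := by
  subst h1 h2 h3 h4 h5 h6
  exact h

theorem substHom₂_C (g h : ℂ⟦X⟧) (hg : constantCoeff g = 0) (hh : constantCoeff h = 0) (c : ℂ) :
    substHom₂ g h hg hh (C (C c)) = C (C c) := by
  have := substHom₂_inU g h hg hh (C c)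
  rwa [subst₁_C] at this

theorem C_two_mul (c : ℂ) : (C (2 * c) : ℂ⟦X⟧) = 2 * C c := by rw [map_mul, map_ofNat]

theorem SeriesReflection.shift {c : ℂ} {S : Matrix I I R⟦X⟧} (h : SeriesReflection c S) :
    SeriesReflection 0 (S.map (shift (-c))) := by
  have h1 := Reflection.map h _ _ (substHom₂_smul (invLin (-c)) (invLin (-c))
    (constantCoeff_invLin _) (constantCoeff_invLin _))
  simp only [map_sub, map_add, map_mul, map_ofNat, substHom₂_inU, substHom₂_inV,
    substHom₂_C, subst₁_X _ (constantCoeff_invLin _)] at h1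
  have h2 := (h1.smul_fst ((1 - C (C c) * xU) * (1 - C (C c) * yV))).smul_snd
    ((1 - C (C c) * xU) * (1 - C (C c) * yV))
  have hx := xU_mul c
  have hy := yV_mul c
  refine h2.congr_param ?_ ?_ ?_ ?_ ?_ ?_
  · linear_combination (1 - C (C c) * xU) * hy - (1 - C (C c) * yV) * hx
  · linear_combination (1 - C (C c) * xU) * inU (invLin (-c)) * hy + yV * hx
  · simp only [mul_zero, map_zero, zero_mul, add_zero]
    linear_combination (1 - C (C c) * xU) * hy + (1 - C (C c) * yV) * hx
      + 2 * C (C c) * ((1 - C (C c) * xU) * inU (invLin (-c)) * hy + yV * hx)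
  · linear_combination (1 - C (C c) * xU) * inU (invLin (-c)) * hy + yV * hx
  · ext1 i j
    exact substHom₂_inU _ _ (constantCoeff_invLin _) (constantCoeff_invLin _) _
  · ext1 i j
    exact substHom₂_inV _ _ (constantCoeff_invLin _) (constantCoeff_invLin _) _

theorem X_mul_neg (c : ℂ) : (1 - C c * X) * invLin (-c) = X := by
  have := one_add_C_mul_X_mul_invLin (-c)
  rwa [map_neg, neg_mul, ← sub_eq_add_neg] at this

/-- The reflection equation at opposite values of the spectral parameters, up to a shift. -/
theorem SeriesReflection.opposite {S : Matrix I I R⟦X⟧} (h : SeriesReflection 0 S) (c : ℂ) :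
    Reflection 2 (X : ℂ⟦X⟧) (-(C (2 * c))) 1 (S.map (TwistedYangian.shift (-c)))
      (S.map fun f => reflect (TwistedYangian.shift (-c) f)) := by
  have hh : constantCoeff (-invLin c) = 0 := by rw [map_neg, constantCoeff_invLin, neg_zero]
  have h1 := Reflection.map h _ _ (evalHom₂_smul (invLin (-c)) (-invLin c)
    (constantCoeff_invLin _) hh)
  simp only [mul_zero, map_zero, zero_mul, add_zero] at h1
  simp only [map_sub, map_add, map_mul, evalHom₂_inU, evalHom₂_inV,
    subst₁_X _ (constantCoeff_invLin _), subst₁_X _ hh] at h1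
  have h2 := (h1.smul_fst ((1 - C c * X) * (1 + C c * X))).smul_snd
    ((1 - C c * X) * (1 + C c * X))
  have hx := X_mul_neg c
  have hy := one_add_C_mul_X_mul_invLin c
  refine Reflection.of_smul (c := -X) (d := -X ^ 2) (h2.congr_param ?_ ?_ ?_ ?_ ?_ ?_)
    (torsionFree_series _ (by simp [X_ne_zero]))
  · linear_combination -(1 - C c * X) * hy - (1 + C c * X) * hx
  · linear_combination -(1 - C c * X) * invLin (-c) * hy - X * hx
  · rw [C_two_mul]
    linear_combination -(1 - C c * X) * hy + (1 + C c * X) * hx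
  · linear_combination -(1 - C c * X) * invLin (-c) * hy - X * hx
  · ext1 i j
    exact evalHom₂_inU _ _ (constantCoeff_invLin _) hh _
  · ext1 i j
    refine (evalHom₂_inV _ _ (constantCoeff_invLin _) hh _).trans ?_
    simp only [Matrix.map_apply]
    rw [← reflectHom_apply]
    refine Eq.trans ?_ (subst₁_subst₁ constantCoeff_neg_X (constantCoeff_invLin (-c)) (S i j)).symm
    rw [subst₁_neg_X_invLin, neg_neg]

/-- The elements of the inverse matrix commute with those of the complementary submatrix. -/
theorem SeriesReflection.commute_inverse {c : ℂ} {S Y : Matrix I I R⟦X⟧}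
    (h : SeriesReflection c S) (h1 : S * Y = 1) (h2 : Y * S = 1) {i j a b : I} (hia : i ≠ a)
    (hib : i ≠ b) (hja : j ≠ a) (hjb : j ≠ b) : CoeffCommute (S i j) (Y a b) := by
  rw [coeffCommute_iff]
  refine Reflection.commute_inverse h (T' := Y.map inV) (by rw [map_inV_mul, h1, map_inV_one])
    (by rw [map_inV_mul, h2, map_inV_one]) (torsionFree_series₂ _
      (mul_ne_zero ?_ (two_var_ne_zero_add _))) hia hib hja hjb
  intro h
  have := congrArg constantCoeff h
  simp [constantCoeff_yV, constantCoeff_xU] at this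

theorem CoeffCommute.matrix_inverse {f : R⟦X⟧} {S Y : Matrix I I R⟦X⟧}
    (h : ∀ i j, CoeffCommute f (S i j)) (h1 : S * Y = 1) (h2 : Y * S = 1) (i j : I) :
    CoeffCommute f (Y i j) := by
  rw [coeffCommute_iff]
  set D : Matrix I I R⟦X⟧⟦X⟧ := Matrix.diagonal fun _ => inU f with hD
  have e1 : D * S.map inV = S.map inV * D := by
    ext1 i j
    rw [hD, Matrix.diagonal_mul, Matrix.mul_diagonal]
    exact coeffCommute_iff.1 (h i j)
  have e2 : D * Y.map inV = Y.map inV * D := by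
    have h1' : S.map inV * Y.map inV = 1 := by rw [map_inV_mul, h1, map_inV_one]
    have h2' : Y.map inV * S.map inV = 1 := by rw [map_inV_mul, h2, map_inV_one]
    calc D * Y.map inV = Y.map inV * (S.map inV * D) * Y.map inV := by
          rw [← Matrix.mul_assoc, h2', Matrix.one_mul]
      _ = Y.map inV * D * (S.map inV * Y.map inV) := by
          rw [← e1]; simp only [Matrix.mul_assoc]
      _ = _ := by rw [h1', Matrix.mul_one]
  have := congrFun (congrFun e2 i) j
  rwa [hD, Matrix.diagonal_mul, Matrix.mul_diagonal] at this

end SeriesReflection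

section Elimination

variable {R : Type*} [Ring R] [Algebra ℂ R]
variable {P Q : Type*} [Fintype P] [DecidableEq P] [Fintype Q] [DecidableEq Q]

theorem reflect_mul (f g : R⟦X⟧) : reflect (f * g) = reflect f * reflect g := by
  simp only [← reflectHom_apply, map_mul]

theorem reflect_add (f g : R⟦X⟧) : reflect (f + g) = reflect f + reflect g := by
  simp only [← reflectHom_apply, map_add]

theorem reflect_sub (f g : R⟦X⟧) : reflect (f - g) = reflect f - reflect g := by
  simp only [← reflectHom_apply, map_sub]

theorem reflect_neg (f : R⟦X⟧) : reflect (-f) = -reflect f := by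
  simp only [← reflectHom_apply, map_neg]

theorem reflect_one : reflect (1 : R⟦X⟧) = 1 := by
  simp only [← reflectHom_apply, map_one]

theorem shift_add (c : ℂ) (f g : R⟦X⟧) : shift c (f + g) = shift c f + shift c g :=
  map_add (shiftHom c) f g

theorem shift_sub (c : ℂ) (f g : R⟦X⟧) : shift c (f - g) = shift c f - shift c g :=
  map_sub (shiftHom c) f g

theorem shift_neg (c : ℂ) (f : R⟦X⟧) : shift c (-f) = -shift c f :=
  map_neg (shiftHom c) f

theorem shift_one (c : ℂ) : shift c (1 : R⟦X⟧) = 1 := map_one (shiftHom c)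

theorem shift_smul (c : ℂ) (a : ℂ⟦X⟧) (f : R⟦X⟧) : shift c (a • f) = shift c a • shift c f :=
  substHom_smul _ (constantCoeff_invLin c) a f

theorem reflect_smul (a : ℂ⟦X⟧) (f : R⟦X⟧) : reflect (a • f) = reflect a • reflect f := by
  simp only [← reflectHom_apply]
  exact substHom_smul _ constantCoeff_neg_X a f

theorem map_shift_mul {I : Type*} [Fintype I] (c : ℂ) (S T : Matrix I I R⟦X⟧) :
    (S * T).map (shift c) = S.map (shift c) * T.map (shift c) :=
  Matrix.map_mul (f := shiftHom c)

theorem map_reflect_mul {I : Type*} [Fintype I] (S T : Matrix I I R⟦X⟧) :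
    (S * T).map reflect = S.map reflect * T.map reflect := by
  have : (reflect : R⟦X⟧ → R⟦X⟧) = reflectHom := funext fun f => (reflectHom_apply f).symm
  rw [this]
  exact Matrix.map_mul

theorem map_shift_one {I : Type*} [DecidableEq I] (c : ℂ) :
    (1 : Matrix I I R⟦X⟧).map (shift c) = 1 :=
  Matrix.map_one (shiftHom c) (map_zero _) (map_one _)

theorem map_reflect_one {I : Type*} [DecidableEq I] :
    (1 : Matrix I I R⟦X⟧).map reflect = 1 := by
  have : (reflect : R⟦X⟧ → R⟦X⟧) = reflectHom := funext fun f => (reflectHom_apply f).symm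
  rw [this]
  exact Matrix.map_one _ (map_zero _) (map_one _)

theorem SeriesReflection.mul {I : Type*} [Fintype I] [DecidableEq I] {c : ℂ} {D : R⟦X⟧}
    {S : Matrix I I R⟦X⟧} (h : SeriesReflection c S)
    (hD : CoeffCommute D D) (hS : ∀ i j, CoeffCommute D (S i j)) :
    SeriesReflection c (fun i j => D * S i j) := by
  refine (Reflection.mul (f := inU D) (g := inV D) h ?_ (fun i j => ?_) fun i j => ?_).congr_param
    rfl rfl rfl rfl ?_ ?_
  · exact coeffCommute_iff.1 hD
  · exact (coeffCommute_iff.1 (hS i j).symm).symm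
  · exact coeffCommute_iff.1 (hS i j)
  · ext1 i j
    exact (map_mul C D (S i j)).symm
  · ext1 i j
    exact (map_mul (PowerSeries.map C) D (S i j)).symm

theorem two_series_ne_zero : (2 : ℂ⟦X⟧) ≠ 0 := fun h => by
  have := congrArg constantCoeff h
  rw [map_ofNat] at this
  simp at this

/-- A twisted matrix is obtained from a quasideterminant and a suitable scalar series. -/
theorem IsTwisted.schur {ε : ℂ} {S X' : Matrix (P ⊕ Q) (P ⊕ Q) R⟦X⟧} {Y : Matrix P P R⟦X⟧}
    {q : Matrix Q Q R⟦X⟧} {D κ : R⟦X⟧} (h : IsTwisted ε S) (hX : S * X' = 1) (hX' : X' * S = 1)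
    (hY : S.toBlocks₁₁ * Y = 1) (hY' : Y * S.toBlocks₁₁ = 1)
    (hq : q * X'.toBlocks₂₂ = 1) (hq' : X'.toBlocks₂₂ * q = 1) (hP : (Fintype.card P : ℂ) ≠ 0)
    (hD : CoeffCommute D D) (hDq : ∀ a b, CoeffCommute D (q a b))
    (hκ : S.toBlocks₁₁.map (shift (-((Fintype.card P : ℂ) / 2))) * ((2 : ℂ⟦X⟧) •
      (Y.map fun f => reflect (shift (-((Fintype.card P : ℂ) / 2)) f)).transpose - (X : ℂ⟦X⟧) •
      (Y.map fun f => reflect (shift (-((Fintype.card P : ℂ) / 2)) f))) =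
        Matrix.diagonal fun _ => κ)
    (hDκ : D * κ = (C (2 * ε) - X : ℂ⟦X⟧) • reflect D) :
    IsTwisted ε (fun a b => D * shift (-((Fintype.card P : ℂ) / 2)) (q a b)) := by
  set c : ℂ := (Fintype.card P : ℂ) / 2 with hc
  have hqS : q = S.toBlocks₂₂ - S.toBlocks₂₁ * Y * S.toBlocks₁₂ := by
    calc q = q * (X'.toBlocks₂₂ * (S.toBlocks₂₂ - S.toBlocks₂₁ * Y * S.toBlocks₁₂)) := by
          rw [mul_schur hX' hY, Matrix.mul_one]
      _ = _ := by rw [← Matrix.mul_assoc, hq, Matrix.one_mul]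
  constructor
  · have h1 := h.refl.schur hX hX' Sum.inr hq hq'
    have e : (0 : ℂ) + ((Fintype.card (P ⊕ Q) : ℂ) - Fintype.card Q) / 2 = c := by
      rw [Fintype.card_sum, hc]
      push_cast
      ring
    rw [e] at h1
    exact h1.shift.mul hD fun a b => (hDq a b).shift_right _
  · intro a b
    have h1 := h.refl.opposite c
    have hφ : ∀ (φ : R⟦X⟧ →+* R⟦X⟧) {T T' : Matrix P P R⟦X⟧}, T * T' = 1 →
        T.map φ * T'.map φ = 1 := fun φ T T' hT => by
      rw [← Matrix.map_mul, hT, Matrix.map_one _ (map_zero _) (map_one _)]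
    have hrs : (fun f : R⟦X⟧ => reflect (shift (-c) f)) = reflectHom.comp (shiftHom (-c)) :=
      funext fun f => (reflectHom_apply _).symm
    have e2 : (-(C (2 * c)) : ℂ⟦X⟧) = -(Fintype.card P : ℂ⟦X⟧) := by
      rw [hc, mul_div_cancel₀ _ (two_ne_zero' ℂ), map_natCast]
    rw [e2, hrs] at h1
    rw [hrs] at hκ
    have hP' : (Fintype.card P : ℂ⟦X⟧) ≠ 0 := fun h0 => hP (by simpa using congrArg constantCoeff h0)
    have h2 := h1.crossing (YS := Y.map (shift (-c))) (YT := Y.map (reflectHom.comp (shiftHom (-c))))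
      (κ := κ) (hφ (shiftHom (-c)) hY')
      (hφ (reflectHom.comp (shiftHom (-c))) hY) (hφ (reflectHom.comp (shiftHom (-c))) hY') hκ
      (torsionFree_series _ hP') (torsionFree_series _ two_series_ne_zero) a b
    have key : ∀ (φ : R⟦X⟧ →+* R⟦X⟧), (S.map φ).toBlocks₂₂ - (S.map φ).toBlocks₂₁ * Y.map φ *
        (S.map φ).toBlocks₁₂ = q.map φ := fun φ => by
      rw [hqS, Matrix.map_sub φ (map_sub φ), Matrix.map_mul, Matrix.map_mul]
      rfl
    rw [key, show Y.map (shift (-c)) = Y.map (shiftHom (-c)) from rfl,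
      show S.map (shift (-c)) = S.map (shiftHom (-c)) from rfl, key] at h2
    simp only [Matrix.map_apply, shiftHom_apply, RingHom.comp_apply, reflectHom_apply] at h2
    rw [← mul_smul_comm, ← mul_smul_comm, ← mul_sub, h2, reflect_mul, ← smul_mul_assoc, ← hDκ,
      ← mul_assoc, ((hDq a b).shift_right _).reflect_right.commute, mul_assoc, hDκ, mul_smul_comm,
      smul_mul_assoc, (((hDq a b).shift_right _).reflect_right.reflect_left).commute]

/-- The scalar factor of the matrix `S(-u) Ω S(u - 1)` of size two. -/
def halfDet (S : Matrix (Fin 2) (Fin 2) R⟦X⟧) : R⟦X⟧ :=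
  reflect (S 0 0) * shift (-1) (S 1 1) - reflect (S 0 1) * shift (-1) (S 0 1)

theorem C_sub_X_ne_zero (c : ℂ) : (C c - X : ℂ⟦X⟧) ≠ 0 := by
  intro h
  have := congrArg (coeff 1) h
  simp at this

theorem IsTwisted.reflect_mul_Omega_mul {ε : ℂ} {S : Matrix (Fin 2) (Fin 2) R⟦X⟧}
    (h : IsTwisted ε S) :
    S.map reflect * Omega R⟦X⟧ * S.map (shift (-1)) = halfDet S • Omega R⟦X⟧ := by
  have h1 := Reflection.map h.refl _ _ (evalHom₂_smul X (invLin (-1)) (by simp)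
    (constantCoeff_invLin _))
  simp only [mul_zero, map_zero, zero_mul, add_zero] at h1
  simp only [map_sub, map_add, map_mul, evalHom₂_inU, evalHom₂_inV,
    subst₁_X _ (constantCoeff_invLin _), subst₁_id] at h1
  have hx : (1 - X) * invLin (-1) = X := by simpa using X_mul_neg 1
  have h2 : Reflection 1 1 (2 - X) (X : ℂ⟦X⟧) S (S.map (shift (-1))) := by
    refine Reflection.of_smul (c := X ^ 2) (d := X)
      (((h1.smul_fst (1 - X)).smul_snd (1 - X)).congr_param ?_ ?_ ?_ ?_ ?_ ?_)
      (torsionFree_series _ (by simp [X_ne_zero]))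
    · linear_combination hx
    · linear_combination X * hx
    · linear_combination hx
    · linear_combination X * hx
    · ext1 i j
      exact (evalHom₂_inU _ _ (by simp) (constantCoeff_invLin _) _).trans (subst₁_id _)
    · ext1 i j
      exact evalHom₂_inV _ _ (by simp) (constantCoeff_invLin _) _
  have h3 := h2.antisymm (U := S.map reflect) h.symm
  have h4 : ∀ i j, (S.map reflect * Omega R⟦X⟧ * S.map (shift (-1))) i j =
      -(S.map reflect * Omega R⟦X⟧ * S.map (shift (-1))) j i := by
    intro i j
    rw [← sub_eq_zero]
    apply torsionFree_series _ (C_sub_X_ne_zero (2 * ε))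
    rw [smul_sub, smul_neg, h3, sub_self]
  have h5 : ∀ i, (S.map reflect * Omega R⟦X⟧ * S.map (shift (-1))) i i = 0 := by
    intro i
    apply torsionFree_series (R := R) (2 : ℂ⟦X⟧) two_series_ne_zero
    rw [two_smul]
    nth_rewrite 1 [h4 i i]
    exact neg_add_cancel _
  have h6 : (S.map reflect * Omega R⟦X⟧ * S.map (shift (-1))) 0 1 = halfDet S := by
    rw [mul_Omega_mul_apply]
    rfl
  have h7 := h4 1 0
  rw [h6] at h7
  ext1 i j
  fin_cases i <;> fin_cases j
  · simpa [Omega] using h5 0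
  · simpa [Omega] using h6
  · simpa [Omega] using h7
  · simpa [Omega] using h5 1

theorem IsTwisted.halfDet_commute {ε : ℂ} {S : Matrix (Fin 2) (Fin 2) R⟦X⟧}
    (h : IsTwisted ε S) (i j : Fin 2) : CoeffCommute (halfDet S) (S i j) := by
  have hO : (Omega R⟦X⟧).map inV = Omega R⟦X⟧⟦X⟧ := by
    ext1 i j
    fin_cases i <;> fin_cases j <;> simp [Omega, inV]
  have hsp : (S.map reflect).map inV * Omega R⟦X⟧⟦X⟧ * (S.map (shift (-1))).map inV =
      inV (halfDet S) • Omega R⟦X⟧⟦X⟧ := by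
    rw [← hO, map_inV_mul, map_inV_mul, h.reflect_mul_Omega_mul]
    ext1 i j
    simp [inV]
  have hy : (1 - yV) * inV (invLin (-1)) = yV := by simpa using yV_mul 1
  have h1 := Reflection.map h.refl _ _ (substHom₂_smul X (invLin (-1)) (by simp)
    (constantCoeff_invLin _))
  simp only [mul_zero, map_zero, zero_mul, add_zero] at h1
  simp only [map_sub, map_add, map_mul, substHom₂_inU, substHom₂_inV,
    subst₁_X _ (constantCoeff_invLin _), subst₁_id] at h1
  have h2 := Reflection.map h.refl _ _ (substHom₂_smul X (-X) (by simp) (by simp))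
  simp only [mul_zero, map_zero, zero_mul, add_zero] at h2
  have hn : (inV (-X) : ℂ⟦X⟧⟦X⟧) = -yV := map_neg _ _
  simp only [map_sub, map_add, map_mul, substHom₂_inU, substHom₂_inV,
    subst₁_X _ constantCoeff_neg_X, subst₁_id, hn] at h2
  refine (coeffCommute_iff.2 (Eq.symm ?_)).symm
  refine Reflection.commute_scalar (a₀ := yV - xU) (b₀ := yV + xU) (γ := xU * yV)
    (S := S.map inU)
    (((h1.smul_fst (1 - yV)).smul_snd (1 - yV)).congr_param ?_ ?_ ?_ ?_ ?_ ?_)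
    (((h2.smul_fst (-1)).smul_snd (-1)).congr_param ?_ ?_ ?_ ?_ ?_ ?_) hsp
    (torsionFree_series₂ _ ?_) i j
  · linear_combination hy
  · linear_combination xU * hy
  · linear_combination hy
  · linear_combination xU * hy
  · ext1 i j
    exact (substHom₂_inU _ _ (by simp) (constantCoeff_invLin _) _).trans (by rw [subst₁_id]; rfl)
  · ext1 i j
    exact substHom₂_inV _ _ (by simp) (constantCoeff_invLin _) _
  · ring
  · ring
  · ring
  · ring
  · ext1 i j
    exact (substHom₂_inU _ _ (by simp) (by simp) _).trans (by rw [subst₁_id]; rfl)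
  · ext1 i j
    refine (substHom₂_inV _ _ (by simp) constantCoeff_neg_X _).trans ?_
    rw [Matrix.map_apply, Matrix.map_apply, ← reflectHom_apply]
    rfl
  · intro h
    have := congrArg constantCoeff h
    simp [constantCoeff_yV, constantCoeff_xU] at this

theorem IsTwisted.halfDet_self_commute {ε : ℂ} {S : Matrix (Fin 2) (Fin 2) R⟦X⟧}
    (h : IsTwisted ε S) : CoeffCommute (halfDet S) (halfDet S) :=
  ((h.halfDet_commute 0 0).reflect_right.mul_right ((h.halfDet_commute 1 1).shift_right _)).sub_right
    ((h.halfDet_commute 0 1).reflect_right.mul_right ((h.halfDet_commute 0 1).shift_right _))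

theorem halfDet_commute_of {S : Matrix (Fin 2) (Fin 2) R⟦X⟧} {f : R⟦X⟧}
    (h : ∀ i j, CoeffCommute f (S i j)) : CoeffCommute f (halfDet S) :=
  ((h 0 0).reflect_right.mul_right ((h 1 1).shift_right _)).sub_right
    ((h 0 1).reflect_right.mul_right ((h 0 1).shift_right _))

variable {ε : ℂ} {S Y : Matrix (Fin 2) (Fin 2) R⟦X⟧}

theorem IsTwisted.mul_Omega_mul_reflect (h : IsTwisted ε S) :
    S.map (shift (-1)) * Omega R⟦X⟧ * S.map reflect =
      shift (-1) (reflect (halfDet S)) • Omega R⟦X⟧ := by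
  have h1 := h.reflect_mul_Omega_mul
  have hO : ∀ φ : R⟦X⟧ →+* R⟦X⟧, (Omega R⟦X⟧).map φ = Omega R⟦X⟧ := fun φ => by
    ext1 i j
    fin_cases i <;> fin_cases j <;> simp [Omega]
  have hrefl : (reflect : R⟦X⟧ → R⟦X⟧) = reflectHom := funext fun f => (reflectHom_apply f).symm
  set U := S.map reflect with hU
  set T := S.map (shift (-1)) with hT
  have := congrArg (fun W => (W.map reflect).map (shift (-1))) h1
  simp only [map_reflect_mul, map_shift_mul] at this
  rw [hrefl, hO, show (shift (-1) : R⟦X⟧ → R⟦X⟧) = shiftHom (-1) from rfl, hO] at this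
  have e1 : (U.map ⇑reflectHom).map (shiftHom (-1)) = T := by
    ext1 i j
    simp only [hU, hT, Matrix.map_apply, reflectHom_apply, reflect_reflect, shiftHom_apply]
  have e2 : (T.map ⇑reflectHom).map (shiftHom (-1)) = U := by
    ext1 i j
    simp only [hU, hT, Matrix.map_apply, reflectHom_apply, reflect_shift, shiftHom_apply,
      shift_shift]
    simp [shift_zero]
  rw [e1, e2] at this
  rw [this]
  ext1 i j
  fin_cases i <;> fin_cases j <;> simp [Omega, ← reflectHom_apply, ← shiftHom_apply]

/-- The scalar factor is invariant under `u ↦ 1 - u`. -/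
theorem IsTwisted.shift_reflect_halfDet (h : IsTwisted ε S) (hY' : Y * S = 1) :
    shift (-1) (reflect (halfDet S)) = halfDet S := by
  have h1 := h.reflect_mul_Omega_mul
  have h2 := h.mul_Omega_mul_reflect
  set a := halfDet S with ha
  set U := S.map reflect with hU
  set T := S.map (shift (-1)) with hT
  set a' := shift (-1) (reflect a) with ha'
  have haU : ∀ i j, U i j * a' = a * U i j := fun i j => by
    have e := congrArg (fun W => W * Omega R⟦X⟧ * U) h1
    have e' : (a • Omega R⟦X⟧) * Omega R⟦X⟧ * U = -(a • U) := by
      rw [Matrix.smul_mul, Omega_mul_Omega]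
      simp
    have e'' : U * Omega R⟦X⟧ * T * Omega R⟦X⟧ * U = U * (Omega R⟦X⟧ * (a' • Omega R⟦X⟧)) := by
      rw [← h2]; simp only [Matrix.mul_assoc]
    have e3 : Omega R⟦X⟧ * (a' • Omega R⟦X⟧) = -(Matrix.diagonal fun _ => a') := by
      ext1 i j
      fin_cases i <;> fin_cases j <;> simp [Omega, Matrix.mul_apply, Fin.sum_univ_two]
    simp only [e', e'', e3] at e
    have := congrFun (congrFun e i) j
    simpa [Matrix.mul_neg, Matrix.mul_diagonal] using this
  have hU1 : Y.map reflect * U = 1 := by rw [← map_reflect_mul, hY', map_reflect_one]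
  have h3 : U * Matrix.diagonal (fun _ => a') = U * Matrix.diagonal (fun _ => a) := by
    ext1 i j
    rw [Matrix.mul_diagonal, Matrix.mul_diagonal, haU]
    exact (h.halfDet_commute i j).reflect_right.commute
  have h4 := congrArg (fun W => (Y.map reflect * W) 0 0) h3
  simp only [← Matrix.mul_assoc, hU1] at h4
  simpa using h4

theorem IsTwisted.exists_halfDet_inverse (h : IsTwisted ε S) (hY : S * Y = 1) (hY' : Y * S = 1) :
    ∃ b, halfDet S * b = 1 ∧ b * halfDet S = 1 := by
  have h1 := h.reflect_mul_Omega_mul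
  set a := halfDet S
  set V := Y.map (shift (-1)) * Omega R⟦X⟧ * Y.map reflect with hV
  have hO := Omega_mul_Omega (A := R⟦X⟧)
  have e1 : S.map reflect * Y.map reflect = 1 := by rw [← map_reflect_mul, hY, map_reflect_one]
  have e1' : Y.map reflect * S.map reflect = 1 := by rw [← map_reflect_mul, hY', map_reflect_one]
  have e2 : S.map (shift (-1)) * Y.map (shift (-1)) = 1 := by
    rw [← map_shift_mul, hY, map_shift_one]
  have e2' : Y.map (shift (-1)) * S.map (shift (-1)) = 1 := by
    rw [← map_shift_mul, hY', map_shift_one]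
  have x1 : (a • Omega R⟦X⟧) * V = -1 := by
    rw [← h1, hV]
    calc _ = S.map reflect * Omega R⟦X⟧ * (S.map (shift (-1)) * Y.map (shift (-1))) * Omega R⟦X⟧ *
          Y.map reflect := by simp only [Matrix.mul_assoc]
      _ = S.map reflect * (Omega R⟦X⟧ * Omega R⟦X⟧) * Y.map reflect := by
          rw [e2, Matrix.mul_one]; simp only [Matrix.mul_assoc]
      _ = _ := by rw [hO, Matrix.mul_neg, Matrix.neg_mul, Matrix.mul_one, e1]
  have x2 : V * (a • Omega R⟦X⟧) = -1 := by
    rw [← h1, hV]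
    calc _ = Y.map (shift (-1)) * Omega R⟦X⟧ * (Y.map reflect * S.map reflect) * Omega R⟦X⟧ *
          S.map (shift (-1)) := by simp only [Matrix.mul_assoc]
      _ = Y.map (shift (-1)) * (Omega R⟦X⟧ * Omega R⟦X⟧) * S.map (shift (-1)) := by
          rw [e1', Matrix.mul_one]; simp only [Matrix.mul_assoc]
      _ = _ := by rw [hO, Matrix.mul_neg, Matrix.neg_mul, Matrix.mul_one, e2']
  have y1 := congrFun (congrFun x1 0) 0
  have y2 := congrFun (congrFun x2 1) 1
  simp [Matrix.mul_apply, Omega, Fin.sum_univ_two] at y1 y2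
  refine ⟨-V 1 0, by simpa [neg_eq_iff_eq_neg] using y1, ?_⟩
  have : a * -V 1 0 = 1 := by simpa [neg_eq_iff_eq_neg] using y1
  have y3 : -V 1 0 * a = 1 := by simpa [neg_eq_iff_eq_neg] using y2
  exact y3

end Elimination

section BlockElimination

variable {R : Type*} [Ring R] [Algebra ℂ R] {ε : ℂ}
variable {Q : Type*} [Fintype Q] [DecidableEq Q]

theorem IsTwisted.reflect_halfDet {S Y : Matrix (Fin 2) (Fin 2) R⟦X⟧} (h : IsTwisted ε S)
    (hY' : Y * S = 1) : reflect (halfDet S) = shift 1 (halfDet S) := by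
  have h3 := h.shift_reflect_halfDet hY'
  nth_rewrite 2 [← h3]
  rw [shift_shift, add_neg_cancel, shift_zero]

theorem map_reflect_shift_inverse {I : Type*} [Fintype I] [DecidableEq I] (c : ℂ)
    {S T : Matrix I I R⟦X⟧} (h : S * T = 1) :
    S.map (fun f => reflect (shift c f)) * T.map (fun f => reflect (shift c f)) = 1 := by
  have := congrArg (fun W => (W.map (shift c)).map reflect) h
  simp only [map_shift_mul, map_reflect_mul, map_shift_one, map_reflect_one] at this
  exact this

theorem IsTwisted.map_reflect_shift_inverse {S Y : Matrix (Fin 2) (Fin 2) R⟦X⟧}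
    (h : IsTwisted ε S) (hY : S * Y = 1) {b : R⟦X⟧} (hb : b * halfDet S = 1) :
    (Y.map fun f => reflect (shift (-1) f)) = !![reflect b * S 1 1, -(reflect b * S 1 0);
      -(reflect b * S 0 1), reflect b * S 0 0] := by
  have h1 := h.reflect_mul_Omega_mul
  set a := halfDet S with ha
  have hO : (Omega R⟦X⟧).map reflect = Omega R⟦X⟧ := by
    ext1 i j
    fin_cases i <;> fin_cases j <;> simp [Omega, ← reflectHom_apply]
  have hrb : reflect b * reflect a = 1 := by rw [← reflect_mul, hb, reflect_one]
  have e1 := congrArg (fun W => W.map reflect * (Y.map fun f => reflect (shift (-1) f))) h1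
  have e2 : (S.map reflect).map reflect = S := by
    ext1 i j
    simp [reflect_reflect]
  have e3 : (S.map (shift (-1))).map reflect * (Y.map fun f => reflect (shift (-1) f)) = 1 :=
    TwistedYangian.map_reflect_shift_inverse (-1) hY
  have e4 : (a • Omega R⟦X⟧).map reflect = reflect a • Omega R⟦X⟧ := by
    ext1 i j
    fin_cases i <;> fin_cases j <;> simp [Omega, ← reflectHom_apply]
  simp only [map_reflect_mul] at e1
  rw [e2, hO, Matrix.mul_assoc, e3, Matrix.mul_one, e4] at e1
  set W := Y.map fun f => reflect (shift (-1) f) with hW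
  have f1 : ∀ i, (S * Omega R⟦X⟧) i 1 = S i 0 := fun i => by
    simp [Omega, Matrix.mul_apply, Fin.sum_univ_two]
  have f0 : ∀ i, (S * Omega R⟦X⟧) i 0 = -S i 1 := fun i => by
    simp [Omega, Matrix.mul_apply, Fin.sum_univ_two]
  have g0 : ∀ j, ((reflect a • Omega R⟦X⟧) * W) 0 j = reflect a * W 1 j := fun j => by
    simp [Omega, Matrix.mul_apply, Fin.sum_univ_two]
  have g1 : ∀ j, ((reflect a • Omega R⟦X⟧) * W) 1 j = -(reflect a * W 0 j) := fun j => by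
    simp [Omega, Matrix.mul_apply, Fin.sum_univ_two]
  have key : ∀ i j, W i j = reflect b * (reflect a * W i j) := fun i j => by
    rw [← mul_assoc, hrb, one_mul]
  ext1 i j
  fin_cases i <;> fin_cases j
  · show W 0 0 = _
    rw [key, ← neg_eq_iff_eq_neg.2 (g1 0).symm.symm, ← e1, f0]
    simp
  · show W 0 1 = _
    rw [key, ← neg_eq_iff_eq_neg.2 (g1 1).symm.symm, ← e1, f1]
    simp
  · show W 1 0 = _
    rw [key, ← g0, ← e1, f0]
    simp
  · show W 1 1 = _
    rw [key, ← g0, ← e1, f1]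
    simp

/-- Elimination of two indices. -/
theorem IsTwisted.elim_two {S X' : Matrix (Fin 2 ⊕ Q) (Fin 2 ⊕ Q) R⟦X⟧}
    {Y : Matrix (Fin 2) (Fin 2) R⟦X⟧} {q : Matrix Q Q R⟦X⟧} (h : IsTwisted ε S)
    (hX : S * X' = 1) (hX' : X' * S = 1)
    (hY : S.toBlocks₁₁ * Y = 1) (hY' : Y * S.toBlocks₁₁ = 1)
    (hq : q * X'.toBlocks₂₂ = 1) (hq' : X'.toBlocks₂₂ * q = 1) :
    IsTwisted ε (fun a b => -shift 1 (halfDet S.toBlocks₁₁) * shift (-1) (q a b)) := by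
  have hs : IsTwisted ε S.toBlocks₁₁ := h.submatrix Sum.inl
  obtain ⟨b, hab, hba⟩ := hs.exists_halfDet_inverse hY hY'
  have hsym := hs.reflect_halfDet hY'
  have hsym' := hs.shift_reflect_halfDet hY'
  have h2 := hs.mul_Omega_mul_reflect
  rw [hsym'] at h2
  have hinv := hs.map_reflect_shift_inverse hY hba
  have hss := hs.halfDet_self_commute
  have hqc : ∀ i j a b, CoeffCommute (S.toBlocks₁₁ i j) (q a b) := fun i j =>
    fun a b => CoeffCommute.matrix_inverse (fun c d => h.refl.commute_inverse hX hX'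
      Sum.inl_ne_inr Sum.inl_ne_inr Sum.inl_ne_inr Sum.inl_ne_inr) hq' hq a b
  have hbc : ∀ i j, CoeffCommute (S.toBlocks₁₁ i j) b := fun i j =>
    (hs.halfDet_commute i j).symm.inv_right hab hba
  set a := halfDet S.toBlocks₁₁ with ha
  set s := S.toBlocks₁₁ with hsdef
  have hc : -((Fintype.card (Fin 2) : ℂ) / 2) = -1 := by simp
  have hD : CoeffCommute (-shift 1 a) (-shift 1 a) :=
    ((hss.shift_right 1).shift_left 1).neg_right.symm.neg_right.symm
  have hra : reflect a * reflect b = 1 := by rw [← reflect_mul, hab, reflect_one]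
  have main := h.schur (D := -shift 1 a) (κ := (C (2 * ε) - X : ℂ⟦X⟧) • (reflect b * a))
    hX hX' hY hY' hq hq' (by simp) hD (fun c d => ?_) ?_ ?_
  · simpa only [hc] using main
  · exact ((halfDet_commute_of fun i j => (hqc i j c d).symm).shift_right 1).neg_right.symm
  · rw [hc, hinv]
    set T := s.map (shift (-1)) with hT
    have hTb : ∀ i j, T i j * reflect b = reflect b * T i j := fun i j =>
      ((hbc i j).reflect_right.shift_left (-1)).commute
    have hW : ((2 : ℂ⟦X⟧) • (!![reflect b * s 1 1, -(reflect b * s 1 0);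
        -(reflect b * s 0 1), reflect b * s 0 0]).transpose - (X : ℂ⟦X⟧) •
          !![reflect b * s 1 1, -(reflect b * s 1 0); -(reflect b * s 0 1), reflect b * s 0 0]) =
        (C (2 * ε) - X : ℂ⟦X⟧) • !![reflect b * reflect (s 1 1), -(reflect b * reflect (s 1 0));
          -(reflect b * reflect (s 0 1)), reflect b * reflect (s 0 0)] := by
      have h3 : ∀ i j, (2 : ℂ⟦X⟧) • (reflect b * s j i) - (X : ℂ⟦X⟧) • (reflect b * s i j) =
          (C (2 * ε) - X : ℂ⟦X⟧) • (reflect b * reflect (s i j)) := fun i j => by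
        rw [← mul_smul_comm, ← mul_smul_comm, ← mul_sub, hs.symm, mul_smul_comm]
      ext1 i j
      fin_cases i <;> fin_cases j
      · exact h3 1 1
      · have := congrArg Neg.neg (h3 1 0)
        simp only [neg_sub] at this
        simpa [sub_eq_add_neg, add_comm] using this
      · have := congrArg Neg.neg (h3 0 1)
        simp only [neg_sub] at this
        simpa [sub_eq_add_neg, add_comm] using this
      · exact h3 0 0
    rw [hW, Matrix.mul_smul]
    have z : ∀ i j, T i 0 * reflect (s 1 j) - T i 1 * reflect (s 0 j) = (a • Omega R⟦X⟧) i j := by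
      intro i j
      rw [← h2, mul_Omega_mul_apply]
      rfl
    have zz : T * !![reflect b * reflect (s 1 1), -(reflect b * reflect (s 1 0));
          -(reflect b * reflect (s 0 1)), reflect b * reflect (s 0 0)] =
        Matrix.diagonal fun _ => reflect b * a := by
      have l : ∀ i, (T * !![reflect b * reflect (s 1 1), -(reflect b * reflect (s 1 0));
          -(reflect b * reflect (s 0 1)), reflect b * reflect (s 0 0)]) i 0 =
          reflect b * (T i 0 * reflect (s 1 1) - T i 1 * reflect (s 0 1)) := fun i => by
        rw [Matrix.mul_apply, Fin.sum_univ_two]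
        show T i 0 * (reflect b * reflect (s 1 1)) + T i 1 * -(reflect b * reflect (s 0 1)) = _
        rw [mul_neg, ← mul_assoc, ← mul_assoc, hTb, hTb, mul_sub, mul_assoc, mul_assoc]
        abel
      have l' : ∀ i, (T * !![reflect b * reflect (s 1 1), -(reflect b * reflect (s 1 0));
          -(reflect b * reflect (s 0 1)), reflect b * reflect (s 0 0)]) i 1 =
          -(reflect b * (T i 0 * reflect (s 1 0) - T i 1 * reflect (s 0 0))) := fun i => by
        rw [Matrix.mul_apply, Fin.sum_univ_two]
        show T i 0 * -(reflect b * reflect (s 1 0)) + T i 1 * (reflect b * reflect (s 0 0)) = _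
        rw [mul_neg, ← mul_assoc, ← mul_assoc, hTb, hTb, mul_sub, mul_assoc, mul_assoc]
        abel
      ext1 i j
      fin_cases j
      · refine (l i).trans ?_
        rw [z]
        fin_cases i <;> simp [Omega]
      · refine (l' i).trans ?_
        rw [z]
        fin_cases i <;> simp [Omega]
    rw [zz]
    ext1 i j
    by_cases hij : i = j <;> simp [hij, Matrix.diagonal]
  · rw [reflect_neg, reflect_shift, hsym', mul_smul_comm, ← hsym, neg_mul, ← mul_assoc, hra, one_mul]

theorem IsTwisted.even_of_one {S : Matrix (Fin 1) (Fin 1) R⟦X⟧} (h : IsTwisted 1 S) :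
    reflect (S 0 0) = S 0 0 := by
  have := h.symm 0 0
  rw [← sub_smul, mul_one, map_ofNat, ← sub_eq_zero, ← smul_sub] at this
  have hne : (2 - X : ℂ⟦X⟧) ≠ 0 := by
    have := C_sub_X_ne_zero 2
    rwa [map_ofNat] at this
  exact (sub_eq_zero.1 (torsionFree_series _ hne _ this)).symm

theorem SeriesReflection.self_commute_of_one {S : Matrix (Fin 1) (Fin 1) R⟦X⟧}
    (h : SeriesReflection 0 S) : CoeffCommute (S 0 0) (S 0 0) := by
  rw [coeffCommute_iff, ← sub_eq_zero]
  have h1 := h 0 0 0 0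
  simp only [mul_zero, map_zero, zero_mul, add_zero, Matrix.map_apply] at h1
  have hne : (yV - xU - xU * yV) * (yV + xU + xU * yV) ≠ 0 := by
    intro h
    have := congrArg constantCoeff h
    simp [constantCoeff_yV, constantCoeff_xU] at this
  apply torsionFree_series₂ _ hne
  rw [← sub_eq_zero] at h1
  rw [← h1]
  simp only [← sub_smul, ← add_smul]
  congr 1
  ring

/-- Elimination of one index. -/
theorem IsTwisted.elim_one {S X' : Matrix (Fin 1 ⊕ Q) (Fin 1 ⊕ Q) R⟦X⟧}
    {Y : Matrix (Fin 1) (Fin 1) R⟦X⟧} {q : Matrix Q Q R⟦X⟧} (h : IsTwisted 1 S)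
    (hX : S * X' = 1) (hX' : X' * S = 1)
    (hY : S.toBlocks₁₁ * Y = 1) (hY' : Y * S.toBlocks₁₁ = 1)
    (hq : q * X'.toBlocks₂₂ = 1) (hq' : X'.toBlocks₂₂ * q = 1) :
    IsTwisted 1 (fun a b => shift (1 / 2) (S.toBlocks₁₁ 0 0) * shift (-(1 / 2)) (q a b)) := by
  have hs : IsTwisted 1 S.toBlocks₁₁ := h.submatrix Sum.inl
  have hev := hs.even_of_one
  have hss := hs.refl.self_commute_of_one
  have hqc : ∀ i j a b, CoeffCommute (S.toBlocks₁₁ i j) (q a b) := fun i j =>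
    fun a b => CoeffCommute.matrix_inverse (fun c d => h.refl.commute_inverse hX hX'
      Sum.inl_ne_inr Sum.inl_ne_inr Sum.inl_ne_inr Sum.inl_ne_inr) hq' hq a b
  set s := S.toBlocks₁₁ with hsdef
  have hc : -((Fintype.card (Fin 1) : ℂ) / 2) = -(1 / 2) := by simp
  have y1 : s 0 0 * Y 0 0 = 1 := by
    have := congrFun (congrFun hY 0) 0
    simpa [Matrix.mul_apply] using this
  have y2 : Y 0 0 * s 0 0 = 1 := by
    have := congrFun (congrFun hY' 0) 0
    simpa [Matrix.mul_apply] using this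
  have hev' : reflect (Y 0 0) = Y 0 0 := by
    have e : reflect (Y 0 0) * s 0 0 = 1 := by
      rw [← hev, ← reflect_mul, y2, reflect_one]
    calc reflect (Y 0 0) = reflect (Y 0 0) * (s 0 0 * Y 0 0) := by rw [y1, mul_one]
      _ = _ := by rw [← mul_assoc, e, one_mul]
  have hYs : CoeffCommute (s 0 0) (Y 0 0) := hss.inv_right y1 y2
  have main := h.schur (D := shift (1 / 2) (s 0 0))
    (κ := (C (2 * 1) - X : ℂ⟦X⟧) • (shift (-(1 / 2)) (s 0 0) * shift (1 / 2) (Y 0 0)))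
    hX hX' hY hY' hq hq' (by simp) ((hss.shift_right _).shift_left _) (fun c d => ?_) ?_ ?_
  · simpa only [hc] using main
  · exact (hqc 0 0 c d).shift_left _
  · rw [hc]
    ext1 i j
    fin_cases i
    fin_cases j
    simp [Matrix.mul_apply, reflect_shift, hev', ← sub_smul, map_ofNat]
    rfl
  · rw [reflect_shift, hev, mul_smul_comm, ← mul_assoc,
      (((hss.shift_right (-(1 / 2))).shift_left (1 / 2)).commute), mul_assoc, ← shift_mul, y1,
      shift_one]
    simp only [mul_one]

end BlockElimination

/-! ### Operators on several tensor factors -/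

section Factors

variable {ι I A : Type*} [Fintype ι] [DecidableEq ι] [Fintype I] [DecidableEq I] [Ring A]

/-- The matrix `X` acting on the tensor factor `a`. -/
def leg (a : ι) (X : Matrix I I A) : Matrix (ι → I) (ι → I) A := fun f g =>
  if ∀ b, b ≠ a → f b = g b then X (f a) (g a) else 0

/-- The partial transpose of the permutation of the tensor factors `a` and `b`. -/
def contract (I A : Type*) [DecidableEq I] [Ring A] (a b : ι) : Matrix (ι → I) (ι → I) A :=
  fun f g => if (∀ c, c ≠ a → c ≠ b → f c = g c) ∧ f a = f b ∧ g a = g b then 1 else 0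

/-- The permutation of tensor factors. -/
def permute (I A : Type*) [DecidableEq I] [Ring A] (σ : Equiv.Perm ι) :
    Matrix (ι → I) (ι → I) A := fun f g => if f = g ∘ σ.symm then 1 else 0

theorem ext_of_mulVec {X Y : Matrix (ι → I) (ι → I) A}
    (h : ∀ φ f, X.mulVec φ f = Y.mulVec φ f) : X = Y := by
  ext1 f g
  simpa using h (Pi.single g 1) f

theorem leg_mulVec (a : ι) (X : Matrix I I A) (φ : (ι → I) → A) (f : ι → I) :
    (leg a X).mulVec φ f = ∑ j, X (f a) j * φ (Function.update f a j) := by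
  rw [Matrix.mulVec, dotProduct]
  symm
  refine Finset.sum_of_injOn (fun j => Function.update f a j) ?_ ?_ ?_ ?_
  · intro i _ j _ hij
    simpa using congrFun hij a
  · intro j _
    simp
  · intro g _ hg
    rw [leg, if_neg, zero_mul]
    intro hb
    refine hg ⟨g a, by simp, ?_⟩
    ext1 b
    by_cases h : b = a
    · subst h; simp
    · simp [h, hb b h]
  · intro j _
    rw [leg, if_pos]
    · simp
    · intro b hb
      simp [hb]

theorem contract_mulVec {a b : ι} (hab : a ≠ b) (φ : (ι → I) → A) (f : ι → I) :
    (contract I A a b).mulVec φ f = if f a = f b then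
      ∑ j, φ (Function.update (Function.update f a j) b j) else 0 := by
  rw [Matrix.mulVec, dotProduct]
  split_ifs with hf
  · symm
    refine Finset.sum_of_injOn (fun j => Function.update (Function.update f a j) b j) ?_ ?_ ?_ ?_
    · intro i _ j _ hij
      simpa using congrFun hij b
    · intro j _
      simp
    · intro g _ hg
      rw [contract, if_neg, zero_mul]
      rintro ⟨hc, -, hgab⟩
      refine hg ⟨g a, by simp, ?_⟩
      ext1 c
      by_cases h : c = b
      · subst h; simpa using hgab
      · by_cases h' : c = a
        · subst h'; simp [h]
        · simp [h, h', hc c h' h]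
    · intro j _
      rw [contract, if_pos, one_mul]
      refine ⟨fun c h1 h2 => by simp [h1, h2], hf, by simp [hab]⟩
  · refine Finset.sum_eq_zero fun g _ => ?_
    rw [contract, if_neg, zero_mul]
    exact fun h => hf h.2.1

theorem permute_mulVec (σ : Equiv.Perm ι) (φ : (ι → I) → A) (f : ι → I) :
    (permute I A σ).mulVec φ f = φ (f ∘ σ) := by
  rw [Matrix.mulVec, dotProduct, Finset.sum_eq_single (f ∘ σ)]
  · rw [permute, if_pos, one_mul]
    ext1 b
    simp
  · intro g _ hg
    rw [permute, if_neg, zero_mul]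
    rintro rfl
    apply hg
    ext1 b
    simp
  · simp

theorem mul_mulVec (X Y : Matrix (ι → I) (ι → I) A) (φ : (ι → I) → A) :
    (X * Y).mulVec φ = X.mulVec (Y.mulVec φ) := (Matrix.mulVec_mulVec φ X Y).symm

theorem leg_mul (a : ι) (X Y : Matrix I I A) : leg a X * leg a Y = leg a (X * Y) := by
  refine ext_of_mulVec fun φ f => ?_
  simp only [mul_mulVec, leg_mulVec, Matrix.mul_apply, Finset.mul_sum, Finset.sum_mul,
    Function.update_self, Function.update_idem, mul_assoc]
  rw [Finset.sum_comm]

theorem leg_one (a : ι) : leg a (1 : Matrix I I A) = 1 := by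
  refine ext_of_mulVec fun φ f => ?_
  simp [leg_mulVec, Matrix.one_apply]

theorem contract_comm (a b : ι) : contract I A a b = contract I A b a := by
  ext1 f g
  simp only [contract]
  congr 1
  refine propext ⟨fun h => ⟨fun c h1 h2 => h.1 c h2 h1, h.2.1.symm, h.2.2.symm⟩,
    fun h => ⟨fun c h1 h2 => h.1 c h2 h1, h.2.1.symm, h.2.2.symm⟩⟩

theorem contract_mul_self {a b : ι} (hab : a ≠ b) :
    contract I A a b * contract I A a b = Fintype.card I • contract I A a b := by
  refine ext_of_mulVec fun φ f => ?_
  rw [Matrix.smul_mulVec, Pi.smul_apply]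
  simp only [mul_mulVec, contract_mulVec hab]
  split_ifs with h
  · simp [hab, Function.update_comm hab]
  · simp

theorem leg_mul_contract {a b c : ι} (hab : a ≠ b) (hac : a ≠ c) (hbc : b ≠ c)
    (X : Matrix I I A) :
    leg a X * contract I A b c = contract I A b c * leg a X := by
  refine ext_of_mulVec fun φ f => ?_
  simp only [mul_mulVec, contract_mulVec hbc, leg_mulVec, Function.update_of_ne hab.symm,
    Function.update_of_ne hac.symm, Function.update_of_ne hab, Function.update_of_ne hac]
  split_ifs with h
  · simp only [Finset.mul_sum]
    rw [Finset.sum_comm]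
    refine Finset.sum_congr rfl fun i _ => Finset.sum_congr rfl fun j _ => ?_
    rw [Function.update_comm hab, Function.update_comm hac]
  · simp

theorem contract_mul_contract {a b c d : ι} (hac : a ≠ c) (had : a ≠ d) (hbc : b ≠ c)
    (hbd : b ≠ d) (hab : a ≠ b) (hcd : c ≠ d) :
    contract I A a b * contract I A c d = contract I A c d * contract I A a b := by
  refine ext_of_mulVec fun φ f => ?_
  simp only [mul_mulVec, contract_mulVec hab, contract_mulVec hcd, Function.update_of_ne hac.symm,
    Function.update_of_ne had.symm, Function.update_of_ne hac, Function.update_of_ne had,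
    Function.update_of_ne hbc.symm,
    Function.update_of_ne hbd.symm, Function.update_of_ne hbc, Function.update_of_ne hbd]
  split_ifs with h h'
  · rw [Finset.sum_comm]
    refine Finset.sum_congr rfl fun i _ => Finset.sum_congr rfl fun j _ => ?_
    rw [Function.update_comm hbc, Function.update_comm hac, Function.update_comm hbd,
      Function.update_comm had]
  · simp
  · simp
  · rfl

theorem permute_mul (σ τ : Equiv.Perm ι) :
    permute I A σ * permute I A τ = permute I A (σ * τ) := by
  refine ext_of_mulVec fun φ f => ?_
  simp only [mul_mulVec, permute_mulVec]
  rfl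

theorem permute_one : permute I A (1 : Equiv.Perm ι) = 1 := by
  refine ext_of_mulVec fun φ f => ?_
  simp [permute_mulVec]

theorem permute_mul_leg (σ : Equiv.Perm ι) (a : ι) (X : Matrix I I A) :
    permute I A σ * leg a X = leg (σ a) X * permute I A σ := by
  refine ext_of_mulVec fun φ f => ?_
  simp only [mul_mulVec, permute_mulVec, leg_mulVec]
  refine Finset.sum_congr rfl fun j _ => ?_
  congr 2
  ext1 b
  by_cases h : b = a <;> simp [h]

theorem permute_mul_contract (σ : Equiv.Perm ι) {a b : ι} (hab : a ≠ b) :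
    permute I A σ * contract I A a b = contract I A (σ a) (σ b) * permute I A σ := by
  refine ext_of_mulVec fun φ f => ?_
  simp only [mul_mulVec, permute_mulVec, contract_mulVec hab,
    contract_mulVec (σ.injective.ne hab), Function.comp_apply]
  congr 1
  refine Finset.sum_congr rfl fun j _ => ?_
  congr 1
  ext1 c
  simp [Function.update_apply]

theorem contract_mul_contract_eq_permute {a b c : ι} (hca : c ≠ a) (hcb : c ≠ b) (hab : a ≠ b) :
    contract I A c a * contract I A c b = contract I A c a * permute I A (Equiv.swap a b) := by
  refine ext_of_mulVec fun φ f => ?_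
  simp only [mul_mulVec, permute_mulVec, contract_mulVec hca, contract_mulVec hcb]
  split_ifs with h
  · have h1 : ∀ j, (Function.update (Function.update f c j) a j) b = f b := fun j => by
      simp [hab.symm, hcb.symm]
    have h2 : ∀ j, (Function.update (Function.update f c j) a j) c = j := fun j => by
      simp [hca]
    simp only [h1, h2]
    rw [Finset.sum_ite_eq' Finset.univ (f b), if_pos (Finset.mem_univ _)]
    refine Finset.sum_congr rfl fun j _ => ?_
    congr 1
    ext1 d
    by_cases hdc : d = c
    · subst hdc
      simp [hcb, hca, Equiv.swap_apply_of_ne_of_ne]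
    · by_cases hda : d = a
      · subst hda
        simp [hab, hab.symm, hdc, hcb.symm]
      · by_cases hdb : d = b
        · subst hdb
          simp
        · simp [hdc, hda, hdb, Equiv.swap_apply_of_ne_of_ne]
  · rfl

end Factors

section ReflectionFactors

variable {ι I A Z : Type*} [Fintype ι] [DecidableEq ι] [Fintype I] [DecidableEq I] [Ring A]
  [CommRing Z] [Algebra Z A]

/-- The components of a vector with all indices fixed except those of two factors. -/
def slice (a b : ι) (f : ι → I) (φ : (ι → I) → A) : Matrix I I A :=
  fun i j => φ (Function.update (Function.update f a i) b j)

variable {a b : ι}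

theorem apply_eq_slice (f : ι → I) (φ : (ι → I) → A) : φ f = slice a b f φ (f a) (f b) := by
  simp [slice]

theorem slice_leg_fst (hab : a ≠ b) (X : Matrix I I A) (f : ι → I) (φ : (ι → I) → A) :
    slice a b f ((leg a X).mulVec φ) = actFst Z X (slice a b f φ) := by
  ext1 i j
  simp only [slice, leg_mulVec, actFst_apply, Matrix.mul_apply]
  refine Finset.sum_congr rfl fun k _ => ?_
  have h1 : Function.update (Function.update (Function.update f a i) b j) a k =
      Function.update (Function.update f a k) b j := by
    rw [Function.update_comm hab.symm, Function.update_idem]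
  have h2 : Function.update (Function.update f a i) b j a = i := by simp [hab]
  rw [h1, h2]

theorem slice_leg_snd (X : Matrix I I A) (f : ι → I) (φ : (ι → I) → A) :
    slice a b f ((leg b X).mulVec φ) = actSnd Z X (slice a b f φ) := by
  ext1 i j
  simp only [slice, leg_mulVec, actSnd_apply, Matrix.transpose_apply, Matrix.mul_apply]
  simp

theorem slice_contract (hab : a ≠ b) (f : ι → I) (φ : (ι → I) → A) :
    slice a b f ((contract I A a b).mulVec φ) = actContract Z A I (slice a b f φ) := by
  ext1 i j
  simp only [slice, contract_mulVec hab, actContract_apply, Matrix.diagonal_apply, Matrix.trace,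
    Matrix.diag_apply]
  simp [hab, Function.update_comm hab]

theorem slice_permute (hab : a ≠ b) (f : ι → I) (φ : (ι → I) → A) :
    slice a b f ((permute I A (Equiv.swap a b)).mulVec φ) = actSwap Z A I (slice a b f φ) := by
  ext1 i j
  simp only [slice, permute_mulVec, actSwap_apply, Matrix.transpose_apply]
  congr 1
  ext1 d
  by_cases hda : d = a
  · subst hda
    simp [hab]
  · by_cases hdb : d = b
    · subst hdb
      simp [hab]
    · simp [hda, hdb, Equiv.swap_apply_of_ne_of_ne]

theorem Reflection.factors (hab : a ≠ b) {α γ β η : Z} {S T : Matrix I I A}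
    (h : Reflection α γ β η S T) :
    (α • 1 - γ • permute I A (Equiv.swap a b)) * leg a S * (β • 1 + η • contract I A a b) * leg b T =
      leg b T * (β • 1 + η • contract I A a b) * leg a S *
        (α • 1 - γ • permute I A (Equiv.swap a b)) := by
  rw [reflection_iff] at h
  refine ext_of_mulVec fun φ f => ?_
  have e1 : ∀ φ : (ι → I) → A, slice a b f ((β • 1 + η • contract I A a b).mulVec φ) =
      (β • (1 : Module.End Z (Matrix I I A)) + η • actContract Z A I) (slice a b f φ) := fun φ => by
    rw [Matrix.add_mulVec, Matrix.smul_mulVec, Matrix.smul_mulVec, Matrix.one_mulVec,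
      smul_one_add_apply, ← slice_contract hab]
    rfl
  have e2 : ∀ φ : (ι → I) → A,
      slice a b f ((α • 1 - γ • permute I A (Equiv.swap a b)).mulVec φ) =
      (α • (1 : Module.End Z (Matrix I I A)) - γ • actSwap Z A I) (slice a b f φ) := fun φ => by
    rw [Matrix.sub_mulVec, Matrix.smul_mulVec, Matrix.smul_mulVec, Matrix.one_mulVec,
      smul_one_sub_apply, ← slice_permute hab]
    rfl
  refine (apply_eq_slice (a := a) (b := b) f _).trans
    (Eq.trans ?_ (apply_eq_slice (a := a) (b := b) f _).symm)
  simp only [mul_mulVec, e1, e2, slice_leg_fst (Z := Z) hab, slice_leg_snd (Z := Z)]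
  exact congrFun (congrFun (LinearMap.congr_fun h (slice a b f φ)) (f a)) (f b)

end ReflectionFactors

/-! ### Ordered products -/

section OrderedProduct

variable {ι E : Type*} [Monoid E]

/-- The product `s₁ (r₁₂ ⋯ r₁ₖ) s₂ (r₂₃ ⋯ r₂ₖ) ⋯ sₖ`. -/
def orderedProd (s : ι → E) (r : ι → ι → E) : List ι → E
  | [] => 1
  | a :: l => s a * (l.map (r a)).prod * orderedProd s r l

theorem map_orderedProd {F : Type*} [Monoid F] (φ : E →* F) (s : ι → E) (r : ι → ι → E)
    (l : List ι) : φ (orderedProd s r l) = orderedProd (fun a => φ (s a)) (fun a b => φ (r a b)) l := by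
  induction l with
  | nil => exact map_one φ
  | cons a l ih =>
    simp only [orderedProd, map_mul, ih, map_list_prod, List.map_map]
    rfl

theorem orderedProd_map {κ : Type*} (e : κ → ι) (s : ι → E) (r : ι → ι → E) (l : List κ) :
    orderedProd s r (l.map e) = orderedProd (fun a => s (e a)) (fun a b => r (e a) (e b)) l := by
  induction l with
  | nil => rfl
  | cons a l ih =>
    simp only [orderedProd, List.map_cons, List.map_map, ih]
    rfl

theorem list_prod_induction {p : E → Prop} (h1 : p 1) (hm : ∀ x y, p x → p y → p (x * y))
    {l : List E} (h : ∀ x ∈ l, p x) : p l.prod :=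
  List.prod_induction p (fun x y hx hy => hm x y hx hy) h1 h

theorem orderedProd_induction {p : E → Prop} (h1 : p 1) (hm : ∀ x y, p x → p y → p (x * y))
    {s : ι → E} {r : ι → ι → E} {l : List ι} (hl : l.Nodup) (hs : ∀ a ∈ l, p (s a))
    (hr : ∀ a ∈ l, ∀ b ∈ l, a ≠ b → p (r a b)) : p (orderedProd s r l) := by
  induction l with
  | nil => exact h1
  | cons a l ih =>
    rw [List.nodup_cons] at hl
    refine hm _ _ (hm _ _ (hs a (by simp)) ?_) (ih hl.2 (fun b hb => hs b (by simp [hb]))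
      (fun b hb c hc => hr b (by simp [hb]) c (by simp [hc])))
    refine list_prod_induction h1 hm fun x hx => ?_
    obtain ⟨b, hb, rfl⟩ := List.mem_map.1 hx
    exact hr a (by simp) b (by simp [hb]) (by rintro rfl; exact hl.1 hb)

theorem prod_map_mul_prod_map (r r' : ι → E) {l : List ι} (hl : l.Nodup)
    (h : ∀ c ∈ l, ∀ d ∈ l, c ≠ d → Commute (r c) (r' d)) :
    (l.map r).prod * (l.map r').prod = (l.map fun c => r c * r' c).prod := by
  induction l with
  | nil => simp
  | cons c l ih =>
    rw [List.nodup_cons] at hl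
    have h1 : Commute (l.map r).prod (r' c) := by
      refine list_prod_induction (p := fun x => Commute x (r' c)) (Commute.one_left _)
        (fun x y hx hy => hx.mul_left hy) fun x hx => ?_
      obtain ⟨b, hb, rfl⟩ := List.mem_map.1 hx
      exact h b (by simp [hb]) c (by simp) (by rintro rfl; exact hl.1 hb)
    simp only [List.map_cons, List.prod_cons]
    rw [← ih hl.2 fun b hb d hd => h b (by simp [hb]) d (by simp [hd])]
    calc _ = r c * ((l.map r).prod * r' c) * (l.map r').prod := by simp only [mul_assoc]
      _ = _ := by rw [h1.eq]; simp only [mul_assoc]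

theorem orderedProd_append (s : ι → E) (r : ι → ι → E) {l l' : List ι} (hl : (l ++ l').Nodup)
    (hs : ∀ a ∈ l, ∀ b ∈ l', ∀ c ∈ l, c ≠ a → Commute (r a b) (s c))
    (hr : ∀ a ∈ l, ∀ b ∈ l', ∀ c ∈ l, ∀ d ∈ l, c ≠ a → d ≠ a → c ≠ d → Commute (r a b) (r c d)) :
    orderedProd s r (l ++ l') = orderedProd s r l *
      (l.map fun a => (l'.map (r a)).prod).prod * orderedProd s r l' := by
  induction l with
  | nil => simp [orderedProd]
  | cons a l ih =>
    rw [List.cons_append, List.nodup_cons] at hl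
    have hal : a ∉ l := fun h => hl.1 (by simp [h])
    have h1 : Commute (l'.map (r a)).prod (orderedProd s r l) := by
      refine list_prod_induction (p := fun x => Commute x _) (Commute.one_left _)
        (fun x y hx hy => hx.mul_left hy) fun x hx => ?_
      obtain ⟨b, hb, rfl⟩ := List.mem_map.1 hx
      refine orderedProd_induction (p := fun x => Commute (r a b) x) (Commute.one_right _)
        (fun x y hx hy => hx.mul_right hy) hl.2.of_append_left (fun c hc => ?_)
        fun c hc d hd hcd => ?_
      · exact hs a (by simp) b hb c (by simp [hc]) (by rintro rfl; exact hal hc)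
      · exact hr a (by simp) b hb c (by simp [hc]) d (by simp [hd]) (by rintro rfl; exact hal hc)
          (by rintro rfl; exact hal hd) hcd
    have h2 := ih hl.2 (fun b hb c hc d hd => hs b (by simp [hb]) c hc d (by simp [hd]))
      (fun b hb c hc d hd e he => hr b (by simp [hb]) c hc d (by simp [hd]) e (by simp [he]))
    simp only [List.cons_append, orderedProd, h2, List.map_append, List.prod_append, List.map_cons,
      List.prod_cons]
    calc _ = s a * (l.map (r a)).prod * ((l'.map (r a)).prod * orderedProd s r l) *
          (l.map fun a => (l'.map (r a)).prod).prod * orderedProd s r l' := by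
          simp only [mul_assoc]
      _ = _ := by rw [h1.eq]; simp only [mul_assoc]

end OrderedProduct

/-! ### Preservation of symmetric tensors -/

section Preserve

variable {E : Type*} [Ring E]

/-- `X` preserves the vectors invariant under the involution `p`. -/
def Preserves (p X : E) : Prop := (1 - p) * X * (1 + p) = 0

theorem Preserves.mul (h2 : ∀ x : E, 2 * x = 0 → x = 0) {p X Y : E} (hX : Preserves p X)
    (hY : Preserves p Y) : Preserves p (X * Y) := by
  apply h2
  calc 2 * ((1 - p) * (X * Y) * (1 + p))
    _ = (1 - p) * X * ((1 - p) * Y * (1 + p)) + ((1 - p) * X * (1 + p)) * Y * (1 + p) := by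
        noncomm_ring
    _ = 0 := by rw [hY, hX]; simp

theorem Preserves.of_commute {p X : E} (hp : p * p = 1) (h : Commute p X) : Preserves p X := by
  have : (1 - p) * X = X * (1 - p) := by rw [sub_mul, mul_sub, one_mul, mul_one, h.eq]
  have h' : (1 - p) * (1 + p) = 0 := by
    rw [sub_mul, mul_add, mul_add, mul_one, one_mul, mul_one, hp, add_comm 1 p, sub_self]
  rw [Preserves, this, mul_assoc, h', mul_zero]

theorem preserves_one {p : E} (hp : p * p = 1) : Preserves p 1 :=
  .of_commute hp (Commute.one_right p)

/-- Fusion of two neighbouring factors. -/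
theorem preserves_of_fusion {Z : Type*} [CommRing Z] [Algebra Z E] {p k k' : E} {y y' : Z}
    (hp : p * p = 1) (hk : p * k = k' * p) (hkk : k * k' = k * p) (hy : y - y' + y * y' = 0) :
    Preserves p ((1 + y • k) * (1 + y' • k')) := by
  have e1 : k' = p * k * p := by rw [hk, mul_assoc, hp, mul_one]
  have e2 : p * (1 + p) = 1 + p := by rw [mul_add, hp, mul_one, add_comm]
  have e3 : (1 - p) * p = -(1 - p) := by rw [sub_mul, hp, one_mul, neg_sub]
  have e4 : (1 - p) * (1 + p) = 0 := by rw [mul_add, e3, mul_one, add_neg_cancel]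
  have e5 : (1 - p) * k' * (1 + p) = -((1 - p) * k * (1 + p)) := by
    rw [e1]
    calc (1 - p) * (p * k * p) * (1 + p) = ((1 - p) * p) * k * (p * (1 + p)) := by
          simp only [mul_assoc]
      _ = _ := by rw [e2, e3]; simp only [neg_mul]
  have e6 : (1 - p) * (k * k') * (1 + p) = (1 - p) * k * (1 + p) := by
    rw [hkk]
    calc (1 - p) * (k * p) * (1 + p) = (1 - p) * k * (p * (1 + p)) := by simp only [mul_assoc]
      _ = _ := by rw [e2]
  have e7 : (1 - p) * ((1 + y • k) * (1 + y' • k')) * (1 + p) = (1 - p) * (1 + p) +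
      y • ((1 - p) * k * (1 + p)) + y' • ((1 - p) * k' * (1 + p)) +
        (y * y') • ((1 - p) * (k * k') * (1 + p)) := by
    simp only [mul_add, add_mul, mul_one, one_mul, smul_mul_assoc, mul_smul_comm, smul_smul,
      smul_add, mul_comm y y', sub_mul, smul_sub]
    abel
  rw [Preserves, e7, e4, e5, e6]
  have : (y - y' + y * y') • ((1 - p) * k * (1 + p)) = 0 := by rw [hy, zero_smul]
  rw [add_smul, sub_smul] at this
  rw [zero_add, smul_neg, ← sub_eq_add_neg, this]

end Preserve

section FactorsPreserve

variable {ι I A Z : Type*} [Fintype ι] [DecidableEq ι] [Fintype I] [DecidableEq I] [Ring A]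
  [CommRing Z] [Algebra Z A]

/-- The partially transposed `R`-matrix. -/
def rContract (I A : Type*) [DecidableEq I] [Fintype I] [Ring A] [Algebra Z A] (y : ι → ι → Z)
    (a b : ι) : Matrix (ι → I) (ι → I) A := 1 + y a b • contract I A a b

theorem rContract_commute_leg (y : ι → ι → Z) {a b c : ι} (hab : a ≠ b) (hac : a ≠ c) (hbc : b ≠ c)
    (X : Matrix I I A) : Commute (rContract I A y a b) (leg c X) :=
  (Commute.one_left _).add_left
    (Commute.smul_left (show Commute (contract I A a b) (leg c X) from
      (leg_mul_contract hac.symm hbc.symm hab X).symm) _)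

theorem rContract_commute (y : ι → ι → Z) {a b c d : ι} (hac : a ≠ c) (had : a ≠ d) (hbc : b ≠ c)
    (hbd : b ≠ d) (hab : a ≠ b) (hcd : c ≠ d) :
    Commute (rContract I A y a b) (rContract I A y c d) :=
  (Commute.one_left _).add_left ((Commute.one_right _).add_right
    (((show Commute (contract I A a b) (contract I A c d) from
      contract_mul_contract hac had hbc hbd hab hcd).smul_right _).smul_left _))

/-- The ordered product preserves symmetry in two neighbouring tensor factors. -/
theorem preserves_orderedProd (h2 : ∀ x : A, 2 * x = 0 → x = 0) (T : ι → Matrix I I A)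
    (y : ι → ι → Z) {a b : ι} (hab : a ≠ b) {l₀ l₁ : List ι} (hl : (l₀ ++ a :: b :: l₁).Nodup)
    (hT : Preserves (permute I A (Equiv.swap a b))
      (leg a (T a) * rContract I A y a b * leg b (T b)))
    (hy : ∀ c, y c a - y c b + y c a * y c b = 0) (hy' : ∀ c, y a c - y b c + y a c * y b c = 0) :
    Preserves (permute I A (Equiv.swap a b))
      (orderedProd (fun c => leg c (T c)) (rContract I A y) (l₀ ++ a :: b :: l₁)) := by
  set p := permute I A (Equiv.swap a b) with hp
  have hpp : p * p = 1 := by rw [hp, permute_mul, Equiv.swap_mul_self, permute_one]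
  have h2' : ∀ x : Matrix (ι → I) (ι → I) A, 2 * x = 0 → x = 0 := fun x hx => by
    ext1 f g
    apply h2
    have := congrFun (congrFun hx f) g
    rwa [two_mul, Matrix.add_apply, ← two_mul] at this
  have hmul : ∀ X Y, Preserves p X → Preserves p Y → Preserves p (X * Y) :=
    fun X Y hX hY => Preserves.mul h2' hX hY
  have hleg : ∀ c X, c ≠ a → c ≠ b → Preserves p (leg c X) := fun c X hca hcb => by
    refine .of_commute hpp ?_
    show _ * _ = _ * _
    rw [hp, permute_mul_leg, Equiv.swap_apply_of_ne_of_ne hca hcb]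
  have hr : ∀ c d, c ≠ a → c ≠ b → d ≠ a → d ≠ b → c ≠ d → Preserves p (rContract I A y c d) :=
    fun c d hca hcb hda hdb hcd => by
    refine .of_commute hpp ((Commute.one_right _).add_right (Commute.smul_right ?_ _))
    show _ * _ = _ * _
    rw [hp, permute_mul_contract _ hcd, Equiv.swap_apply_of_ne_of_ne hca hcb,
      Equiv.swap_apply_of_ne_of_ne hda hdb]
  have hrr : ∀ c, c ≠ a → c ≠ b →
      Preserves p (rContract I A y c a * rContract I A y c b) := fun c hca hcb => by
    refine preserves_of_fusion hpp ?_ (contract_mul_contract_eq_permute hca hcb hab) (hy c)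
    rw [hp, permute_mul_contract _ hca, Equiv.swap_apply_of_ne_of_ne hca hcb,
      Equiv.swap_apply_left]
  have hrr' : ∀ c, c ≠ a → c ≠ b →
      Preserves p (rContract I A y a c * rContract I A y b c) := fun c hca hcb => by
    rw [rContract, rContract, contract_comm a c, contract_comm b c]
    refine preserves_of_fusion hpp ?_ (contract_mul_contract_eq_permute hca hcb hab) (hy' c)
    rw [hp, permute_mul_contract _ hca, Equiv.swap_apply_of_ne_of_ne hca hcb,
      Equiv.swap_apply_left]
  induction l₀ with
  | nil =>
    simp only [List.nil_append, List.nodup_cons, List.mem_cons, not_or] at hl ⊢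
    obtain ⟨⟨-, hal⟩, hbl, hl⟩ := hl
    have e0 : ∀ c ∈ l₁, c ≠ a ∧ c ≠ b := fun c hc =>
      ⟨by rintro rfl; exact hal hc, by rintro rfl; exact hbl hc⟩
    have e1 : Commute (l₁.map (rContract I A y a)).prod (leg b (T b)) := by
      refine list_prod_induction (p := fun x => Commute x _) (Commute.one_left _)
        (fun x y hx hy => hx.mul_left hy) fun x hx => ?_
      obtain ⟨c, hc, rfl⟩ := List.mem_map.1 hx
      exact rContract_commute_leg y (e0 c hc).1.symm hab (e0 c hc).2 _
    have e2 := prod_map_mul_prod_map (rContract I A y a) (rContract I A y b) hl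
      (fun c hc d hd hcd => rContract_commute y hab (e0 d hd).1.symm (e0 c hc).2 hcd
        (e0 c hc).1.symm (e0 d hd).2.symm)
    have e3 : orderedProd (fun c => leg c (T c)) (rContract I A y) (a :: b :: l₁) =
        leg a (T a) * rContract I A y a b * leg b (T b) *
          (l₁.map fun c => rContract I A y a c * rContract I A y b c).prod *
          orderedProd (fun c => leg c (T c)) (rContract I A y) l₁ := by
      rw [← e2]
      simp only [orderedProd, List.map_cons, List.prod_cons]
      calc _ = leg a (T a) * rContract I A y a b * ((l₁.map (rContract I A y a)).prod *
            leg b (T b)) * (l₁.map (rContract I A y b)).prod *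
            orderedProd (fun c => leg c (T c)) (rContract I A y) l₁ := by simp only [mul_assoc]
        _ = _ := by rw [e1.eq]; simp only [mul_assoc]
    rw [e3]
    refine hmul _ _ (hmul _ _ hT ?_) ?_
    · refine list_prod_induction (preserves_one hpp) hmul fun x hx => ?_
      obtain ⟨c, hc, rfl⟩ := List.mem_map.1 hx
      exact hrr' c (e0 c hc).1 (e0 c hc).2
    · exact orderedProd_induction (preserves_one hpp) hmul hl
        (fun c hc => hleg c _ (e0 c hc).1 (e0 c hc).2)
        fun c hc d hd hcd => hr c d (e0 c hc).1 (e0 c hc).2 (e0 d hd).1 (e0 d hd).2 hcd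
  | cons c l₀ ih =>
    rw [List.cons_append, List.nodup_cons] at hl
    have hc : ∀ d ∈ l₀ ++ a :: b :: l₁, c ≠ d := fun d hd h => hl.1 (h ▸ hd)
    have hca := hc a (by simp)
    have hcb := hc b (by simp)
    have hn := hl.2
    rw [List.nodup_append] at hn
    obtain ⟨-, hn1, hn2⟩ := hn
    simp only [List.nodup_cons, List.mem_cons, not_or] at hn1
    rw [List.cons_append, orderedProd]
    refine hmul _ _ (hmul _ _ (hleg c _ hca hcb) ?_) (ih hl.2)
    have hlist : ∀ l : List ι, (∀ d ∈ l, d ∈ l₀ ++ a :: b :: l₁ ∧ d ≠ a ∧ d ≠ b) →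
        Preserves p (l.map (rContract I A y c)).prod := fun l hl' => by
      refine list_prod_induction (preserves_one hpp) hmul fun x hx => ?_
      obtain ⟨d, hd, rfl⟩ := List.mem_map.1 hx
      exact hr c d hca hcb (hl' d hd).2.1 (hl' d hd).2.2 (hc d (hl' d hd).1)
    rw [List.map_append, List.prod_append, List.map_cons, List.prod_cons, List.map_cons,
      List.prod_cons, ← mul_assoc (rContract I A y c a)]
    refine hmul _ _ (hlist l₀ fun d hd => ⟨by simp [hd], hn2 d hd a (by simp),
      hn2 d hd b (by simp)⟩) (hmul _ _ (hrr c hca hcb) (hlist l₁ fun d hd => ⟨by simp [hd], ?_, ?_⟩))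
    · rintro rfl
      exact hn1.1.2 hd
    · rintro rfl
      exact hn1.2.1 hd

end FactorsPreserve

/-! ### Antisymmetrizers -/

section Alternator

variable {ι I A : Type*} [Fintype ι] [DecidableEq ι] [Fintype I] [DecidableEq I] [Ring A]

/-- The antisymmetrizer on the tensor factors labelled by `ι`. -/
def alternator (ι I A : Type*) [Fintype ι] [DecidableEq ι] [DecidableEq I] [Ring A] :
    Matrix (ι → I) (ι → I) A :=
  fun f g => ∑ σ : Equiv.Perm ι, if f = g ∘ σ.symm then ((Equiv.Perm.sign σ : ℤ) : A) else 0

theorem alternator_eq_sum :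
    alternator ι I A = ∑ σ : Equiv.Perm ι, (Equiv.Perm.sign σ : ℤ) • permute I A σ := by
  ext1 f g
  rw [Matrix.sum_apply, alternator]
  refine Finset.sum_congr rfl fun σ _ => ?_
  rw [Matrix.smul_apply, permute, smul_ite, smul_zero, zsmul_one]

theorem permute_mul_apply (σ : Equiv.Perm ι) (X : Matrix (ι → I) (ι → I) A) (f g : ι → I) :
    (permute I A σ * X) f g = X (f ∘ σ) g := by
  have := congrFun (mul_mulVec (permute I A σ) X (Pi.single g 1)) f
  rw [permute_mulVec] at this
  simpa using this

theorem mul_permute_apply (σ : Equiv.Perm ι) (X : Matrix (ι → I) (ι → I) A) (f g : ι → I) :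
    (X * permute I A σ) f g = X f (g ∘ σ.symm) := by
  rw [Matrix.mul_apply, Finset.sum_eq_single (g ∘ σ.symm)]
  · simp [permute]
  · intro h _ hh
    rw [permute, if_neg hh, mul_zero]
  · simp

theorem alternator_mul_apply (X : Matrix (ι → I) (ι → I) A) (f g : ι → I) :
    (alternator ι I A * X) f g = ∑ σ : Equiv.Perm ι, (Equiv.Perm.sign σ : ℤ) • X (f ∘ σ) g := by
  rw [alternator_eq_sum, Finset.sum_mul, Matrix.sum_apply]
  refine Finset.sum_congr rfl fun σ _ => ?_
  rw [Matrix.smul_mul, Matrix.smul_apply, permute_mul_apply]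

theorem alternator_mul_permute (τ : Equiv.Perm ι) :
    alternator ι I A * permute I A τ = (Equiv.Perm.sign τ : ℤ) • alternator ι I A := by
  rw [alternator_eq_sum, Finset.sum_mul, Finset.smul_sum]
  refine Finset.sum_equiv (Equiv.mulRight τ) (by simp) fun σ _ => ?_
  rw [Matrix.smul_mul, permute_mul, smul_smul, Equiv.coe_mulRight, Equiv.Perm.sign_mul,
    Units.val_mul, mul_left_comm, ← Units.val_mul, Int.units_mul_self, Units.val_one, mul_one]

theorem permute_mul_alternator (τ : Equiv.Perm ι) :
    permute I A τ * alternator ι I A = (Equiv.Perm.sign τ : ℤ) • alternator ι I A := by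
  rw [alternator_eq_sum, Finset.mul_sum, Finset.smul_sum]
  refine Finset.sum_equiv (Equiv.mulLeft τ) (by simp) fun σ _ => ?_
  rw [Matrix.mul_smul, permute_mul, smul_smul, Equiv.coe_mulLeft, Equiv.Perm.sign_mul,
    Units.val_mul, ← mul_assoc, ← Units.val_mul, Int.units_mul_self, Units.val_one, one_mul]

theorem alternator_mul_apply_comp_left (X : Matrix (ι → I) (ι → I) A) (τ : Equiv.Perm ι)
    (f g : ι → I) : (alternator ι I A * X) (f ∘ τ) g =
      (Equiv.Perm.sign τ : ℤ) • (alternator ι I A * X) f g := by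
  rw [← permute_mul_apply τ (alternator ι I A * X) f g, ← mul_assoc, permute_mul_alternator, Matrix.smul_mul, Matrix.smul_apply]

theorem alternator_mul_mul_swap (h2 : ∀ x : A, 2 * x = 0 → x = 0) {X : Matrix (ι → I) (ι → I) A}
    {a b : ι} (hab : a ≠ b) (hX : Preserves (permute I A (Equiv.swap a b)) X) :
    alternator ι I A * X * permute I A (Equiv.swap a b) = -(alternator ι I A * X) := by
  set p := permute I A (Equiv.swap a b) with hp
  have h1 : alternator ι I A * p = -alternator ι I A := by
    rw [hp, alternator_mul_permute, Equiv.Perm.sign_swap hab]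
    simp
  have h3 : alternator ι I A * (1 - p) = 2 * alternator ι I A := by
    rw [mul_sub, mul_one, h1, sub_neg_eq_add, two_mul]
  have h4 : 2 * (alternator ι I A * X * (1 + p)) = 0 := by
    calc _ = alternator ι I A * (1 - p) * X * (1 + p) := by rw [h3]; simp only [mul_assoc]
      _ = alternator ι I A * ((1 - p) * X * (1 + p)) := by simp only [mul_assoc]
      _ = 0 := by rw [hX, mul_zero]
  have h5 : alternator ι I A * X * (1 + p) = 0 := by
    ext1 f g
    apply h2
    have := congrFun (congrFun h4 f) g
    rwa [two_mul, Matrix.add_apply, ← two_mul] at this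
  rw [mul_add, mul_one] at h5
  exact (neg_eq_of_add_eq_zero_right h5).symm

theorem alternator_mul_mul_permute (h2 : ∀ x : A, 2 * x = 0 → x = 0) {n : ℕ}
    {X : Matrix (Fin n → I) (Fin n → I) A}
    (hX : ∀ i j : Fin n, (j : ℕ) = i + 1 → Preserves (permute I A (Equiv.swap i j)) X)
    (σ : Equiv.Perm (Fin n)) : alternator (Fin n) I A * X * permute I A σ =
      (Equiv.Perm.sign σ : ℤ) • (alternator (Fin n) I A * X) := by
  cases n with
  | zero =>
    rw [Subsingleton.elim σ 1, permute_one]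
    simp
  | succ n =>
    have hσ : σ ∈ Submonoid.closure
        (Set.range fun i : Fin n => Equiv.swap i.castSucc i.succ) := by
      rw [Equiv.Perm.mclosure_swap_castSucc_succ]
      trivial
    induction hσ using Submonoid.closure_induction with
    | mem σ hσ =>
      obtain ⟨i, rfl⟩ := hσ
      have hi : i.castSucc ≠ i.succ := Fin.castSucc_lt_succ.ne
      show alternator (Fin (n + 1)) I A * X * permute I A (Equiv.swap i.castSucc i.succ) =
        (Equiv.Perm.sign (Equiv.swap i.castSucc i.succ) : ℤ) • _
      rw [alternator_mul_mul_swap h2 hi (hX _ _ (by simp)), Equiv.Perm.sign_swap hi]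
      simp
    | one => simp [permute_one]
    | mul σ τ _ _ hσ hτ =>
      rw [← permute_mul, ← mul_assoc, hσ, Matrix.smul_mul, hτ, smul_smul, Equiv.Perm.sign_mul,
        Units.val_mul]

theorem apply_comp_of_antisymm {X : Matrix (ι → I) (ι → I) A}
    (h : ∀ σ : Equiv.Perm ι, X * permute I A σ = (Equiv.Perm.sign σ : ℤ) • X) (f g : ι → I)
    (σ : Equiv.Perm ι) : X f (g ∘ σ) = (Equiv.Perm.sign σ : ℤ) • X f g := by
  have := congrFun (congrFun (h σ⁻¹) f) g
  rw [mul_permute_apply, Matrix.smul_apply, Equiv.Perm.sign_inv] at this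
  exact this

theorem apply_eq_zero_of_antisymm (h2 : ∀ x : A, 2 * x = 0 → x = 0)
    {X : Matrix (ι → I) (ι → I) A}
    (h : ∀ σ : Equiv.Perm ι, X * permute I A σ = (Equiv.Perm.sign σ : ℤ) • X) (f g : ι → I)
    {a b : ι} (hab : a ≠ b) (hg : g a = g b) : X f g = 0 := by
  have h1 := apply_comp_of_antisymm h f g (Equiv.swap a b)
  have h3 : g ∘ Equiv.swap a b = g := by
    ext1 c
    by_cases hca : c = a
    · subst hca; simp [hg]
    · by_cases hcb : c = b
      · subst hcb; simp [hg]
      · simp [Equiv.swap_apply_of_ne_of_ne hca hcb]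
  rw [h3, Equiv.Perm.sign_swap hab, Units.val_neg, Units.val_one, neg_smul, one_smul] at h1
  apply h2
  rw [two_mul]
  nth_rewrite 1 [h1]
  exact neg_add_cancel _

end Alternator

/-! ### Products of spectral parameter dependent operators -/

section Spectral

/-- The expansion of `1 / (2 u - d)`. -/
def pole (d : ℂ) : ℂ⟦X⟧ := C (1 / 2) * invLin (-(d / 2))

theorem two_sub_mul_pole (d : ℂ) : (2 - C d * X) * pole d = X := by
  have h := one_add_C_mul_X_mul_invLin (-(d / 2))
  have h1 : (C (-(d / 2)) : ℂ⟦X⟧) = -(C d * C (1 / 2)) := by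
    rw [← map_mul, ← map_neg]; congr 1; ring
  have h2 : (2 : ℂ⟦X⟧) * C (1 / 2) = 1 := by
    rw [← map_ofNat (C : ℂ →+* ℂ⟦X⟧) 2, ← map_mul]
    norm_num
  rw [h1] at h
  rw [pole]
  linear_combination h + invLin (-(d / 2)) * h2

theorem two_sub_C_mul_X_ne_zero (d : ℂ) : (2 - C d * X : ℂ⟦X⟧) ≠ 0 := fun h => by
  have := congrArg constantCoeff h
  rw [map_sub, map_ofNat] at this
  simp at this

theorem pole_sub_pole (d : ℂ) : pole d - pole (d + 1) + pole d * pole (d + 1) = 0 := by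
  have h1 := two_sub_mul_pole d
  have h2 := two_sub_mul_pole (d + 1)
  refine (mul_eq_zero.1 (?_ : (2 - C d * X) * (2 - C (d + 1) * X) *
    (pole d - pole (d + 1) + pole d * pole (d + 1)) = 0)).resolve_left
    (mul_ne_zero (two_sub_C_mul_X_ne_zero _) (two_sub_C_mul_X_ne_zero _))
  rw [map_add, map_one] at *
  linear_combination (2 - (C d + 1) * X) * h1 - (2 - C d * X) * h2 +
    ((2 - (C d + 1) * X) * pole (d + 1)) * h1 + X * h2

theorem shift_pole (c d : ℂ) : shift c (pole d) = pole (d - 2 * c) := by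
  rw [pole, shift_mul, shift_C, shift_invLin, pole]
  congr 2
  ring

variable {ι I R : Type*} [Fintype ι] [DecidableEq ι] [Fintype I] [DecidableEq I] [Ring R]
  [Algebra ℂ R]

/-- The operator `1 + K / (u_a + u_b)` with `u_a = u - p a`. -/
def rSpectral (I R : Type*) [DecidableEq I] [Fintype I] [Ring R] [Algebra ℂ R] (p : ι → ℂ) :
    ι → ι → Matrix (ι → I) (ι → I) R⟦X⟧ := rContract I R⟦X⟧ fun a b => pole (p a + p b)

/-- The product `T₁ (R₁₂ ⋯ R₁ₖ) T₂ ⋯ Tₖ` with `T_a = T(u - p a)`. -/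
def spectralProd (T : Matrix I I R⟦X⟧) (p : ι → ℂ) (l : List ι) :
    Matrix (ι → I) (ι → I) R⟦X⟧ :=
  orderedProd (fun a => leg a (T.map (shift (-(p a))))) (rSpectral I R p) l

theorem two_torsionFree (x : R⟦X⟧) (h : 2 * x = 0) : x = 0 := by
  apply torsionFree_series (2 : ℂ⟦X⟧) two_series_ne_zero
  rwa [two_smul, ← two_mul]

/-- The consequence of the reflection equation at `u - v = 1`. -/
theorem SeriesReflection.preserves {S : Matrix I I R⟦X⟧} (h : SeriesReflection 0 S) {a b : ι}
    (hab : a ≠ b) {p : ι → ℂ} (hp : p b = p a + 1) :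
    Preserves (permute I R⟦X⟧ (Equiv.swap a b)) (leg a (S.map (TwistedYangian.shift (-(p a)))) *
      rSpectral I R p a b * leg b (S.map (TwistedYangian.shift (-(p b))))) := by
  set c := p a with hc
  have h1 := Reflection.map h _ _ (evalHom₂_smul (invLin (-c)) (invLin (-(c + 1)))
    (constantCoeff_invLin _) (constantCoeff_invLin _))
  simp only [mul_zero, map_zero, zero_mul, add_zero] at h1
  simp only [map_sub, map_add, map_mul, evalHom₂_inU, evalHom₂_inV,
    subst₁_X _ (constantCoeff_invLin _)] at h1
  have hx := X_mul_neg c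
  have hy := X_mul_neg (c + 1)
  rw [map_add, map_one] at hy
  have h2 : Reflection 1 1 (2 - C (2 * c + 1) * X) (X : ℂ⟦X⟧) (S.map (TwistedYangian.shift (-c)))
      (S.map (TwistedYangian.shift (-(c + 1)))) := by
    refine Reflection.of_smul (c := X ^ 2) (d := X)
      (((h1.smul_fst ((1 - C c * X) * (1 - (C c + 1) * X))).smul_snd
        ((1 - C c * X) * (1 - (C c + 1) * X))).congr_param ?_ ?_ ?_ ?_ ?_ ?_)
      (torsionFree_series _ (by simp [X_ne_zero]))
    · linear_combination (1 - C c * X) * hy - (1 - (C c + 1) * X) * hx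
    · linear_combination (1 - C c * X) * invLin (-c) * hy + X * hx
    · rw [map_add, map_one, C_two_mul]
      linear_combination (1 - C c * X) * hy + (1 - (C c + 1) * X) * hx
    · linear_combination (1 - C c * X) * invLin (-c) * hy + X * hx
    · ext1 i j
      exact evalHom₂_inU _ _ (constantCoeff_invLin _) (constantCoeff_invLin _) _
    · ext1 i j
      exact evalHom₂_inV _ _ (constantCoeff_invLin _) (constantCoeff_invLin _) _
  have h3 := h2.factors hab
  set P := permute I R⟦X⟧ (Equiv.swap a b) with hP
  have hPP : P * P = 1 := by rw [hP, permute_mul, Equiv.swap_mul_self, permute_one]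
  rw [one_smul, one_smul] at h3
  have h4 : (2 - C (2 * c + 1) * X : ℂ⟦X⟧) • (1 : Matrix (ι → I) (ι → I) R⟦X⟧) +
      (X : ℂ⟦X⟧) • contract I R⟦X⟧ a b = (2 - C (2 * c + 1) * X : ℂ⟦X⟧) • rSpectral I R p a b := by
    rw [rSpectral, rContract, smul_add, smul_smul, show p a + p b = 2 * c + 1 by rw [hp]; ring,
      two_sub_mul_pole]
  have h5 : (1 - P) * (1 + P) = 0 := by
    rw [sub_mul, mul_add, mul_add, mul_one, one_mul, mul_one, hPP, add_comm 1 P, sub_self]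
  rw [h4] at h3
  rw [hp]
  have h6 : (2 - C (2 * c + 1) * X : ℂ⟦X⟧) • ((1 - P) * (leg a (S.map (TwistedYangian.shift (-c))) *
      rSpectral I R p a b * leg b (S.map (TwistedYangian.shift (-(c + 1))))) * (1 + P)) = 0 := by
    calc _ = ((1 - P) * leg a (S.map (TwistedYangian.shift (-c))) * ((2 - C (2 * c + 1) * X : ℂ⟦X⟧) •
        rSpectral I R p a b) * leg b (S.map (TwistedYangian.shift (-(c + 1))))) * (1 + P) := by
          simp only [Matrix.mul_smul, Matrix.smul_mul, mul_assoc]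
      _ = leg b (S.map (TwistedYangian.shift (-(c + 1)))) * ((2 - C (2 * c + 1) * X : ℂ⟦X⟧) •
        rSpectral I R p a b) * leg a (S.map (TwistedYangian.shift (-c))) * ((1 - P) * (1 + P)) := by
          rw [h3]; simp only [mul_assoc]
      _ = 0 := by rw [h5, mul_zero]
  ext1 f g
  apply torsionFree_series _ (two_sub_C_mul_X_ne_zero (2 * c + 1))
  exact congrFun (congrFun h6 f) g

theorem finRange_eq_append {n : ℕ} {i j : Fin n} (hij : (j : ℕ) = i + 1) :
    ∃ l₀ l₁, List.finRange n = l₀ ++ i :: j :: l₁ := by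
  have h1 : ∀ m (h : m < n), (List.finRange n).drop m = ⟨m, h⟩ :: (List.finRange n).drop (m + 1) := by
    intro m h
    rw [List.drop_eq_getElem_cons (by simpa using h)]
    simp
  refine ⟨(List.finRange n).take i, (List.finRange n).drop (i + 1 + 1), ?_⟩
  have hi := h1 i i.2
  have hj := h1 (i + 1) (by omega)
  rw [hj] at hi
  have e : (⟨(i : ℕ) + 1, by omega⟩ : Fin n) = j := Fin.ext hij.symm
  rw [e] at hi
  calc List.finRange n = (List.finRange n).take i ++ (List.finRange n).drop i :=
        (List.take_append_drop _ _).symm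
    _ = _ := by rw [hi]

/-- The antisymmetrized product is antisymmetric with respect to column indices, too. -/
theorem SeriesReflection.alternator_mul_spectralProd_mul_permute {S : Matrix I I R⟦X⟧}
    (h : SeriesReflection 0 S) {n : ℕ} (σ : Equiv.Perm (Fin n)) :
    alternator (Fin n) I R⟦X⟧ * spectralProd S (fun a : Fin n => ((a : ℕ) : ℂ)) (List.finRange n) *
      permute I R⟦X⟧ σ = (Equiv.Perm.sign σ : ℤ) • (alternator (Fin n) I R⟦X⟧ *
        spectralProd S (fun a : Fin n => ((a : ℕ) : ℂ)) (List.finRange n)) := by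
  refine alternator_mul_mul_permute two_torsionFree (fun i j hij => ?_) σ
  obtain ⟨l₀, l₁, hl⟩ := finRange_eq_append hij
  have hne : i ≠ j := fun h => by rw [h] at hij; omega
  have hp : ((j : ℕ) : ℂ) = ((i : ℕ) : ℂ) + 1 := by rw [hij]; push_cast; rfl
  have hy : ∀ d, pole (d + ((i : ℕ) : ℂ)) - pole (d + ((j : ℕ) : ℂ)) +
      pole (d + ((i : ℕ) : ℂ)) * pole (d + ((j : ℕ) : ℂ)) = 0 := fun d => by
    have := pole_sub_pole (d + ((i : ℕ) : ℂ))
    rwa [add_assoc, ← hp] at this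
  have key := preserves_orderedProd (Z := ℂ⟦X⟧) two_torsionFree
    (fun a : Fin n => S.map (TwistedYangian.shift (-((a : ℕ) : ℂ))))
    (fun a b => pole (((a : ℕ) : ℂ) + ((b : ℕ) : ℂ))) hne (hl ▸ List.nodup_finRange n)
    (h.preserves (p := fun a : Fin n => ((a : ℕ) : ℂ)) hne hp) (fun c => hy _) fun c => by
      rw [add_comm ((i : ℕ) : ℂ), add_comm ((j : ℕ) : ℂ)]
      exact hy _
  rw [← hl] at key
  exact key

end Spectral

/-! ### Restriction of ordered products to a subset of indices -/

section Compress

/-- Restriction to a subset of indices commutes with ordered products, although it does not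
commute with products in general. -/
theorem orderedProd_compress {ι I E F : Type*} [Monoid E] [Monoid F]
    (supp : E → (ι → I) → (ι → I) → Prop) (J : Set I) (ψ : E → F) (hψ1 : ψ 1 = 1)
    (h1 : ∀ f g, supp 1 f g → f = g)
    (hm : ∀ x y f g, supp (x * y) f g → ∃ k, supp x f k ∧ supp y k g)
    (hψ : ∀ x y, (∀ f k g, (∀ c, f c ∈ J) → (∀ c, g c ∈ J) → supp x f k → supp y k g →
      ∀ c, k c ∈ J) → ψ (x * y) = ψ x * ψ y)
    (s : ι → E) (r : ι → ι → E) (hs : ∀ a f g, supp (s a) f g → ∀ c, c ≠ a → f c = g c)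
    (hr : ∀ a b, a ≠ b → ∀ f g, supp (r a b) f g → ∀ c, c ≠ a → c ≠ b → f c = g c)
    (hr' : ∀ a b, a ≠ b → ∀ f g, supp (r a b) f g → f b ∈ J → g a ∈ J → f a ∈ J ∧ g b ∈ J)
    {l : List ι} (hl : l.Nodup) :
    ψ (orderedProd s r l) = orderedProd (fun a => ψ (s a)) (fun a b => ψ (r a b)) l := by
  have hprod : ∀ (a : ι) (l : List ι), (a :: l).Nodup → ∀ f g, supp (l.map (r a)).prod f g →
      (∀ c, c ≠ a → c ∉ l → f c = g c) ∧ ((∀ c ∈ l, f c ∈ J) → g a ∈ J →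
        f a ∈ J ∧ ∀ c ∈ l, g c ∈ J) := by
    intro a l
    induction l with
    | nil =>
      intro _ f g hfg
      obtain rfl := h1 f g hfg
      exact ⟨fun _ _ _ => rfl, fun _ h => ⟨h, by simp⟩⟩
    | cons b l ih =>
      intro hn f g hfg
      simp only [List.nodup_cons, List.mem_cons, not_or] at hn
      rw [List.map_cons, List.prod_cons] at hfg
      obtain ⟨k, hfk, hkg⟩ := hm _ _ _ _ hfg
      obtain ⟨i1, i2⟩ := ih (by simp only [List.nodup_cons]; exact ⟨hn.1.2, hn.2.2⟩) k g hkg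
      have hk := hr a b hn.1.1 f k hfk
      have hk' := hr' a b hn.1.1 f k hfk
      constructor
      · intro c hca hc
        simp only [List.mem_cons, not_or] at hc
        rw [hk c hca hc.1, i1 c hca hc.2]
      · intro hf hg
        have hkl : ∀ c ∈ l, k c ∈ J := fun c hc => by
          rw [← hk c (by rintro rfl; exact hn.1.2 hc) (by rintro rfl; exact hn.2.1 hc)]
          exact hf c (by simp [hc])
        obtain ⟨j1, j2⟩ := i2 hkl hg
        obtain ⟨j3, j4⟩ := hk' (hf b (by simp)) j1
        refine ⟨j3, fun c hc => ?_⟩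
        rcases List.mem_cons.1 hc with rfl | hc
        · rw [← i1 c (Ne.symm hn.1.1) hn.2.1]
          exact j4
        · exact j2 c hc
  have hprodψ : ∀ (a : ι) (l : List ι), (a :: l).Nodup →
      ψ (l.map (r a)).prod = (l.map fun b => ψ (r a b)).prod := by
    intro a l
    induction l with
    | nil => intro _; simpa using hψ1
    | cons b l ih =>
      intro hn
      simp only [List.nodup_cons, List.mem_cons, not_or] at hn
      have hn' : (a :: l).Nodup := by simp only [List.nodup_cons]; exact ⟨hn.1.2, hn.2.2⟩
      rw [List.map_cons, List.prod_cons, hψ, ih hn', List.map_cons, List.prod_cons]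
      intro f k g hf hg hfk hkg c
      have hk := hr a b hn.1.1 f k hfk
      have hk' := hr' a b hn.1.1 f k hfk
      obtain ⟨i1, i2⟩ := hprod a l hn' k g hkg
      have hkl : ∀ c ∈ l, k c ∈ J := fun c hc => by
        rw [← hk c (by rintro rfl; exact hn.1.2 hc) (by rintro rfl; exact hn.2.1 hc)]
        exact hf c
      have hka := (i2 hkl (hg a)).1
      by_cases hca : c = a
      · rw [hca]; exact hka
      · by_cases hcb : c = b
        · rw [hcb]; exact (hk' (hf b) hka).2
        · rw [← hk c hca hcb]; exact hf c
  have hord : ∀ l : List ι, l.Nodup → ∀ f g, supp (orderedProd s r l) f g →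
      ∀ c, c ∉ l → f c = g c := by
    intro l
    induction l with
    | nil => intro _ f g hfg c _; rw [h1 f g hfg]
    | cons a l ih =>
      intro hn f g hfg c hc
      have hn' := hn
      simp only [List.nodup_cons, List.mem_cons, not_or] at hn hc
      rw [orderedProd] at hfg
      obtain ⟨k, hfk, hkg⟩ := hm _ _ _ _ hfg
      obtain ⟨k', hfk', hkk⟩ := hm _ _ _ _ hfk
      rw [hs a f k' hfk' c hc.1, (hprod a l hn' k' k hkk).1 c hc.1 hc.2, ih hn.2 k g hkg c hc.2]
  induction l with
  | nil => exact hψ1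
  | cons a l ih =>
    have hn := List.nodup_cons.1 hl
    rw [orderedProd, orderedProd, ← ih hn.2, ← hprodψ a l hl, mul_assoc, mul_assoc, hψ, hψ]
    · intro f k g hf hg hfk hkg c
      obtain ⟨i1, i2⟩ := hprod a l hl f k hfk
      have hka : k a ∈ J := by
        rw [hord l hn.2 k g hkg a hn.1]
        exact hg a
      by_cases hca : c = a
      · rw [hca]; exact hka
      · by_cases hcl : c ∈ l
        · exact (i2 (fun c _ => hf c) hka).2 c hcl
        · rw [← i1 c hca hcl]; exact hf c
    · intro f k g hf hg hfk hkg c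
      by_cases hca : c = a
      · obtain ⟨k', hk1, hk2⟩ := hm _ _ _ _ hkg
        rw [hca]
        refine ((hprod a l hl k k' hk1).2 (fun d hd => ?_) ?_).1
        · rw [← hs a f k hfk d (by rintro rfl; exact hn.1 hd)]
          exact hf d
        · rw [hord l hn.2 k' g hk2 a hn.1]
          exact hg a
      · rw [← hs a f k hfk c hca]; exact hf c

variable {ι I J A Z : Type*} [Fintype ι] [DecidableEq ι] [Fintype I] [DecidableEq I] [Fintype J]
  [DecidableEq J] [Ring A] [CommRing Z] [Algebra Z A]

theorem exists_of_mul_apply_ne_zero {n : Type*} [Fintype n] {X Y : Matrix n n A} {f g : n}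
    (h : (X * Y) f g ≠ 0) : ∃ k, X f k ≠ 0 ∧ Y k g ≠ 0 := by
  rw [Matrix.mul_apply] at h
  obtain ⟨k, -, hk⟩ := Finset.exists_ne_zero_of_sum_ne_zero h
  exact ⟨k, left_ne_zero_of_mul hk, right_ne_zero_of_mul hk⟩

theorem submatrix_mul_of_forall {j : J → I} (hj : Function.Injective j)
    (X Y : Matrix (ι → I) (ι → I) A)
    (h : ∀ f g : ι → J, ∀ k, X (j ∘ f) k ≠ 0 → Y k (j ∘ g) ≠ 0 → ∀ c, k c ∈ Set.range j) :
    (X * Y).submatrix (j ∘ ·) (j ∘ ·) =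
      X.submatrix (j ∘ ·) (j ∘ ·) * Y.submatrix (j ∘ ·) (j ∘ ·) := by
  ext1 f g
  rw [Matrix.submatrix_apply, Matrix.mul_apply, Matrix.mul_apply]
  symm
  refine Finset.sum_of_injOn (fun k => j ∘ k) (fun k _ k' _ h => hj.comp_left h)
    (fun _ _ => by simp) (fun k _ hk => ?_) fun k _ => rfl
  by_contra h0
  have hc := h f g k (left_ne_zero_of_mul h0) (right_ne_zero_of_mul h0)
  choose k' hk' using hc
  exact hk ⟨k', by simp, funext hk'⟩

theorem submatrix_leg {j : J → I} (hj : Function.Injective j) (a : ι) (X : Matrix I I A) :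
    (leg a X).submatrix (j ∘ ·) (j ∘ ·) = leg a (X.submatrix j j) := by
  ext1 f g
  simp [leg, hj.eq_iff]

theorem submatrix_contract {j : J → I} (hj : Function.Injective j) (a b : ι) :
    (contract I A a b).submatrix (j ∘ ·) (j ∘ ·) = contract J A a b := by
  ext1 f g
  simp [contract, hj.eq_iff]

theorem submatrix_comp_one {j : J → I} (hj : Function.Injective j) :
    (1 : Matrix (ι → I) (ι → I) A).submatrix (j ∘ ·) (j ∘ ·) = 1 :=
  Matrix.submatrix_one _ hj.comp_left

theorem submatrix_rContract {j : J → I} (hj : Function.Injective j) (y : ι → ι → Z) (a b : ι) :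
    (rContract I A y a b).submatrix (j ∘ ·) (j ∘ ·) = rContract J A y a b := by
  rw [rContract, rContract, ← submatrix_contract hj, ← submatrix_comp_one hj]
  rfl

theorem eq_of_leg_ne_zero {a : ι} {X : Matrix I I A} {f g : ι → I} (h : leg a X f g ≠ 0) :
    ∀ c, c ≠ a → f c = g c := by
  by_contra h'
  exact h (if_neg h')

theorem rContract_ne_zero {y : ι → ι → Z} {a b : ι} {f g : ι → I}
    (h : rContract I A y a b f g ≠ 0) :
    f = g ∨ ((∀ c, c ≠ a → c ≠ b → f c = g c) ∧ f a = f b ∧ g a = g b) := by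
  by_contra! h'
  apply h
  rw [rContract, Matrix.add_apply, Matrix.one_apply_ne h'.1, Matrix.smul_apply, contract, if_neg,
    smul_zero, add_zero]
  rintro ⟨h1, h2, h3⟩
  exact h'.2 h1 h2 h3

theorem rContract_ne_zero_left {y : ι → ι → Z} {a b : ι} {f g : ι → I}
    (h : rContract I A y a b f g ≠ 0) : ∀ c, c ≠ a → c ≠ b → f c = g c := by
  rcases rContract_ne_zero h with rfl | h
  · exact fun _ _ _ => rfl
  · exact h.1

theorem rContract_ne_zero_right {y : ι → ι → Z} {a b : ι} {f g : ι → I} {K : Set I}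
    (h : rContract I A y a b f g ≠ 0) (hf : f b ∈ K) (hg : g a ∈ K) : f a ∈ K ∧ g b ∈ K := by
  rcases rContract_ne_zero h with rfl | h
  · exact ⟨hg, hf⟩
  · rw [h.2.1, ← h.2.2]
    exact ⟨hf, hg⟩

theorem submatrix_orderedProd {j : J → I} (hj : Function.Injective j) (T : ι → Matrix I I A)
    (y : ι → ι → Z) {l : List ι} (hl : l.Nodup) :
    (orderedProd (fun a => leg a (T a)) (rContract I A y) l).submatrix (j ∘ ·) (j ∘ ·) =
      orderedProd (fun a => leg a ((T a).submatrix j j)) (rContract J A y) l := by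
  have := orderedProd_compress (fun (X : Matrix (ι → I) (ι → I) A) f g => X f g ≠ 0)
    (Set.range j) (fun X : Matrix (ι → I) (ι → I) A => X.submatrix (j ∘ ·) (j ∘ ·))
    (submatrix_comp_one hj) (fun f g h => by by_contra h'; exact h (Matrix.one_apply_ne h'))
    (fun x y f g => exists_of_mul_apply_ne_zero)
    (fun x y h => submatrix_mul_of_forall hj x y fun f g k => h _ k _ (fun c => ⟨f c, rfl⟩)
      fun c => ⟨g c, rfl⟩)
    (fun a => leg a (T a)) (rContract I A y) (fun a f g => eq_of_leg_ne_zero)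
    (fun a b _ f g => rContract_ne_zero_left) (fun a b _ f g => rContract_ne_zero_right) hl
  simpa only [submatrix_leg hj, submatrix_rContract hj] using this

/-- The product in the reverse order. -/
def reverseProd {ι E : Type*} [Monoid E] (s : ι → E) (r : ι → ι → E) (l : List ι) : E :=
  MulOpposite.unop (orderedProd (fun a => MulOpposite.op (s a)) (fun a b => MulOpposite.op (r a b)) l)

theorem submatrix_reverseProd {j : J → I} (hj : Function.Injective j) (T : ι → Matrix I I A)
    (y : ι → ι → Z) {l : List ι} (hl : l.Nodup) :
    (reverseProd (fun a => leg a (T a)) (rContract I A y) l).submatrix (j ∘ ·) (j ∘ ·) =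
      reverseProd (fun a => leg a ((T a).submatrix j j)) (rContract J A y) l := by
  have := orderedProd_compress
    (fun (X : (Matrix (ι → I) (ι → I) A)ᵐᵒᵖ) f g => X.unop g f ≠ 0)
    (Set.range j) (fun X : (Matrix (ι → I) (ι → I) A)ᵐᵒᵖ =>
      MulOpposite.op (X.unop.submatrix (j ∘ ·) (j ∘ ·)))
    (congrArg MulOpposite.op (submatrix_comp_one hj))
    (fun f g h => by by_contra h'; exact h (Matrix.one_apply_ne (Ne.symm h')))
    (fun x y f g h => (exists_of_mul_apply_ne_zero h).imp fun k h => h.symm)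
    (fun x y h => congrArg MulOpposite.op (submatrix_mul_of_forall hj y.unop x.unop
      fun f g k h1 h2 => h _ k _ (fun c => ⟨g c, rfl⟩) (fun c => ⟨f c, rfl⟩) h2 h1))
    (fun a => MulOpposite.op (leg a (T a))) (fun a b => MulOpposite.op (rContract I A y a b))
    (fun a f g h c hc => (eq_of_leg_ne_zero h c hc).symm)
    (fun a b _ f g h c h1 h2 => (rContract_ne_zero_left h c h1 h2).symm)
    (fun a b _ f g h hf hg => (rContract_ne_zero_right (K := Set.range j)
      (by rwa [rContract, contract_comm] : rContract I A (fun _ _ => y a b) b a g f ≠ 0) hg hf).symm)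
    hl
  simp only [MulOpposite.unop_op, submatrix_leg hj, submatrix_rContract hj] at this
  exact congrArg MulOpposite.unop this

theorem orderedProd_mul_reverseProd {ι E : Type*} [Monoid E] {s s' : ι → E} {r r' : ι → ι → E}
    {l : List ι} (hl : l.Nodup) (hs : ∀ a, s a * s' a = 1)
    (hr : ∀ a b, a ≠ b → r a b * r' a b = 1) : orderedProd s r l * reverseProd s' r' l = 1 := by
  have hp : ∀ a (l : List ι), a ∉ l → (l.map (r a)).prod *
      MulOpposite.unop (l.map fun b => MulOpposite.op (r' a b)).prod = 1 := by
    intro a l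
    induction l with
    | nil => simp
    | cons b l ih =>
      intro h
      simp only [List.mem_cons, not_or] at h
      rw [List.map_cons, List.prod_cons, List.map_cons, List.prod_cons, MulOpposite.unop_mul,
        MulOpposite.unop_op]
      calc _ = r a b * ((l.map (r a)).prod *
            MulOpposite.unop (l.map fun b => MulOpposite.op (r' a b)).prod) * r' a b := by
            simp only [mul_assoc]
        _ = 1 := by rw [ih h.2, mul_one, hr a b h.1]
  induction l with
  | nil => simp [orderedProd, reverseProd]
  | cons a l ih =>
    rw [List.nodup_cons] at hl
    have h1 := ih hl.2
    rw [reverseProd] at h1 ⊢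
    rw [orderedProd, orderedProd, MulOpposite.unop_mul, MulOpposite.unop_mul, MulOpposite.unop_op]
    calc _ = s a * ((l.map (r a)).prod * (orderedProd s r l * MulOpposite.unop (orderedProd
            (fun a => MulOpposite.op (s' a)) (fun a b => MulOpposite.op (r' a b)) l)) *
            MulOpposite.unop (l.map fun b => MulOpposite.op (r' a b)).prod) * s' a := by
          simp only [mul_assoc]
      _ = 1 := by rw [h1, mul_one, hp a l hl.1, mul_one, hs]

theorem reverseProd_mul_orderedProd {ι E : Type*} [Monoid E] {s s' : ι → E} {r r' : ι → ι → E}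
    {l : List ι} (hl : l.Nodup) (hs : ∀ a, s' a * s a = 1)
    (hr : ∀ a b, a ≠ b → r' a b * r a b = 1) : reverseProd s' r' l * orderedProd s r l = 1 := by
  have hp : ∀ a (l : List ι), a ∉ l →
      MulOpposite.unop (l.map fun b => MulOpposite.op (r' a b)).prod * (l.map (r a)).prod = 1 := by
    intro a l
    induction l with
    | nil => simp
    | cons b l ih =>
      intro h
      simp only [List.mem_cons, not_or] at h
      rw [List.map_cons, List.prod_cons, List.map_cons, List.prod_cons, MulOpposite.unop_mul,
        MulOpposite.unop_op]
      calc _ = MulOpposite.unop (l.map fun b => MulOpposite.op (r' a b)).prod * (r' a b * r a b) *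
            (l.map (r a)).prod := by simp only [mul_assoc]
        _ = 1 := by rw [hr a b h.1, mul_one, ih h.2]
  induction l with
  | nil => simp [orderedProd, reverseProd]
  | cons a l ih =>
    rw [List.nodup_cons] at hl
    have h1 := ih hl.2
    rw [reverseProd] at h1 ⊢
    rw [orderedProd, orderedProd, MulOpposite.unop_mul, MulOpposite.unop_mul, MulOpposite.unop_op]
    calc _ = MulOpposite.unop (orderedProd (fun a => MulOpposite.op (s' a))
            (fun a b => MulOpposite.op (r' a b)) l) *
            (MulOpposite.unop (l.map fun b => MulOpposite.op (r' a b)).prod * (s' a * s a) *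
            (l.map (r a)).prod) * orderedProd s r l := by
          simp only [mul_assoc]
      _ = 1 := by rw [hs, mul_one, hp a l hl.1, mul_one, h1]

end Compress

/-! ### Factorization of minors -/

section Embed

variable {ι κ I A Z : Type*} [Fintype ι] [DecidableEq ι] [Fintype κ] [DecidableEq κ] [Fintype I]
  [DecidableEq I] [Ring A] [CommRing Z] [Algebra Z A]

/-- An operator on the tensor factors `κ`, acting on the tensor factors `ι` through `e : κ → ι`. -/
def embed (e : κ → ι) (X : Matrix (κ → I) (κ → I) A) : Matrix (ι → I) (ι → I) A := fun f g =>
  if ∀ b, (∀ a, e a ≠ b) → f b = g b then X (f ∘ e) (g ∘ e) else 0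

variable {e : κ → ι}

theorem embed_one : embed e (1 : Matrix (κ → I) (κ → I) A) = 1 := by
  ext1 f g
  rw [embed, Matrix.one_apply, Matrix.one_apply]
  by_cases h : f = g
  · subst h; simp
  · rw [if_neg h]
    split_ifs with h1 h2
    · exfalso
      apply h
      ext1 b
      by_cases hb : ∀ a, e a ≠ b
      · exact h1 b hb
      · push Not at hb
        obtain ⟨a, rfl⟩ := hb
        exact congrFun h2 a
    · rfl
    · rfl

theorem embed_mul (he : Function.Injective e) (X Y : Matrix (κ → I) (κ → I) A) :
    embed e (X * Y) = embed e X * embed e Y := by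
  ext1 f g
  rw [embed, Matrix.mul_apply, Matrix.mul_apply]
  split_ifs with h
  · refine Finset.sum_of_injOn (fun k => Function.extend e k f) ?_ ?_ ?_ ?_
    · intro k _ k' _ hk
      ext1 a
      have := congrFun hk (e a)
      simpa only [he.extend_apply] using this
    · simp
    · intro k _ hk
      rw [embed, if_neg, zero_mul]
      intro h'
      refine hk ⟨k ∘ e, by simp, ?_⟩
      ext1 b
      by_cases hb : ∃ a, e a = b
      · obtain ⟨a, rfl⟩ := hb
        exact he.extend_apply _ _ _
      · show Function.extend e (k ∘ e) f b = k b
        rw [Function.extend_apply' _ _ _ hb]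
        exact h' b fun a ha => hb ⟨a, ha⟩
    · intro k _
      have h1 : Function.extend e k f ∘ e = k := funext fun a => he.extend_apply _ _ _
      have h2 : ∀ b, (∀ a, e a ≠ b) → Function.extend e k f b = f b := fun b hb =>
        Function.extend_apply' _ _ _ fun ⟨a, ha⟩ => hb a ha
      rw [embed, embed, if_pos fun b hb => (h2 b hb).symm,
        if_pos fun b hb => (h2 b hb).trans (h b hb), h1]
  · symm
    refine Finset.sum_eq_zero fun k _ => ?_
    rw [embed, embed]
    split_ifs with h1 h2
    · exact absurd (fun b hb => (h1 b hb).trans (h2 b hb)) h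
    · exact mul_zero _
    · exact zero_mul _
    · exact zero_mul _

/-- `embed` as a homomorphism of monoids. -/
def embedHom (I A : Type*) [Fintype I] [DecidableEq I] [Ring A] {e : κ → ι}
    (he : Function.Injective e) : Matrix (κ → I) (κ → I) A →* Matrix (ι → I) (ι → I) A where
  toFun := embed e
  map_one' := embed_one
  map_mul' := embed_mul he

theorem embed_leg (he : Function.Injective e) (a : κ) (X : Matrix I I A) :
    embed e (leg a X) = leg (e a) X := by
  ext1 f g
  simp only [embed, leg, Function.comp_apply]
  rw [← ite_and]
  congr 1
  refine propext ⟨fun h b hb => ?_, fun h => ⟨fun b hb => h b (hb a).symm, fun b hb =>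
    h (e b) (he.ne hb)⟩⟩
  by_cases hb' : ∃ c, e c = b
  · obtain ⟨c, rfl⟩ := hb'
    exact h.2 c fun hc => hb (congrArg e hc)
  · exact h.1 b fun c hc => hb' ⟨c, hc⟩

theorem embed_contract (he : Function.Injective e) (a b : κ) :
    embed e (contract I A a b) = contract I A (e a) (e b) := by
  ext1 f g
  simp only [embed, contract, Function.comp_apply]
  rw [← ite_and]
  congr 1
  refine propext ⟨fun h => ⟨fun c hca hcb => ?_, h.2.2⟩, fun h => ⟨fun c hc => h.1 c (hc a).symm
    (hc b).symm, fun c hca hcb => h.1 (e c) (he.ne hca) (he.ne hcb), h.2⟩⟩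
  by_cases hc : ∃ d, e d = c
  · obtain ⟨d, rfl⟩ := hc
    exact h.2.1 d (fun hd => hca (congrArg e hd)) fun hd => hcb (congrArg e hd)
  · exact h.1 c fun d hd => hc ⟨d, hd⟩

theorem embed_add (X Y : Matrix (κ → I) (κ → I) A) :
    embed e (X + Y) = embed e X + embed e Y := by
  ext1 f g
  rw [Matrix.add_apply, embed, embed, embed]
  split_ifs <;> simp

theorem embed_smul (z : Z) (X : Matrix (κ → I) (κ → I) A) :
    embed e (z • X) = z • embed e X := by
  ext1 f g
  rw [Matrix.smul_apply, embed, embed]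
  split_ifs <;> simp

theorem embed_rContract (he : Function.Injective e) (y : ι → ι → Z) (a b : κ) :
    embed e (rContract I A (fun a b => y (e a) (e b)) a b) = rContract I A y (e a) (e b) := by
  rw [rContract, rContract, embed_add, embed_one, embed_smul, embed_contract he]

theorem spectralProd_map {R : Type*} [Ring R] [Algebra ℂ R] (he : Function.Injective e)
    (T : Matrix I I R⟦X⟧) (p : ι → ℂ) (l : List κ) :
    spectralProd T p (l.map e) = embed e (spectralProd T (fun a => p (e a)) l) := by
  rw [spectralProd, orderedProd_map, spectralProd]
  refine Eq.trans ?_ (map_orderedProd (embedHom I R⟦X⟧ he) _ _ l).symm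
  congr 1
  · ext1 a
    exact (embed_leg he a _).symm
  · ext1 a
    ext1 b
    exact (embed_rContract he (fun a b => pole (p a + p b)) a b).symm

end Embed

section Factorization

theorem rContract_mul_rContract {ι I A Z : Type*} [Fintype ι] [DecidableEq ι] [Fintype I]
    [DecidableEq I] [Ring A] [CommRing Z] [Algebra Z A] {y y' : ι → ι → Z} {a b : ι} (hab : a ≠ b)
    (h : y a b + y' a b + Fintype.card I * (y a b * y' a b) = 0) :
    rContract I A y a b * rContract I A y' a b = 1 := by
  have e : rContract I A y a b * rContract I A y' a b =
      1 + (y a b + y' a b + Fintype.card I * (y a b * y' a b)) • contract I A a b := by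
    simp only [rContract, mul_add, add_mul, mul_one, one_mul, Matrix.smul_mul, Matrix.mul_smul,
      contract_mul_self hab, ← Nat.cast_smul_eq_nsmul Z, smul_smul, add_smul]
    rw [show y' a b * (y a b * (Fintype.card I : Z)) = Fintype.card I * (y a b * y' a b) by ring]
    abel
  rw [e, h, zero_smul, add_zero]

theorem pole_sub_pole_mul (d : ℂ) (m : ℕ) :
    -pole d + pole (d + m) + (m : ℂ⟦X⟧) * (-pole d * pole (d + m)) = 0 := by
  have h1 := two_sub_mul_pole d
  have h2 := two_sub_mul_pole (d + m)
  refine (mul_eq_zero.1 (?_ : (2 - C d * X) * (2 - C (d + m) * X) *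
    (-pole d + pole (d + m) + (m : ℂ⟦X⟧) * (-pole d * pole (d + m))) = 0)).resolve_left
    (mul_ne_zero (two_sub_C_mul_X_ne_zero _) (two_sub_C_mul_X_ne_zero _))
  rw [map_add, map_natCast] at *
  linear_combination (-(2 - (C d + (m : ℂ⟦X⟧)) * X)) * h1 + (2 - C d * X) * h2 -
    (m : ℂ⟦X⟧) * ((2 - (C d + (m : ℂ⟦X⟧)) * X) * pole (d + m)) * h1 - (m : ℂ⟦X⟧) * X * h2

theorem sum_perm_fin_add {B : Type*} [AddCommMonoid B] {m k : ℕ}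
    (Φ : Equiv.Perm (Fin (m + k)) → B)
    (h : ∀ σ, Φ σ ≠ 0 → ∀ j, ∃ j', σ (Fin.natAdd m j) = Fin.natAdd m j') :
    ∑ σ, Φ σ = ∑ σ : Equiv.Perm (Fin m), ∑ τ : Equiv.Perm (Fin k),
      Φ (finSumFinEquiv.permCongr (Equiv.Perm.sumCongr σ τ)) := by
  rw [← Fintype.sum_prod_type']
  symm
  refine Finset.sum_of_injOn (fun x => finSumFinEquiv.permCongr (Equiv.Perm.sumCongr x.1 x.2))
    ?_ (by simp) ?_ (fun _ _ => rfl)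
  · rintro ⟨σ, τ⟩ - ⟨σ', τ'⟩ - hh
    have := Equiv.Perm.sumCongrHom_injective (a₁ := (σ, τ)) (a₂ := (σ', τ'))
      (finSumFinEquiv.permCongr.injective hh)
    exact this
  · intro ρ _ hρ
    by_contra h0
    have h1 := h ρ h0
    set ρ' := finSumFinEquiv.symm.permCongr ρ with hρ'
    have h2 : Set.MapsTo ρ' (Set.range Sum.inr) (Set.range Sum.inr) := by
      rintro _ ⟨j, rfl⟩
      obtain ⟨j', hj'⟩ := h1 j
      exact ⟨j', by simp [ρ', Equiv.permCongr_apply, hj']⟩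
    obtain ⟨⟨σ, τ⟩, hστ⟩ := Equiv.Perm.mem_sumCongrHom_range_of_perm_mapsTo_inl
      ((Equiv.Perm.perm_mapsTo_inl_iff_mapsTo_inr ρ').2 h2)
    refine hρ ⟨(σ, τ), by simp, ?_⟩
    have h3 : Equiv.Perm.sumCongr σ τ = ρ' := hστ
    show finSumFinEquiv.permCongr (Equiv.Perm.sumCongr σ τ) = ρ
    rw [h3, hρ']
    ext1 x
    simp [Equiv.permCongr_apply]

variable {I B Q A : Type*} [Fintype I] [DecidableEq I] [Fintype B] [DecidableEq B] [Fintype Q]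
  [DecidableEq Q] [Ring A]

theorem alternator_mul_embed_apply {β : B → I} {α : Q → I} (hα : Function.Injective α)
    (hdisj : ∀ b a, β b ≠ α a) {m k : ℕ}
    (b : Fin m → B) (Y : Matrix (Fin m → I) (Fin m → I) A) (f h : Fin k → Q) :
    (alternator (Fin (m + k)) I A * embed (Fin.castAdd k) Y) (Fin.append (β ∘ b) (α ∘ f))
      (Fin.append (β ∘ b) (α ∘ h)) =
    (alternator (Fin m) I A * Y) (β ∘ b) (β ∘ b) * alternator (Fin k) Q A f h := by
  rw [alternator_mul_apply, alternator_mul_apply, alternator, Finset.sum_mul_sum,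
    sum_perm_fin_add]
  · refine Finset.sum_congr rfl fun σ _ => Finset.sum_congr rfl fun τ _ => ?_
    have e1 : ∀ i, finSumFinEquiv.permCongr (Equiv.Perm.sumCongr σ τ) (Fin.castAdd k i) =
        Fin.castAdd k (σ i) := fun i => by simp [Equiv.permCongr_apply]
    have e2 : ∀ j, finSumFinEquiv.permCongr (Equiv.Perm.sumCongr σ τ) (Fin.natAdd m j) =
        Fin.natAdd m (τ j) := fun j => by simp [Equiv.permCongr_apply]
    have e3 : (Fin.append (β ∘ b) (α ∘ f) ∘ finSumFinEquiv.permCongr (Equiv.Perm.sumCongr σ τ)) ∘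
        Fin.castAdd k = (β ∘ b) ∘ σ := by
      ext1 i
      simp only [Function.comp_apply, e1, Fin.append_left]
    have e4 : Fin.append (β ∘ b) (α ∘ h) ∘ Fin.castAdd k = β ∘ b := by
      ext1 i
      simp only [Function.comp_apply, Fin.append_left]
    rw [embed, e3, e4, Equiv.Perm.sign_permCongr, Equiv.Perm.sign_sumCongr]
    have e5 : (∀ i, (∀ j, Fin.castAdd k j ≠ i) → (Fin.append (β ∘ b) (α ∘ f) ∘
        finSumFinEquiv.permCongr (Equiv.Perm.sumCongr σ τ)) i = Fin.append (β ∘ b) (α ∘ h) i) ↔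
        f = h ∘ τ.symm := by
      constructor
      · intro hh
        ext1 j
        have := hh (Fin.natAdd m (τ.symm j)) (fun i hi => by
          have := congrArg Fin.val hi
          simp at this
          omega)
        rw [Function.comp_apply, e2, Fin.append_right, Fin.append_right] at this
        simpa using hα this
      · rintro rfl i
        refine Fin.addCases (fun i hi => absurd rfl (hi i)) (fun j _ => ?_) i
        rw [Function.comp_apply, e2, Fin.append_right, Fin.append_right]
        simp
    simp only [e5]
    split_ifs
    · rw [Units.val_mul, mul_smul, smul_mul_assoc, ← zsmul_eq_mul', smul_comm]
    · simp
  · intro σ hσ j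
    have h1 : embed (Fin.castAdd k) Y (Fin.append (β ∘ b) (α ∘ f) ∘ σ)
        (Fin.append (β ∘ b) (α ∘ h)) ≠ 0 := fun h0 => hσ (by rw [h0, smul_zero])
    have h2 : ∀ i, (∀ j, Fin.castAdd k j ≠ i) → (Fin.append (β ∘ b) (α ∘ f) ∘ σ) i =
        Fin.append (β ∘ b) (α ∘ h) i := by
      by_contra h0
      exact h1 (if_neg h0)
    have h3 := h2 (Fin.natAdd m j) (fun i hi => by
      have := congrArg Fin.val hi
      simp at this
      omega)
    rw [Fin.append_right, Function.comp_apply] at h3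
    revert h3
    refine Fin.addCases (fun i => ?_) (fun j' _ => ⟨j', rfl⟩) (σ (Fin.natAdd m j))
    rw [Fin.append_left]
    intro h3
    exact absurd h3 (hdisj _ _)

end Factorization

section Factorization

variable {ι I B Q R : Type*} [Fintype ι] [DecidableEq ι] [Fintype I] [DecidableEq I] [Fintype B]
  [DecidableEq B] [Fintype Q] [DecidableEq Q] [Ring R] [Algebra ℂ R]

theorem finRange_add (m k : ℕ) : List.finRange (m + k) =
    (List.finRange m).map (Fin.castAdd k) ++ (List.finRange k).map (Fin.natAdd m) := by
  rw [← List.ofFn_id, List.ofFn_add, ← List.ofFn_eq_map, ← List.ofFn_eq_map]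
  rfl

theorem map_shift_spectralProd (c : ℂ) (T : Matrix I I R⟦X⟧) (p : ι → ℂ) (l : List ι) :
    (spectralProd T p l).map (shift c) = spectralProd T (fun a => p a - c) l := by
  have := map_orderedProd
    (RingHom.mapMatrix (m := ι → I) (shiftHom c : R⟦X⟧ →+* R⟦X⟧)).toMonoidHom
    (fun a => leg a (T.map (shift (-(p a))))) (rSpectral I R p) l
  refine this.trans ?_
  rw [spectralProd]
  congr 1
  · ext1 a
    refine Matrix.ext fun f g => ?_
    show shift c (leg _ _ _ _) = _
    rw [leg, leg]
    split_ifs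
    · show shift c (shift _ _) = shift _ _
      rw [shift_shift]
      congr 1
      ring
    · exact map_zero (shiftHom c)
  · ext1 a
    ext1 b
    refine Matrix.ext fun f g => ?_
    show shift c ((1 : Matrix (ι → I) (ι → I) R⟦X⟧) f g +
      pole (p a + p b) • contract I R⟦X⟧ a b f g) = (1 : Matrix (ι → I) (ι → I) R⟦X⟧) f g +
      pole (p a - c + (p b - c)) • contract I R⟦X⟧ a b f g
    have h0 : shift c (0 : R⟦X⟧) = 0 := map_zero (shiftHom c)
    have h1 : shift c (1 : R⟦X⟧) = 1 := map_one (shiftHom c)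
    have h2 : p a + p b - 2 * c = p a - c + (p b - c) := by ring
    rw [shift_add, shift_smul, shift_pole, h2, Matrix.one_apply, contract, apply_ite (shift c),
      apply_ite (shift c), h0, h1]

theorem mul_apply_of_col {n A : Type*} [Fintype n] [DecidableEq n] [Ring A]
    {X Y : Matrix n n A} {g : n} (h : ∀ f, Y f g = (1 : Matrix n n A) f g) (f : n) :
    (X * Y) f g = X f g := by
  rw [Matrix.mul_apply]
  simp_rw [h]
  rw [← Matrix.mul_apply, mul_one]

theorem SeriesReflection.alternator_mul_spectralProd_append {S S' : Matrix I I R⟦X⟧}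
    (hS : SeriesReflection 0 S) (h1 : S * S' = 1) {β : B → I} {α : Q → I}
    (hβ : Function.Injective β) (hα : Function.Injective α) (hdisj : ∀ b a, β b ≠ α a)
    (hcov : ∀ i, (∃ b, β b = i) ∨ ∃ a, α a = i) {q : Matrix Q Q R⟦X⟧}
    (hq : S'.submatrix α α * q = 1) {m k : ℕ} {b : Fin m → B} (hb : Function.Bijective b)
    (f g : Fin k → Q) :
    (alternator (Fin (m + k)) I R⟦X⟧ * spectralProd S (fun a : Fin (m + k) => ((a : ℕ) : ℂ))
      (List.finRange (m + k))) (Fin.append (β ∘ b) (α ∘ f)) (Fin.append (β ∘ b) (α ∘ g)) =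
    (alternator (Fin m) B R⟦X⟧ * spectralProd (S.submatrix β β) (fun a : Fin m => ((a : ℕ) : ℂ))
      (List.finRange m)) b b *
    (alternator (Fin k) Q R⟦X⟧ * spectralProd (q.map (TwistedYangian.shift (-((m : ℂ) / 2))))
      (fun a : Fin k => (m : ℂ) / 2 + ((a : ℕ) : ℂ))
      (List.finRange k)) f g := by
  set p : Fin (m + k) → ℂ := fun a => ((a : ℕ) : ℂ) with hp
  set n : ℕ := Fintype.card I with hn
  have hcard : Fintype.card I = Fintype.card B + Fintype.card Q := by
    rw [← Fintype.card_sum]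
    refine (Fintype.card_of_bijective (f := Sum.elim β α) ⟨?_, ?_⟩).symm
    · exact hβ.sumElim hα hdisj
    · intro i
      rcases hcov i with ⟨b, rfl⟩ | ⟨a, rfl⟩
      · exact ⟨Sum.inl b, rfl⟩
      · exact ⟨Sum.inr a, rfl⟩
  have hB : Fintype.card B = m := by
    rw [← Fintype.card_of_bijective hb, Fintype.card_fin]
  have he1 : Function.Injective (Fin.castAdd (n := m) k) := Fin.castAdd_injective m k
  have he2 : Function.Injective (Fin.natAdd (m := k) m) := Fin.natAdd_injective k m
  have hne : ∀ i j, Fin.castAdd (n := m) k i ≠ Fin.natAdd m j := fun i j h => by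
    have := congrArg Fin.val h
    simp at this
    omega
  set G := alternator (Fin (m + k)) I R⟦X⟧ * spectralProd S p (List.finRange (m + k)) with hG
  have hanti : ∀ σ : Equiv.Perm (Fin (m + k)), G * permute I R⟦X⟧ σ =
      (Equiv.Perm.sign σ : ℤ) • G := fun σ => hS.alternator_mul_spectralProd_mul_permute σ
  set Y := spectralProd S (fun a : Fin m => ((a : ℕ) : ℂ)) (List.finRange m) with hY
  set U := spectralProd S (fun a : Fin k => p (Fin.natAdd m a)) (List.finRange k) with hU
  set T : Fin k → Matrix I I R⟦X⟧ := fun a => S'.map (TwistedYangian.shift (-p (Fin.natAdd m a)))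
    with hT
  set y : Fin k → Fin k → ℂ⟦X⟧ := fun a b =>
    -pole (p (Fin.natAdd m a) + p (Fin.natAdd m b) - n) with hy
  set V := reverseProd (fun a => leg a (T a)) (rContract I R⟦X⟧ y) (List.finRange k) with hV
  set cross := (((List.finRange m).map (Fin.castAdd k)).map fun a =>
    (((List.finRange k).map (Fin.natAdd m)).map (rSpectral I R p a)).prod).prod with hcross
  have hUV : U * V = 1 := by
    refine orderedProd_mul_reverseProd (List.nodup_finRange k) (fun a => ?_) fun a b hab => ?_
    · exact (leg_mul _ _ _).trans (by rw [← map_shift_mul, h1, map_shift_one, leg_one])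
    · refine rContract_mul_rContract hab ?_
      have := pole_sub_pole_mul (p (Fin.natAdd m a) + p (Fin.natAdd m b) - n) n
      rw [sub_add_cancel] at this
      simp only [hy]
      linear_combination this
  have hfac : G = alternator (Fin (m + k)) I R⟦X⟧ * embed (Fin.castAdd k) Y * cross *
      embed (Fin.natAdd m) U := by
    rw [hG, finRange_add, spectralProd, orderedProd_append, ← spectralProd, ← spectralProd,
      spectralProd_map he1, spectralProd_map he2]
    · simp only [mul_assoc]
      rfl
    · rw [← finRange_add]
      exact List.nodup_finRange _
    · intro a ha b hb c hc hca
      obtain ⟨a, -, rfl⟩ := List.mem_map.1 ha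
      obtain ⟨b, -, rfl⟩ := List.mem_map.1 hb
      obtain ⟨c, -, rfl⟩ := List.mem_map.1 hc
      exact rContract_commute_leg _ (hne _ _) hca.symm (hne _ _).symm _
    · intro a ha b hb c hc d hd hca hda hcd
      obtain ⟨a, -, rfl⟩ := List.mem_map.1 ha
      obtain ⟨b, -, rfl⟩ := List.mem_map.1 hb
      obtain ⟨c, -, rfl⟩ := List.mem_map.1 hc
      obtain ⟨d, -, rfl⟩ := List.mem_map.1 hd
      exact rContract_commute _ hca.symm hda.symm (hne _ _).symm (hne _ _).symm (hne _ _) hcd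
  have hGV : G * embed (Fin.natAdd m) V = alternator (Fin (m + k)) I R⟦X⟧ *
      embed (Fin.castAdd k) Y * cross := by
    rw [hfac, mul_assoc _ (embed _ U), ← embed_mul he2, hUV, embed_one, mul_one]
  have hcol : ∀ (h : Fin k → Q) x, cross x (Fin.append (β ∘ b) (α ∘ h)) =
      (1 : Matrix (Fin (m + k) → I) (Fin (m + k) → I) R⟦X⟧) x (Fin.append (β ∘ b) (α ∘ h)) := by
    intro h
    refine list_prod_induction (p := fun X : Matrix (Fin (m + k) → I) (Fin (m + k) → I) R⟦X⟧ =>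
      ∀ x, X x (Fin.append (β ∘ b) (α ∘ h)) = (1 : Matrix (Fin (m + k) → I) _ R⟦X⟧) x _)
      (fun _ => rfl) (fun X Z hX hZ x => (mul_apply_of_col hZ x).trans (hX x)) fun X hX => ?_
    obtain ⟨i, hi, rfl⟩ := List.mem_map.1 hX
    obtain ⟨i, -, rfl⟩ := List.mem_map.1 hi
    refine list_prod_induction (p := fun X : Matrix (Fin (m + k) → I) (Fin (m + k) → I) R⟦X⟧ =>
      ∀ x, X x (Fin.append (β ∘ b) (α ∘ h)) = (1 : Matrix (Fin (m + k) → I) _ R⟦X⟧) x _)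
      (fun _ => rfl) (fun X Z hX hZ x => (mul_apply_of_col hZ x).trans (hX x)) fun X hX x => ?_
    obtain ⟨j, hj, rfl⟩ := List.mem_map.1 hX
    obtain ⟨j, -, rfl⟩ := List.mem_map.1 hj
    rw [rSpectral, rContract, Matrix.add_apply, Matrix.smul_apply, contract, if_neg, smul_zero,
      add_zero]
    rintro ⟨-, -, h3⟩
    rw [Fin.append_left, Fin.append_right] at h3
    exact hdisj _ _ h3
  have hrow : ∀ h, (G * embed (Fin.natAdd m) V) (Fin.append (β ∘ b) (α ∘ f))
      (Fin.append (β ∘ b) (α ∘ h)) = (alternator (Fin m) I R⟦X⟧ * Y) (β ∘ b) (β ∘ b) *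
        alternator (Fin k) Q R⟦X⟧ f h := fun h => by
    rw [hGV, mul_apply_of_col (hcol h), alternator_mul_embed_apply hα hdisj]
  have hsum : ∀ h, (G * embed (Fin.natAdd m) V) (Fin.append (β ∘ b) (α ∘ f))
      (Fin.append (β ∘ b) (α ∘ h)) = ∑ g : Fin k → Q, G (Fin.append (β ∘ b) (α ∘ f))
        (Fin.append (β ∘ b) (α ∘ g)) * V.submatrix (α ∘ ·) (α ∘ ·) g h := fun h => by
    rw [Matrix.mul_apply]
    symm
    refine Finset.sum_of_injOn (fun g => Fin.append (β ∘ b) (α ∘ g)) ?_ (by simp) ?_ ?_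
    · intro g _ g' _ hgg
      ext1 j
      have := congrFun hgg (Fin.natAdd m j)
      simp only [Fin.append_right, Function.comp_apply] at this
      exact hα this
    · intro x _ hx
      by_contra h0
      have h2 := right_ne_zero_of_mul h0
      have h3 : ∀ i, (∀ j, Fin.natAdd m j ≠ i) → x i = Fin.append (β ∘ b) (α ∘ h) i := by
        by_contra h4
        exact h2 (if_neg h4)
      have h4 : ∀ i, x (Fin.castAdd k i) = β (b i) := fun i => by
        rw [h3 _ fun j => (hne i j).symm, Fin.append_left]
        rfl
      have h5 : ∀ j, ∃ a, α a = x (Fin.natAdd m j) := fun j => by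
        refine (hcov (x (Fin.natAdd m j))).resolve_left ?_
        rintro ⟨b', hb'⟩
        obtain ⟨i, rfl⟩ := hb.2 b'
        exact left_ne_zero_of_mul h0 (apply_eq_zero_of_antisymm two_torsionFree hanti _ _
          (hne i j) ((h4 i).trans hb'))
      choose g hg using h5
      refine hx ⟨g, by simp, ?_⟩
      ext1 i
      refine Fin.addCases (fun i => ?_) (fun j => ?_) i
      · simp only [Fin.append_left, h4, Function.comp_apply]
      · simp only [Fin.append_right, hg, Function.comp_apply]
    · intro g _
      rw [embed, if_pos, show ∀ z : Fin k → Q, Fin.append (β ∘ b) (α ∘ z) ∘ Fin.natAdd m = α ∘ z from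
        fun z => funext fun j => Fin.append_right _ _ j, show ∀ z : Fin k → Q,
          Fin.append (β ∘ b) (α ∘ z) ∘ Fin.natAdd m = α ∘ z from
        fun z => funext fun j => Fin.append_right _ _ j]
      · rfl
      · intro i
        refine Fin.addCases (fun i _ => ?_) (fun j hj => absurd rfl (hj j)) i
        simp only [Fin.append_left]
  have hVQ : V.submatrix (α ∘ ·) (α ∘ ·) * spectralProd (q.map (TwistedYangian.shift (-((m : ℂ) / 2))))
      (fun a : Fin k => (m : ℂ) / 2 + ((a : ℕ) : ℂ))
      (List.finRange k) = 1 := by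
    rw [hV, submatrix_reverseProd hα _ _ (List.nodup_finRange k)]
    refine reverseProd_mul_orderedProd (List.nodup_finRange k) (fun a => ?_) fun a b hab => ?_
    · have e : (T a).submatrix α α = (S'.submatrix α α).map (TwistedYangian.shift
          (-((m : ℂ) + ((a : ℕ) : ℂ)))) := by
        ext1 i j
        simp [T, p]
      have e' : (q.map (TwistedYangian.shift (-((m : ℂ) / 2)))).map (TwistedYangian.shift
          (-((m : ℂ) / 2 + ((a : ℕ) : ℂ)))) =
          q.map (TwistedYangian.shift (-((m : ℂ) + ((a : ℕ) : ℂ)))) := by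
        ext1 i j
        rw [Matrix.map_apply, Matrix.map_apply, shift_shift, Matrix.map_apply]
        congr 1
        ring
      rw [e, e']
      exact (leg_mul _ _ _).trans (by rw [← map_shift_mul, hq, map_shift_one, leg_one])
    · refine rContract_mul_rContract hab ?_
      have := pole_sub_pole_mul (p (Fin.natAdd m a) + p (Fin.natAdd m b) - n) (Fintype.card Q)
      have e : p (Fin.natAdd m a) + p (Fin.natAdd m b) - n + Fintype.card Q =
          (m : ℂ) / 2 + ((a : ℕ) : ℂ) + ((m : ℂ) / 2 + ((b : ℕ) : ℂ)) := by
        rw [hn, hcard, hB]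
        simp only [p, Fin.val_natAdd]
        push_cast
        ring
      rw [e] at this
      exact this
  have hYB : (alternator (Fin m) I R⟦X⟧ * Y) (β ∘ b) (β ∘ b) = (alternator (Fin m) B R⟦X⟧ *
      spectralProd (S.submatrix β β) (fun a : Fin m => ((a : ℕ) : ℂ)) (List.finRange m)) b b := by
    rw [alternator_mul_apply, alternator_mul_apply]
    have := submatrix_orderedProd hβ (fun a : Fin m => S.map (TwistedYangian.shift (-((a : ℕ) : ℂ))))
      (fun a b => pole (((a : ℕ) : ℂ) + ((b : ℕ) : ℂ))) (List.nodup_finRange m)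
    refine Finset.sum_congr rfl fun σ _ => ?_
    exact congrArg _ (congrFun (congrFun this (b ∘ σ)) b)
  have hrow' : Matrix.of (fun _ g : Fin k → Q => G (Fin.append (β ∘ b) (α ∘ f))
      (Fin.append (β ∘ b) (α ∘ g))) * V.submatrix (α ∘ ·) (α ∘ ·) =
      Matrix.of fun _ h => (alternator (Fin m) I R⟦X⟧ * Y) (β ∘ b) (β ∘ b) *
        alternator (Fin k) Q R⟦X⟧ f h := by
    ext1 f' h
    rw [Matrix.mul_apply, Matrix.of_apply, ← hrow h, hsum h]
    rfl
  have key := congrArg (· * spectralProd (q.map (TwistedYangian.shift (-((m : ℂ) / 2))))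
    (fun a : Fin k => (m : ℂ) / 2 + ((a : ℕ) : ℂ)) (List.finRange k)) hrow'
  simp only [Matrix.mul_assoc] at key
  rw [hVQ, Matrix.mul_one] at key
  refine (congrFun (congrFun key f) g).trans ?_
  rw [← hYB, Matrix.mul_apply (M := alternator (Fin k) Q R⟦X⟧), Finset.mul_sum, Matrix.mul_apply]
  exact Finset.sum_congr rfl fun x _ => mul_assoc _ _ _

end Factorization

/-! ### Minors without sign factors -/

section SpectralMinor

variable {I Q R : Type*} [Fintype I] [DecidableEq I] [Fintype Q] [DecidableEq Q] [Ring R]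
  [Algebra ℂ R]

/-- The Sklyanin minor of a matrix without sign factors. -/
def spectralMinor (S : Matrix I I R⟦X⟧) {n : ℕ} (f g : Fin n → I) : R⟦X⟧ :=
  (alternator (Fin n) I R⟦X⟧ * spectralProd S (fun a : Fin n => ((a : ℕ) : ℂ)) (List.finRange n)) f g

theorem spectralMinor_submatrix {J : Type*} [Fintype J] [DecidableEq J] {j : J → I}
    (hj : Function.Injective j) (S : Matrix I I R⟦X⟧) {n : ℕ} (f g : Fin n → J) :
    spectralMinor (S.submatrix j j) f g = spectralMinor S (j ∘ f) (j ∘ g) := by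
  rw [spectralMinor, spectralMinor, alternator_mul_apply, alternator_mul_apply]
  have := submatrix_orderedProd hj (fun a : Fin n => S.map (shift (-((a : ℕ) : ℂ))))
    (fun a b => pole (((a : ℕ) : ℂ) + ((b : ℕ) : ℂ))) (List.nodup_finRange n)
  exact Finset.sum_congr rfl fun σ _ => congrArg _ (congrFun (congrFun this (f ∘ σ)) g).symm

theorem SeriesReflection.spectralMinor_comp {S : Matrix I I R⟦X⟧} (h : SeriesReflection 0 S) {n : ℕ}
    (f g : Fin n → I) (σ τ : Equiv.Perm (Fin n)) : spectralMinor S (f ∘ σ) (g ∘ τ) =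
      ((Equiv.Perm.sign σ * Equiv.Perm.sign τ : ℤˣ) : ℤ) • spectralMinor S f g := by
  rw [spectralMinor, apply_comp_of_antisymm (fun σ => h.alternator_mul_spectralProd_mul_permute σ),
    alternator_mul_apply_comp_left, smul_smul, mul_comm, Units.val_mul]
  rfl

theorem SeriesReflection.spectralMinor_comp_self {S : Matrix I I R⟦X⟧} (h : SeriesReflection 0 S)
    {n : ℕ} (f : Fin n → I) (σ : Equiv.Perm (Fin n)) :
    spectralMinor S (f ∘ σ) (f ∘ σ) = spectralMinor S f f := by
  rw [h.spectralMinor_comp, Int.units_mul_self, Units.val_one, one_smul]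

theorem SeriesReflection.spectralMinor_eq_of_range {S : Matrix I I R⟦X⟧} (h : SeriesReflection 0 S)
    {n n' : ℕ} {f : Fin n → I} {g : Fin n' → I} (hf : Function.Injective f)
    (hg : Function.Injective g) (hfg : Set.range f = Set.range g) :
    spectralMinor S f f = spectralMinor S g g := by
  obtain rfl : n = n' := by
    have := Fintype.card_congr ((Equiv.ofInjective f hf).trans
      ((Equiv.setCongr hfg).trans (Equiv.ofInjective g hg).symm))
    simpa using this
  set σ : Equiv.Perm (Fin n) := (Equiv.ofInjective f hf).trans
    ((Equiv.setCongr hfg).trans (Equiv.ofInjective g hg).symm) with hσ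
  have : f = g ∘ σ := by
    ext1 i
    simp only [hσ, Function.comp_apply, Equiv.trans_apply, Equiv.apply_ofInjective_symm]
    rfl
  rw [this, h.spectralMinor_comp_self]

/-- Minors containing a block factor. -/
theorem SeriesReflection.spectralMinor_append {S S' : Matrix I I R⟦X⟧} (h : SeriesReflection 0 S)
    (h1 : S * S' = 1) {m k : ℕ} {β : Fin m → I} {α : Q → I}
    (hβ : Function.Injective β) (hα : Function.Injective α) (hdisj : ∀ b a, β b ≠ α a)
    (hcov : ∀ i, (∃ b, β b = i) ∨ ∃ a, α a = i) {q : Matrix Q Q R⟦X⟧}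
    (hq : S'.submatrix α α * q = 1) (f g : Fin k → Q) :
    spectralMinor S (Fin.append β (α ∘ f)) (Fin.append β (α ∘ g)) = spectralMinor S β β *
      TwistedYangian.shift (-((m : ℂ) / 2))
        (spectralMinor (q.map (TwistedYangian.shift (-((m : ℂ) / 2)))) f g) := by
  have := h.alternator_mul_spectralProd_append h1 hβ hα hdisj hcov hq
    (b := id) Function.bijective_id f g
  refine this.trans ?_
  congr 1
  · exact spectralMinor_submatrix hβ S id id
  · rw [spectralMinor, alternator_mul_apply, alternator_mul_apply, ← shiftHom_apply, map_sum]
    refine Finset.sum_congr rfl fun σ _ => ?_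
    rw [map_zsmul, shiftHom_apply]
    have := map_shift_spectralProd (-((m : ℂ) / 2))
      (q.map (TwistedYangian.shift (-((m : ℂ) / 2)))) (fun a : Fin k => ((a : ℕ) : ℂ))
      (List.finRange k)
    have := congrFun (congrFun this (f ∘ σ)) g
    rw [Matrix.map_apply] at this
    rw [this]
    congr 4
    ext1 a
    ring

theorem orderedProd_smul {ι E A : Type*} [Monoid A] [Monoid E] [MulAction A E] [IsScalarTower A E E]
    (d : ι → A) (s : ι → E) (r : ι → ι → E) {l : List ι} (hl : l.Nodup)
    (hs : ∀ a ∈ l, ∀ b ∈ l, ∀ x : E, s a * (d b • x) = d b • (s a * x))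
    (hr : ∀ a ∈ l, ∀ b ∈ l, a ≠ b → ∀ c ∈ l, ∀ x : E, r a b * (d c • x) = d c • (r a b * x)) :
    orderedProd (fun a => d a • s a) r l = (l.map d).prod • orderedProd s r l := by
  induction l with
  | nil => simp [orderedProd]
  | cons a l ih =>
    rw [List.nodup_cons] at hl
    have h1 : ∀ {l' : List E} {d' : List A}, (∀ y ∈ l', ∀ c ∈ d', ∀ x : E, y * (c • x) = c • (y * x)) →
        ∀ x : E, l'.prod * (d'.prod • x) = d'.prod • (l'.prod * x) := by
      have h2 : ∀ {d' : List A} {y : E}, (∀ c ∈ d', ∀ x : E, y * (c • x) = c • (y * x)) →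
          ∀ x : E, y * (d'.prod • x) = d'.prod • (y * x) := by
        intro d' y
        induction d' with
        | nil => simp
        | cons c d' ih =>
          intro h x
          rw [List.prod_cons, mul_smul, mul_smul, h c (by simp), ih fun c hc => h c (by simp [hc])]
      intro l'
      induction l' with
      | nil => simp
      | cons y l' ih =>
        intro d' h x
        rw [List.prod_cons, mul_assoc, mul_assoc, ih fun y hy => h y (by simp [hy]),
          h2 (h y (by simp))]
    rw [orderedProd, orderedProd, ih hl.2 (fun a ha b hb => hs a (by simp [ha]) b (by simp [hb]))
      (fun a ha b hb hab c hc => hr a (by simp [ha]) b (by simp [hb]) hab c (by simp [hc])),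
      List.map_cons, List.prod_cons, mul_smul, smul_mul_assoc, smul_mul_assoc, mul_assoc, h1, mul_assoc,
      ← List.prod_singleton (x := s a), h1]
    · intro y hy c hc x
      rw [List.mem_singleton] at hy
      obtain ⟨b, hb, rfl⟩ := List.mem_map.1 hc
      rw [hy]
      exact hs a (by simp) b (by simp [hb]) x
    · intro y hy c hc x
      obtain ⟨b, hb, rfl⟩ := List.mem_map.1 hy
      obtain ⟨c, hc, rfl⟩ := List.mem_map.1 hc
      exact hr a (by simp) b (by simp [hb]) (fun h => hl.1 (h ▸ hb)) c
        (List.mem_cons_of_mem _ ‹_›) x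

theorem matrix_mul_smul {n A : Type*} [Fintype n] [Ring A] {d : A} {X : Matrix n n A}
    (h : ∀ i j, Commute (X i j) d) (Y : Matrix n n A) : X * (d • Y) = d • (X * Y) := by
  ext1 i j
  simp only [Matrix.mul_apply, Matrix.smul_apply, smul_eq_mul, Finset.mul_sum, ← mul_assoc,
    (h _ _).eq]

theorem spectralMinor_smul {D : R⟦X⟧} {q : Matrix I I R⟦X⟧} (h : ∀ i j, CoeffCommute D (q i j))
    {n : ℕ} (f g : Fin n → I) : spectralMinor (D • q) f g =
      ((List.finRange n).map fun a : Fin n => shift (-((a : ℕ) : ℂ)) D).prod *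
        spectralMinor q f g := by
  have e : ∀ a : Fin n, leg a ((D • q).map (shift (-((a : ℕ) : ℂ)))) =
      shift (-((a : ℕ) : ℂ)) D • leg a (q.map (shift (-((a : ℕ) : ℂ)))) := by
    intro a
    ext1 f g
    rw [Matrix.smul_apply, leg, leg]
    split_ifs
    · exact shift_mul _ _ _
    · exact (smul_zero _).symm
  have key : spectralProd (D • q) (fun a : Fin n => ((a : ℕ) : ℂ)) (List.finRange n) =
      ((List.finRange n).map fun a : Fin n => shift (-((a : ℕ) : ℂ)) D).prod •
        spectralProd q (fun a : Fin n => ((a : ℕ) : ℂ)) (List.finRange n) := by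
    rw [spectralProd, funext e]
    refine orderedProd_smul _ _ _ (List.nodup_finRange n) (fun a _ b _ x => matrix_mul_smul ?_ x)
      fun a _ b _ hab c _ x => matrix_mul_smul ?_ x
    · intro i j
      rw [leg]
      split_ifs
      · exact (((h _ _).shift_right _).shift_left _).commute.symm
      · exact Commute.zero_left _
    · intro i j
      rw [rSpectral, rContract, Matrix.add_apply, Matrix.smul_apply, Matrix.one_apply, contract]
      refine Commute.add_left ?_ ?_
      · split_ifs
        · exact Commute.one_left _
        · exact Commute.zero_left _
      · split_ifs
        · exact (coeffCommute_scal _ _).mul_right (fun _ _ => by simp only [coeff_one]; split_ifs <;> simp) |>.commute.symm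
        · rw [smul_zero]
          exact Commute.zero_left _
  rw [spectralMinor, spectralMinor, key, alternator_mul_apply, alternator_mul_apply, Finset.mul_sum]
  refine Finset.sum_congr rfl fun σ _ => ?_
  rw [Matrix.smul_apply, smul_eq_mul, mul_smul_comm]

theorem CoeffCommute.spectralMinor {D : R⟦X⟧} {q : Matrix I I R⟦X⟧}
    (h : ∀ i j, CoeffCommute D (q i j)) {n : ℕ} (f g : Fin n → I) :
    CoeffCommute D (spectralMinor q f g) := by
  have h0 : CoeffCommute D (0 : R⟦X⟧) := CoeffCommute.zero_right D
  have h1 : CoeffCommute D (1 : R⟦X⟧) := fun p q => by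
    rw [coeff_one]
    split_ifs
    · exact Commute.one_right _
    · exact Commute.zero_right _
  have key : ∀ f g, CoeffCommute D (spectralProd q (fun a : Fin n => ((a : ℕ) : ℂ))
      (List.finRange n) f g) := by
    refine orderedProd_induction (p := fun X : Matrix (Fin n → I) (Fin n → I) R⟦X⟧ =>
      ∀ f g, CoeffCommute D (X f g)) (fun f g => ?_) (fun X Y hX hY f g => ?_)
      (List.nodup_finRange n) (fun a _ f g => ?_) fun a _ b _ _ f g => ?_
    · rw [Matrix.one_apply]
      split_ifs
      · exact h1
      · exact h0
    · rw [Matrix.mul_apply]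
      exact CoeffCommute.sum_right fun k _ => (hX f k).mul_right (hY k g)
    · rw [leg]
      split_ifs
      · exact (h _ _).shift_right _
      · exact h0
    · rw [rSpectral, rContract, Matrix.add_apply, Matrix.smul_apply, Matrix.one_apply, contract]
      refine CoeffCommute.add_right ?_ (CoeffCommute.smul_right ?_ _)
      · split_ifs
        · exact h1
        · exact h0
      · split_ifs
        · exact h1
        · exact h0
  rw [TwistedYangian.spectralMinor, alternator_mul_apply]
  refine CoeffCommute.sum_right fun σ _ => ?_
  rw [← Int.cast_smul_eq_zsmul ℂ, ← smul_const_eq]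
  exact (key _ _).smul_right _

theorem spectralMinor_zero (S : Matrix I I R⟦X⟧) (f g : Fin 0 → I) : spectralMinor S f g = 1 := by
  rw [spectralMinor, alternator_mul_apply]
  simp [spectralProd, orderedProd, Subsingleton.elim (f ∘ _) g]

theorem spectralMinor_one (S : Matrix I I R⟦X⟧) (f g : Fin 1 → I) :
    spectralMinor S f g = S (f 0) (g 0) := by
  rw [spectralMinor, alternator_mul_apply]
  simp [spectralProd, orderedProd, leg, List.finRange_succ, shift_zero]

/-- The minor of a twisted matrix of size two. -/
theorem IsTwisted.spectralMinor_two {ε : ℂ} {S : Matrix (Fin 2) (Fin 2) R⟦X⟧} (h : IsTwisted ε S) :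
    (2 - X : ℂ⟦X⟧) • spectralMinor S id id = (C (2 * ε) - X : ℂ⟦X⟧) • halfDet S := by
  have h1 : ∀ f : Fin 2 → Fin 2, spectralProd S (fun a : Fin 2 => ((a : ℕ) : ℂ)) (List.finRange 2) f id =
      S (f 0) 0 * shift (-1) (S (f 1) 1) + pole 1 • (S (f 0) (f 1) * shift (-1) (S 0 1)) := by
    intro f
    have hl : ∀ k : Fin 2 → Fin 2, leg (1 : Fin 2) (S.map (shift (-1))) k id =
        if k 0 = 0 then shift (-1) (S (k 1) 1) else 0 := fun k => by
      rw [leg]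
      congr 1
      exact propext ⟨fun h => h 0 (by decide), fun h b hb => by
        have : b = 0 := by omega
        rw [this, h]
        rfl⟩
    have hr : ∀ k : Fin 2 → Fin 2, (rSpectral (Fin 2) R (fun a : Fin 2 => ((a : ℕ) : ℂ)) 0 1 *
        leg (1 : Fin 2) (S.map (shift (-1)))) k id = (if k 0 = 0 then shift (-1) (S (k 1) 1) else 0) +
          pole 1 • (if k 0 = k 1 then shift (-1) (S 0 1) else 0) := fun k => by
      have hc : (contract (Fin 2) R⟦X⟧ (0 : Fin 2) 1 * leg (1 : Fin 2) (S.map (shift (-1)))) k id =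
          if k 0 = k 1 then shift (-1) (S 0 1) else 0 := by
        refine (contract_mulVec (by decide) (fun k => leg (1 : Fin 2) (S.map (shift (-1))) k id)
          k).trans ?_
        congr 1
        rw [Fin.sum_univ_two, hl, hl, if_pos (by simp), if_neg (by simp), add_zero]
        simp
      have hp : (((0 : Fin 2) : ℕ) : ℂ) + (((1 : Fin 2) : ℕ) : ℂ) = 1 := by simp
      rw [rSpectral, rContract, add_mul, one_mul, Matrix.add_apply, hl, Matrix.smul_mul,
        Matrix.smul_apply, hc, hp]
    have hs : spectralProd S (fun a : Fin 2 => ((a : ℕ) : ℂ)) (List.finRange 2) =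
        leg (0 : Fin 2) S * (rSpectral (Fin 2) R (fun a : Fin 2 => ((a : ℕ) : ℂ)) 0 1 *
        leg (1 : Fin 2) (S.map (shift (-1)))) := by
      have h0 : S.map (shift 0) = S := by
        ext1 i j
        rw [Matrix.map_apply, shift_zero]
      simp [spectralProd, List.finRange_succ, orderedProd, h0, mul_assoc]
    rw [hs]
    refine (leg_mulVec 0 S (fun k => (rSpectral (Fin 2) R (fun a : Fin 2 => ((a : ℕ) : ℂ)) 0 1 *
        leg (1 : Fin 2) (S.map (shift (-1)))) k id) f).trans ?_
    simp only [hr, Function.update_self, ne_eq, one_ne_zero, not_false_eq_true,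
      Function.update_of_ne, mul_add, Finset.sum_add_distrib, mul_ite, mul_zero, smul_ite, smul_zero,
      Finset.sum_ite_eq', Finset.mem_univ, if_true, mul_smul_comm]
  have h2 : (2 - X : ℂ⟦X⟧) * pole 1 = X := by
    have := two_sub_mul_pole 1
    rwa [map_one, one_mul] at this
  have h3 := h.symm 0 0
  have h4 := h.symm 0 1
  rw [← sub_smul] at h3
  rw [spectralMinor, alternator_mul_apply,
    show (Finset.univ : Finset (Equiv.Perm (Fin 2))) = {1, Equiv.swap 0 1} by decide,
    Finset.sum_pair (by decide), Equiv.Perm.sign_one, Equiv.Perm.sign_swap (by decide), h1, h1]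
  rw [halfDet, smul_sub, ← smul_mul_assoc _ (reflect _), ← smul_mul_assoc _ (reflect _), ← h3, ← h4]
  simp only [Units.val_one, one_smul, Units.val_neg, neg_smul, Function.comp_apply, id_eq,
    Equiv.Perm.one_apply, Equiv.swap_apply_left, Equiv.swap_apply_right, smul_add, smul_neg, smul_smul,
    h2, sub_mul, smul_mul_assoc, sub_smul]
  abel

end SpectralMinor

/-! ### Successive elimination of indices -/

section Elimination

variable {I Q Q' R : Type*} [Fintype I] [DecidableEq I] [Fintype Q] [DecidableEq Q] [Fintype Q']
  [DecidableEq Q'] [Ring R] [Algebra ℂ R] {ε : ℂ}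

theorem IsTwisted.mul {E : R⟦X⟧} {S : Matrix I I R⟦X⟧} (h : IsTwisted ε S)
    (hE : CoeffCommute E E) (hS : ∀ i j, CoeffCommute E (S i j)) (hr : reflect E = E) :
    IsTwisted ε (E • S) :=
  ⟨h.refl.mul hE hS, fun i j => by
    rw [Matrix.smul_apply, Matrix.smul_apply, smul_eq_mul, smul_eq_mul, ← mul_smul_comm,
      ← mul_smul_comm, ← mul_sub, h.symm, reflect_mul, hr, mul_smul_comm]⟩

theorem smul_mul_smul_of_commute {A : Type*} [Ring A] {D E : A} {U V : Matrix I I A}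
    (h : ∀ i j, Commute (U i j) E) : (D • U) * (E • V) = (D * E) • (U * V) := by
  rw [Matrix.smul_mul, matrix_mul_smul h, smul_smul]

theorem smul_map_shift_mul {D E : R⟦X⟧} {U V : Matrix I I R⟦X⟧} (c : ℂ)
    (h : ∀ i j, CoeffCommute E (U i j)) (hDE : D * E = 1) (hUV : U * V = 1) :
    (D • U.map (shift c)) * (E • V.map (shift c)) = 1 := by
  rw [smul_mul_smul_of_commute fun i j => by exact ((h i j).shift_right c).commute.symm,
    ← map_shift_mul, hUV, map_shift_one, hDE, one_smul]

theorem reflect_shift_neg_one {D : R⟦X⟧} (h : reflect D = shift (-1) D) :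
    reflect (shift (-1) D) = D := by
  rw [← h, reflect_reflect]

/-- The result `D(u) q(u - M / 2)` of the elimination of `M` indices, where `q` is the matrix of
quasideterminants with rows and columns in the image of `α`, and `X` is the inverse of the given
twisted matrix. -/
structure Elimination (ε : ℂ) (X : Matrix I I R⟦X⟧) (M : ℕ) (α : Q → I) (D : R⟦X⟧)
    (q : Matrix Q Q R⟦X⟧) : Prop where
  mul_left : q * X.submatrix α α = 1
  mul_right : X.submatrix α α * q = 1
  twisted : IsTwisted ε (D • q.map (shift (-((M : ℂ) / 2))))
  commute : ∀ a b, CoeffCommute D (q a b)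
  self_commute : CoeffCommute D D
  exists_inverse : ∃ D', D * D' = 1 ∧ D' * D = 1
  reflect_eq : reflect D = shift (-1) D

theorem Elimination.zero {S X : Matrix I I R⟦X⟧} (h : IsTwisted ε S) (h1 : S * X = 1)
    (h2 : X * S = 1) (α : Q ≃ I) : Elimination ε X 0 α 1 (S.submatrix α α) where
  mul_left := by rw [Matrix.submatrix_mul_equiv, h1, Matrix.submatrix_one_equiv]
  mul_right := by rw [Matrix.submatrix_mul_equiv, h2, Matrix.submatrix_one_equiv]
  twisted := by
    have : (S.submatrix α α).map (shift (-(((0 : ℕ) : ℂ) / 2))) = S.submatrix α α := by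
      ext1 i j
      simp [shift_zero]
    rw [this, one_smul]
    exact h.submatrix α
  commute a b := fun p q => by
    rw [coeff_one]
    split_ifs
    · exact Commute.one_left _
    · exact Commute.zero_left _
  self_commute := fun p q => by
    rw [coeff_one]
    split_ifs
    · exact Commute.one_left _
    · exact Commute.zero_left _
  exists_inverse := ⟨1, mul_one 1, mul_one 1⟩
  reflect_eq := by rw [reflect_one, shift_one]

theorem Elimination.one {S X : Matrix I I R⟦X⟧} (h : IsTwisted 1 S) (h1 : S * X = 1)
    (h2 : X * S = 1) (γ : Fin 1 ⊕ Q ≃ I) {q : Matrix Q Q R⟦X⟧}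
    (hq : q * X.submatrix (γ ∘ Sum.inr) (γ ∘ Sum.inr) = 1)
    (hq' : X.submatrix (γ ∘ Sum.inr) (γ ∘ Sum.inr) * q = 1) :
    Elimination 1 X 1 (γ ∘ Sum.inr) (shift (1 / 2) (S (γ (Sum.inl 0)) (γ (Sum.inl 0)))) q := by
  set T := S.submatrix γ γ with hT
  set Z := X.submatrix γ γ with hZ
  have t1 : T * Z = 1 := by rw [Matrix.submatrix_mul_equiv, h1, Matrix.submatrix_one_equiv]
  have t2 : Z * T = 1 := by rw [Matrix.submatrix_mul_equiv, h2, Matrix.submatrix_one_equiv]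
  have hTt : IsTwisted 1 T := h.submatrix γ
  set w : Fin 1 ⊕ Q ≃ Q ⊕ Fin 1 := Equiv.sumComm _ _
  set Y : Matrix (Fin 1) (Fin 1) R⟦X⟧ :=
    Z.toBlocks₁₁ - Z.toBlocks₁₂ * q * Z.toBlocks₂₁ with hYdef
  have hY' : Y * T.toBlocks₁₁ = 1 := schur_mul (S := Z.submatrix w.symm w.symm)
    (X := T.submatrix w.symm w.symm)
    (by rw [Matrix.submatrix_mul_equiv, t2, Matrix.submatrix_one_equiv]) hq
  have hY : T.toBlocks₁₁ * Y = 1 := mul_schur (S := Z.submatrix w.symm w.symm)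
    (X := T.submatrix w.symm w.symm)
    (by rw [Matrix.submatrix_mul_equiv, t1, Matrix.submatrix_one_equiv]) hq'
  have y1 : T.toBlocks₁₁ 0 0 * Y 0 0 = 1 := by simpa [Matrix.mul_apply] using congrFun (congrFun hY 0) 0
  have y2 : Y 0 0 * T.toBlocks₁₁ 0 0 = 1 := by simpa [Matrix.mul_apply] using congrFun (congrFun hY' 0) 0
  have hss : CoeffCommute (T.toBlocks₁₁ 0 0) (T.toBlocks₁₁ 0 0) :=
    (hTt.refl.submatrix Sum.inl).self_commute_of_one
  have hev : reflect (T.toBlocks₁₁ 0 0) = T.toBlocks₁₁ 0 0 := (hTt.submatrix Sum.inl).even_of_one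
  refine ⟨hq, hq', ?_, fun a b => ?_, ?_, ⟨shift (1 / 2) (Y 0 0), ?_, ?_⟩, ?_⟩
  · have := hTt.elim_one t1 t2 hY hY' (q := q) hq hq'
    rw [Nat.cast_one]
    exact this
  · refine CoeffCommute.shift_left ?_ _
    exact CoeffCommute.matrix_inverse (fun c d => hTt.refl.commute_inverse t1 t2
      Sum.inl_ne_inr Sum.inl_ne_inr Sum.inl_ne_inr Sum.inl_ne_inr) hq' hq a b
  · exact (hss.shift_right _).shift_left _
  · rw [← shift_mul]
    exact (congrArg _ y1).trans (shift_one _)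
  · rw [← shift_mul]
    exact (congrArg _ y2).trans (shift_one _)
  · rw [reflect_shift, shift_shift]
    have : S (γ (Sum.inl 0)) (γ (Sum.inl 0)) = T.toBlocks₁₁ 0 0 := rfl
    rw [this, hev]
    congr 1
    norm_num

theorem Elimination.step {X : Matrix I I R⟦X⟧} {M : ℕ} {α : Q → I} {D : R⟦X⟧}
    {q : Matrix Q Q R⟦X⟧} (h : Elimination ε X M α D q) (γ : Fin 2 ⊕ Q' ≃ Q)
    {q' : Matrix Q' Q' R⟦X⟧} (hq : q' * X.submatrix (α ∘ γ ∘ Sum.inr) (α ∘ γ ∘ Sum.inr) = 1)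
    (hq' : X.submatrix (α ∘ γ ∘ Sum.inr) (α ∘ γ ∘ Sum.inr) * q' = 1) :
    ∃ D', D * D' = -shift 1 (halfDet ((D • q.map (shift (-((M : ℂ) / 2)))).submatrix
      (γ ∘ Sum.inl) (γ ∘ Sum.inl))) ∧ Elimination ε X (M + 2) (α ∘ γ ∘ Sum.inr) D' q' := by
  obtain ⟨Di, hDi, hDi'⟩ := h.exists_inverse
  set c : ℂ := -((M : ℂ) / 2) with hc
  have cD := h.self_commute
  have cDDi : CoeffCommute D Di := cD.inv_right hDi hDi'
  have cDiDi : CoeffCommute Di Di := cDDi.symm.inv_right hDi hDi'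
  have cDX : ∀ a b, CoeffCommute D (X (α a) (α b)) :=
    CoeffCommute.matrix_inverse h.commute h.mul_left h.mul_right
  have cDq' : ∀ a b, CoeffCommute D (q' a b) :=
    CoeffCommute.matrix_inverse (fun a b => cDX _ _) hq' hq
  have cDiq : ∀ a b, CoeffCommute Di (q a b) := fun a b => ((h.commute a b).symm.inv_right hDi hDi').symm
  have cDiq' : ∀ a b, CoeffCommute Di (q' a b) := fun a b => ((cDq' a b).symm.inv_right hDi hDi').symm
  set T := (D • q.map (shift c)).submatrix γ γ with hT
  set Z := (Di • (X.submatrix α α).map (shift c)).submatrix γ γ with hZ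
  have t1 : T * Z = 1 := by
    rw [Matrix.submatrix_mul_equiv, smul_map_shift_mul c cDiq hDi h.mul_left,
      Matrix.submatrix_one_equiv]
  have t2 : Z * T = 1 := by
    rw [Matrix.submatrix_mul_equiv, smul_map_shift_mul (U := X.submatrix α α) c cDX hDi' h.mul_right,
      Matrix.submatrix_one_equiv]
  have hTt : IsTwisted ε T := h.twisted.submatrix γ
  have r1 : (D • q'.map (shift c)) * Z.toBlocks₂₂ = 1 := smul_map_shift_mul c cDiq' hDi hq
  have r2 : Z.toBlocks₂₂ * (D • q'.map (shift c)) = 1 :=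
    smul_map_shift_mul c (fun i j => cDX _ _) hDi' hq'
  set qT := D • q'.map (shift c) with hqT
  set w : Fin 2 ⊕ Q' ≃ Q' ⊕ Fin 2 := Equiv.sumComm _ _
  set Y : Matrix (Fin 2) (Fin 2) R⟦X⟧ :=
    Z.toBlocks₁₁ - Z.toBlocks₁₂ * qT * Z.toBlocks₂₁ with hYdef
  have hY' : Y * T.toBlocks₁₁ = 1 := schur_mul (S := Z.submatrix w.symm w.symm)
    (X := T.submatrix w.symm w.symm)
    (by rw [Matrix.submatrix_mul_equiv, t2, Matrix.submatrix_one_equiv]) r1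
  have hY : T.toBlocks₁₁ * Y = 1 := mul_schur (S := Z.submatrix w.symm w.symm)
    (X := T.submatrix w.symm w.symm)
    (by rw [Matrix.submatrix_mul_equiv, t1, Matrix.submatrix_one_equiv]) r2
  have main := hTt.elim_two t1 t2 hY hY' r1 r2
  have hs : IsTwisted ε T.toBlocks₁₁ := hTt.submatrix Sum.inl
  obtain ⟨b, hab, hba⟩ := hs.exists_halfDet_inverse hY hY'
  have hra := hs.reflect_halfDet hY'
  have caa := hs.halfDet_self_commute
  have cDa : CoeffCommute D (halfDet T.toBlocks₁₁) := halfDet_commute_of fun i j =>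
    cD.mul_right ((h.commute _ _).shift_right _)
  have caqT : ∀ i j, CoeffCommute (halfDet T.toBlocks₁₁) (qT i j) := fun c d =>
    (halfDet_commute_of fun i j => (CoeffCommute.matrix_inverse (fun c d =>
      hTt.refl.commute_inverse t1 t2 Sum.inl_ne_inr Sum.inl_ne_inr Sum.inl_ne_inr Sum.inl_ne_inr)
        r2 r1 c d).symm).symm
  set a := halfDet T.toBlocks₁₁ with ha
  have caDi : CoeffCommute a Di := cDa.symm.inv_right hDi hDi'
  have caq' : ∀ i j, CoeffCommute a (q' i j) := fun i j => by
    have e : q' i j = shift (-c) (Di * qT i j) := by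
      show _ = shift (-c) (Di * (D * shift c (q' i j)))
      rw [← mul_assoc, hDi', one_mul, shift_shift, neg_add_cancel, shift_zero]
    rw [e]
    exact (caDi.mul_right (caqT i j)).shift_right _
  have i1 : shift (-1) D * shift (-1) Di = 1 := by rw [← shift_mul, hDi, shift_one]
  have i2 : shift (-1) Di * shift (-1) D = 1 := by rw [← shift_mul, hDi', shift_one]
  set E := Di * shift (-1) Di with hE
  have cEE : CoeffCommute E E :=
    have : CoeffCommute Di E := cDiDi.mul_right (cDiDi.shift_right _)
    this.symm.mul_right (this.symm.shift_right _)
  have hrDi : reflect Di = shift (-1) Di := by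
    calc reflect Di = reflect Di * (shift (-1) D * shift (-1) Di) := by rw [i1, mul_one]
      _ = reflect (Di * D) * shift (-1) Di := by rw [← h.reflect_eq, ← mul_assoc, reflect_mul]
      _ = _ := by rw [hDi', reflect_one, one_mul]
  have hrE : reflect E = E := by
    rw [hE, reflect_mul, reflect_shift_neg_one hrDi, hrDi, (cDiDi.shift_left (-1)).commute]
  have hT' : (fun i j => -shift 1 a * shift (-1) (qT i j)) =
      ((-shift 1 a * shift (-1) D) • q'.map (shift (-(((M + 2 : ℕ) : ℂ) / 2))) :
        Matrix Q' Q' R⟦X⟧) := by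
    ext1 i
    ext1 j
    show -shift 1 a * shift (-1) (D * shift c (q' i j)) = _ * shift _ (q' i j)
    rw [shift_mul, shift_shift, mul_assoc]
    congr 3
    rw [hc]
    push_cast
    ring
  rw [hT'] at main
  have cX : ∀ {f : R⟦X⟧}, CoeffCommute Di f → CoeffCommute E f := fun hf =>
    (hf.symm.mul_right (hf.symm.shift_right _)).symm
  have hfin : E * (-shift 1 a * shift (-1) D) = Di * -shift 1 a := by
    have := ((caDi.symm.shift_left (-1)).shift_right 1).neg_right.commute
    rw [hE, mul_assoc, ← mul_assoc (shift (-1) Di), this, mul_assoc, i2, mul_one]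
  refine ⟨Di * -shift 1 a, ?_, hq, hq', ?_, ?_, ?_, ⟨-shift 1 b * D, ?_, ?_⟩, ?_⟩
  · rw [← mul_assoc, hDi, one_mul]
    rfl
  · have := main.mul cEE (fun i j => ?_) hrE
    · rwa [smul_smul, hfin] at this
    · exact cX (((caDi.symm.shift_right 1).neg_right.mul_right (cDDi.symm.shift_right _)).mul_right
        ((cDiq' i j).shift_right _))
  · intro i j
    exact ((cDiq' i j).symm.mul_right ((caq' i j).symm.shift_right 1).neg_right).symm
  · have u1 : CoeffCommute Di (Di * -shift 1 a) :=
      cDiDi.mul_right (caDi.symm.shift_right 1).neg_right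
    have u2 : CoeffCommute a (Di * -shift 1 a) := caDi.mul_right (caa.shift_right 1).neg_right
    exact (u1.symm.mul_right (u2.symm.shift_right 1).neg_right).symm.symm
  · have : shift 1 a * shift 1 b = 1 := by rw [← shift_mul, hab, shift_one]
    rw [mul_assoc, ← mul_assoc (-shift 1 a), neg_mul_neg, this, one_mul, hDi']
  · have : shift 1 b * shift 1 a = 1 := by rw [← shift_mul, hba, shift_one]
    rw [mul_assoc, ← mul_assoc D, hDi, one_mul, neg_mul_neg, this]
  · rw [reflect_mul, hrDi, reflect_neg, reflect_shift, hra, shift_shift, shift_mul, shift_neg,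
      shift_shift]

theorem Elimination.spectralMinor_step {S X : Matrix I I R⟦X⟧} (hS : SeriesReflection 0 S)
    (hSX : S * X = 1) {M : ℕ} {β : Fin M → I} {α : Q → I} (hβ : Function.Injective β)
    (hα : Function.Injective α) (hdisj : ∀ b a, β b ≠ α a)
    (hcov : ∀ i, (∃ b, β b = i) ∨ ∃ a, α a = i) {D D' : R⟦X⟧}
    {q : Matrix Q Q R⟦X⟧} (h : Elimination ε X M α D q) {p : Fin 2 → Q} (hp : Function.Injective p)
    (hD' : D * D' = -shift 1 (halfDet ((D • q.map (shift (-((M : ℂ) / 2)))).submatrix p p)))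
    {φ φ' : ℂ⟦X⟧} (hφ : (C (2 * ε) - invLin 1) * φ' = -((2 - invLin 1) * shift 1 φ))
    (hD : D = φ • shift ((M : ℂ) / 2) (spectralMinor S β β)) :
    D' = φ' • shift (((M + 2 : ℕ) : ℂ) / 2)
      (spectralMinor S (Fin.append β (α ∘ p)) (Fin.append β (α ∘ p))) := by
  obtain ⟨Di, hDi, hDi'⟩ := h.exists_inverse
  set W := spectralMinor S β β with hW
  set V := spectralMinor (q.map (shift (-((M : ℂ) / 2)))) p p with hV
  have h1 := hS.spectralMinor_append hSX hβ hα hdisj hcov h.mul_right p p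
  have h2 := (h.twisted.submatrix p).spectralMinor_two
  rw [spectralMinor_submatrix hp, Function.comp_id, spectralMinor_smul (q := q.map (shift (-((M : ℂ) / 2))))
    fun i j => (h.commute i j).shift_right _] at h2
  have h3 : ((List.finRange 2).map fun a : Fin 2 => shift (-((a : ℕ) : ℂ)) D).prod =
      D * shift (-1) D := by
    simp [List.finRange_succ, shift_zero]
  rw [h3, ← hV] at h2
  have h4 := congrArg (shift 1) h2
  have e2 : shift (1 : ℂ) (2 - PowerSeries.X : ℂ⟦X⟧) = 2 - invLin 1 := by
    rw [shift_sub, shift_X]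
    congr 1
    exact map_ofNat (shiftHom 1) 2
  rw [shift_smul, shift_smul, e2, shift_sub, shift_C, shift_X, shift_mul, shift_mul, shift_shift,
    add_neg_cancel, shift_zero] at h4
  have h5 : D * D' = D * (φ' • shift (((M + 2 : ℕ) : ℂ) / 2)
      (spectralMinor S (Fin.append β (α ∘ p)) (Fin.append β (α ∘ p)))) := by
    have hne : (C (2 * ε) - invLin 1 : ℂ⟦X⟧) ≠ 0 := by
      intro h0
      have := congrArg (shift (-1)) h0
      rw [shift_sub, shift_C, shift_invLin, neg_add_cancel, ← shift_X, shift_zero] at this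
      exact C_sub_X_ne_zero _ (this.trans (map_zero (shiftHom (-1))))
    have hcD : D * shift 1 D = shift 1 D * D := (h.self_commute.shift_right 1).commute
    have hsh : shift (((M + 2 : ℕ) : ℂ) / 2) (spectralMinor S (Fin.append β (α ∘ p))
        (Fin.append β (α ∘ p))) = shift (((M + 2 : ℕ) : ℂ) / 2) W * shift 1 V := by
      rw [h1, shift_mul, shift_shift]
      congr 2
      push_cast
      ring
    have hD1 : shift 1 D = shift 1 φ • shift (((M + 2 : ℕ) : ℂ) / 2) W := by
      rw [hD, shift_smul, shift_shift]
      congr 2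
      push_cast
      ring
    rw [← sub_eq_zero]
    apply torsionFree_series _ hne
    rw [smul_sub, hD', hsh, sub_eq_zero, smul_neg, ← h4, ← hcD, hD1]
    simp only [mul_smul_comm, smul_mul_assoc, smul_smul]
    rw [hφ, neg_smul, mul_assoc]
  calc D' = Di * (D * D') := by rw [← mul_assoc, hDi', one_mul]
    _ = _ := by rw [h5, ← mul_assoc, hDi', one_mul]

end Elimination

/-! ### Removal of the sign factors -/

theorem Idx.neg_neg {K : Finset ℕ} (i : Idx K) : -(-i) = i := Subtype.ext (_root_.neg_neg i.1)

/-- `1` in the orthogonal case and `sgn i` in the symplectic case. -/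
def sgn : Kind → ℤ → ℂ
  | .orthogonal, _ => 1
  | .symplectic, i => ((i.sign : ℤ) : ℂ)

theorem theta_eq (t : Kind) (i j : ℤ) : theta t i j = sgn t i * sgn t j := by
  cases t
  · simp [theta, sgn]
  · simp [theta, sgn]

theorem sgn_neg (t : Kind) (i : ℤ) : sgn t (-i) = t.pm * sgn t i := by
  cases t <;> simp [sgn, Kind.pm]

theorem Kind.pm_mul_self (t : Kind) : t.pm * t.pm = 1 := by cases t <;> simp [Kind.pm]

theorem sgn_mul_self {t : Kind} {K : Finset ℕ} (hK : t = Kind.symplectic → 0 ∉ K) (i : Idx K) :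
    sgn t i.1 * sgn t i.1 = 1 := by
  cases t
  · simp [sgn]
  · have h : i.1 ≠ 0 := fun h => hK rfl (by simpa [h] using i.2)
    rw [sgn]
    rcases lt_or_gt_of_ne h with h | h
    · simp [Int.sign_eq_neg_one_of_neg h]
    · simp [Int.sign_eq_one_of_pos h]

section Untwist

variable {R : Type*} [Ring R] [Algebra ℂ R] {t : Kind} {K : Finset ℕ}

/-- The matrix without sign factors corresponding to a matrix of generating series. -/
def untwist (t : Kind) (s : Matrix (Idx K) (Idx K) R⟦X⟧) : Matrix (Idx K) (Idx K) R⟦X⟧ :=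
  fun i j => sgn t j.1 • s i (-j)

theorem untwist_apply (s : Matrix (Idx K) (Idx K) R⟦X⟧) (i j : Idx K) :
    untwist t s i j = sgn t j.1 • s i (-j) := rfl

theorem const₂_mul (z : ℂ) (F : R⟦X⟧⟦X⟧) : const₂ R z * F = z • F := by
  ext p q
  rw [const₂, coeff_C_mul, coeff_C_mul, ← Algebra.smul_def]
  rfl

theorem inU_smul (z : ℂ) (f : R⟦X⟧) : inU (z • f) = z • inU f := by
  rw [← const₂_mul, ← smul_const_eq, inU, inU, ← scal_mul_eq_smul, map_mul, const₂]
  simp [scal]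

theorem inV_smul (z : ℂ) (f : R⟦X⟧) : inV (z • f) = z • inV f := by
  rw [← const₂_mul, ← smul_const_eq, inV, inV, ← scal_mul_eq_smul, map_mul, const₂]
  simp [scal]

theorem algebraMap_xU : algebraMap ℂ⟦X⟧⟦X⟧ R⟦X⟧⟦X⟧ xU = inU X := by
  rw [series_algebraMap, xU, inU, inU, map_C, series_algebraMap, map_X]

theorem algebraMap_yV : algebraMap ℂ⟦X⟧⟦X⟧ R⟦X⟧⟦X⟧ yV = inV X := by
  rw [series_algebraMap, yV, inV_X, map_X]
  simp [inV]

theorem quadLHS_eq (s : Matrix (Idx K) (Idx K) R⟦X⟧) (i j k l : Idx K) :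
    quadLHS s i j k l = (yV ^ 2 - xU ^ 2) •
      (inU (s i j) * inV (s k l) - inV (s k l) * inU (s i j)) := by
  rw [Algebra.smul_def, map_sub, map_pow, map_pow, algebraMap_xU, algebraMap_yV]
  rfl

theorem quadRHS_eq (s : Matrix (Idx K) (Idx K) R⟦X⟧) (i j k l : Idx K) :
    quadRHS t s i j k l =
      (xU * yV * (yV + xU)) • (inU (s k j) * inV (s i l) - inV (s k j) * inU (s i l)) -
      (xU * yV * (yV - xU)) •
        ((sgn t k.1 * sgn t (-j).1) • (inU (s i (-k)) * inV (s (-j) l)) -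
          (sgn t i.1 * sgn t (-l).1) • (inV (s k (-i)) * inU (s (-l) j))) +
      (xU ^ 2 * yV ^ 2) • ((sgn t i.1 * sgn t (-j).1) •
        (inU (s k (-i)) * inV (s (-j) l) - inV (s k (-i)) * inU (s (-j) l))) := by
  simp only [Algebra.smul_def (A := R⟦X⟧⟦X⟧) (R := ℂ⟦X⟧⟦X⟧), map_mul, map_add, map_sub, map_pow,
    algebraMap_xU, algebraMap_yV, ← const₂_mul, ← theta_eq]
  rfl

theorem quad_iff (hK : t = Kind.symplectic → 0 ∉ K) {s : Matrix (Idx K) (Idx K) R⟦X⟧} :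
    (∀ i j k l, quadLHS s i j k l = quadRHS t s i j k l) ↔ SeriesReflection 0 (untwist t s) := by
  have key : ∀ i j k l, (quadLHS s i (-j) k (-l) = quadRHS t s i (-j) k (-l)) ↔
      ((yV - xU) * (yV + xU + C (C (2 * 0)) * (xU * yV))) •
        (inU (untwist t s i j) * inV (untwist t s k l) - inV (untwist t s k l) * inU (untwist t s i j)) =
      ((xU * yV) * (yV + xU + C (C (2 * 0)) * (xU * yV))) •
        (inU (untwist t s k j) * inV (untwist t s i l) - inV (untwist t s k j) * inU (untwist t s i l)) -
      ((yV - xU) * (xU * yV)) •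
        (inU (untwist t s i k) * inV (untwist t s j l) - inV (untwist t s k i) * inU (untwist t s l j)) +
      ((xU * yV) * (xU * yV)) •
        (inU (untwist t s k i) * inV (untwist t s j l) -
          inV (untwist t s k i) * inU (untwist t s j l)) := by
    intro i j k l
    have hj := sgn_mul_self hK j
    have hl := sgn_mul_self hK l
    set a := sgn t j.1 with ha
    set b := sgn t l.1 with hb
    have hab : a * b ≠ 0 := fun h0 => by
      have : a * a * (b * b) = 0 := by rw [mul_mul_mul_comm, h0, zero_mul]
      rw [hj, hl] at this
      simp at this
    have e1 : ∀ (z w : ℂ) (f g : R⟦X⟧), inU (z • f) * inV (w • g) = (z * w) • (inU f * inV g) :=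
      fun z w f g => by rw [inU_smul, inV_smul, smul_mul_smul_comm]
    have e2 : ∀ (z w : ℂ) (f g : R⟦X⟧), inV (z • f) * inU (w • g) = (z * w) • (inV f * inU g) :=
      fun z w f g => by rw [inU_smul, inV_smul, smul_mul_smul_comm]
    simp only [untwist_apply, e1, e2, ← ha, ← hb]
    rw [← (smul_right_injective _ hab).eq_iff, quadLHS_eq, quadRHS_eq, Idx.neg_neg, Idx.neg_neg]
    have e3 : ∀ (P₁ P₂ P₃ : ℂ⟦X⟧⟦X⟧) (z z₁ z₂ z₃ : ℂ) (B₁ B₂ B₃ B₄ : R⟦X⟧⟦X⟧),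
        z • (P₁ • B₁ - P₂ • (z₁ • B₂ - z₂ • B₃) + P₃ • (z₃ • B₄)) =
          P₁ • (z • B₁) - P₂ • ((z * z₁) • B₂ - (z * z₂) • B₃) + P₃ • ((z * z₃) • B₄) := by
      intros
      simp only [smul_add, smul_sub, smul_comm (_ : ℂ) (_ : ℂ⟦X⟧⟦X⟧), smul_smul]
    have s1 : a * b * (sgn t k.1 * a) = sgn t k.1 * b := by linear_combination sgn t k.1 * b * hj
    have s2 : a * b * (sgn t i.1 * b) = sgn t i.1 * a := by linear_combination sgn t i.1 * a * hl
    have s3 : a * b * (sgn t i.1 * a) = sgn t i.1 * b := by linear_combination sgn t i.1 * b * hj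
    have p1 : ((yV - xU) * (yV + xU + C (C (2 * 0)) * (xU * yV)) : ℂ⟦X⟧⟦X⟧) = yV ^ 2 - xU ^ 2 := by
      simp only [mul_zero, map_zero, zero_mul]
      ring
    have p2 : (xU * yV * (yV + xU + C (C (2 * 0)) * (xU * yV)) : ℂ⟦X⟧⟦X⟧) = xU * yV * (yV + xU) := by
      simp only [mul_zero, map_zero, zero_mul, add_zero]
    have p3 : (xU * yV * (xU * yV) : ℂ⟦X⟧⟦X⟧) = xU ^ 2 * yV ^ 2 := by ring
    have p4 : ((yV - xU) * (xU * yV) : ℂ⟦X⟧⟦X⟧) = xU * yV * (yV - xU) := by ring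
    rw [e3, ← ha, ← hb, s1, s2, s3, p1, p2, p3, p4, smul_comm (a * b) (yV ^ 2 - xU ^ 2)]
    simp only [smul_sub, mul_comm b a]
  constructor
  · intro h i j k l
    exact (key i j k l).1 (h i (-j) k (-l))
  · intro h i j k l
    have := (key i (-j) k (-l)).2 (h i (-j) k (-l))
    rwa [Idx.neg_neg, Idx.neg_neg] at this

theorem reflect_const_smul (z : ℂ) (f : R⟦X⟧) : reflect (z • f) = z • reflect f := by
  ext p
  rw [reflect, coeff_mk, coeff_smul, coeff_smul, reflect, coeff_mk, smul_comm]

theorem smul_symm_aux {Z M : Type*} [CommRing Z] [AddCommGroup M] [Module Z M] {a e w h : Z}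
    (ha : a * a = 1) (he : e * e = 1) (hw : w * h = e) (x s : Z) (A B A' : M) :
    (w * (e * a)) • (s * (e * a)) • B - (w * (e * a)) • (A' + (h * -x) • (A' - A)) =
      w • s • B - x • a • A - (w * e - x) • a • A' := by
  match_scalars
  · linear_combination w * s * a * a * he + w * s * ha
  · linear_combination e * a * x * hw + a * x * he
  · linear_combination -(e * a * x * hw) - a * x * he

theorem symm_iff (hK : t = Kind.symplectic → 0 ∉ K) {s : Matrix (Idx K) (Idx K) R⟦X⟧} :
    (∀ i j, symLHS t s i j = symRHS t s i j) ↔ ∀ i j, (2 : ℂ⟦X⟧) • untwist t s j i -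
      (X : ℂ⟦X⟧) • untwist t s i j = (C (2 * t.pm) - X) • reflect (untwist t s i j) := by
  have key : ∀ i j, symLHS t s i (-j) = symRHS t s i (-j) ↔ (2 : ℂ⟦X⟧) • untwist t s j i -
      (X : ℂ⟦X⟧) • untwist t s i j = (C (2 * t.pm) - X) • reflect (untwist t s i j) := by
    intro i j
    have hj := sgn_mul_self hK j
    have hε := t.pm_mul_self
    rw [symLHS, symRHS, Idx.neg_neg, theta_eq, scal_mul_eq_smul, scal_mul_eq_smul, untwist_apply,
      untwist_apply, show (-j).1 = -j.1 from rfl, sgn_neg]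
    set a := sgn t j.1 with ha
    set ε := t.pm with hεd
    set A := s i (-j) with hA
    set B := s j (-i) with hB
    have hne : (C (2 * ε * a) : ℂ⟦X⟧) ≠ 0 := by
      intro h
      have h1 : 2 * ε * a = 0 := by simpa using congrArg constantCoeff h
      have h2 : 2 * ε * a * (ε * a) = 2 := by linear_combination 2 * a * a * hε + 2 * hj
      rw [h1, zero_mul] at h2
      exact two_ne_zero h2.symm
    have hr : ∀ z : ℂ, reflect (C z : ℂ⟦X⟧) = C z := fun z => by
      rw [← reflectHom_apply]
      exact subst₁_C z
    have e1 : ∀ L N : R⟦X⟧, L = N ↔ (C (2 * ε * a) : ℂ⟦X⟧) • reflect L =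
        (C (2 * ε * a) : ℂ⟦X⟧) • reflect N := by
      refine fun L N => ⟨fun h => by rw [h], fun h => ?_⟩
      rw [← sub_eq_zero, ← smul_sub] at h
      have := sub_eq_zero.1 (torsionFree_series _ hne _ h)
      rw [← reflect_reflect L, this, reflect_reflect]
    have hjC : (C a * C a : ℂ⟦X⟧) = 1 := by rw [← map_mul, hj, map_one]
    have hεC : (C ε * C ε : ℂ⟦X⟧) = 1 := by rw [← map_mul, hε, map_one]
    have h2C : (2 * C (ε / 2) : ℂ⟦X⟧) = C ε := by
      rw [← C_two_mul]
      congr 1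
      ring
    rw [e1, reflect_smul, reflect_reflect, reflect_add, reflect_smul, reflect_sub, reflect_reflect,
      reflect_mul, reflect_X, hr, hr, reflect_const_smul]
    simp only [← smul_const_eq]
    rw [← sub_eq_zero, ← sub_eq_zero (b := (C (2 * ε) - X) • _)]
    refine Eq.congr ?_ rfl
    simp only [map_mul, map_ofNat]
    rw [mul_assoc]
    exact smul_symm_aux hjC hεC h2C _ _ _ _ _
  constructor
  · intro h i j
    exact (key i j).1 (h i (-j))
  · intro h i j
    have := (key i (-j)).2 (h i (-j))
    rwa [Idx.neg_neg] at this

theorem isTwisted_untwist_iff (hK : t = Kind.symplectic → 0 ∉ K)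
    {s : Matrix (Idx K) (Idx K) R⟦X⟧} : IsTwisted t.pm (untwist t s) ↔
      (∀ i j k l, quadLHS s i j k l = quadRHS t s i j k l) ∧ ∀ i j, symLHS t s i j = symRHS t s i j := by
  rw [quad_iff hK, symm_iff hK]
  exact ⟨fun h => ⟨h.refl, h.symm⟩, fun h => ⟨h.1, h.2⟩⟩

end Untwist

/-! ### Sklyanin minors in terms of minors without sign factors -/

section Bracket

variable {R : Type*} [Ring R] [Algebra ℂ R] {t : Kind} {K : Finset ℕ}

theorem orderedProd_mul_prod_map {ι E : Type*} [Monoid E] (s j : ι → E) (r r' : ι → ι → E) {l : List ι}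
    (hl : l.Nodup) (h : ∀ a b, a ≠ b → j a * r' a b = r a b * j a)
    (hs : ∀ a b, a ≠ b → Commute (j a) (s b))
    (hr : ∀ a b c, a ≠ b → a ≠ c → b ≠ c → Commute (j a) (r b c)) :
    orderedProd (fun a => s a * j a) r' l = orderedProd s r l * (l.map j).prod := by
  induction l with
  | nil => simp [orderedProd]
  | cons a l ih =>
    rw [List.nodup_cons] at hl
    have h1 : ∀ l : List ι, a ∉ l → j a * (l.map (r' a)).prod = (l.map (r a)).prod * j a := by
      intro l
      induction l with
      | nil => simp
      | cons b l ih =>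
        intro hb
        rw [List.mem_cons, not_or] at hb
        rw [List.map_cons, List.prod_cons, List.map_cons, List.prod_cons, ← mul_assoc, h a b hb.1,
          mul_assoc, ih hb.2, mul_assoc]
    have h2 : ∀ l : List ι, a ∉ l → l.Nodup → Commute (j a) (orderedProd s r l) := fun l hal hl =>
      orderedProd_induction (p := Commute (j a)) (Commute.one_right _)
        (fun _ _ => Commute.mul_right) hl (fun b hb => hs a b fun h => hal (h ▸ hb))
        fun b hb c hc hbc => hr a b c (fun h => hal (h ▸ hb)) (fun h => hal (h ▸ hc)) hbc
    rw [orderedProd, orderedProd, ih hl.2, mul_assoc (s a), h1 l hl.1, List.map_cons, List.prod_cons]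
    simp only [mul_assoc]
    rw [← mul_assoc (j a), (h2 l hl.1 hl.2).eq, mul_assoc]

theorem prod_map_filter_lt {ι E : Type*} [LinearOrder ι] [Monoid E] (s : ι → E) (r : ι → ι → E)
    {l : List ι} (hl : l.Pairwise (· < ·)) :
    (l.map fun a => s a * ((l.filter (fun b => a < b)).map (r a)).prod).prod =
      orderedProd s r l := by
  induction l with
  | nil => rfl
  | cons a l ih =>
    rw [List.pairwise_cons] at hl
    rw [List.map_cons, List.prod_cons, orderedProd, ← ih hl.2]
    congr 1
    · rw [List.filter_cons_of_neg (by simp), List.filter_eq_self.2 fun b hb => by simpa using hl.1 b hb]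
    · congr 1
      refine List.map_congr_left fun b hb => ?_
      rw [List.filter_cons_of_neg (by simpa using (hl.1 b hb).le)]

/-- The matrix relating a matrix of generating series to the matrix without sign factors. -/
def twistMatrix (t : Kind) (K : Finset ℕ) (R : Type*) [Ring R] [Algebra ℂ R] :
    Matrix (Idx K) (Idx K) R⟦X⟧ := fun i j => if i = -j then scal R (C (sgn t i.1)) else 0

theorem untwist_mul_twistMatrix (hK : t = Kind.symplectic → 0 ∉ K)
    (s : Matrix (Idx K) (Idx K) R⟦X⟧) : untwist t s * twistMatrix t K R = s := by
  ext1 i j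
  rw [Matrix.mul_apply, Finset.sum_eq_single (-j)]
  · rw [untwist_apply, twistMatrix, if_pos rfl, Idx.neg_neg, (coeffCommute_scal _ _).commute,
      scal_mul_eq_smul, smul_const_eq, smul_smul, sgn_mul_self hK, one_smul]
  · intro k _ hk
    rw [twistMatrix, if_neg hk, mul_zero]
  · simp

theorem mul_leg_apply {ι I A : Type*} [Fintype ι] [DecidableEq ι] [Fintype I] [DecidableEq I] [Ring A]
    (a : ι) (Z : Matrix (ι → I) (ι → I) A) (U : Matrix I I A) (f g : ι → I) :
    (Z * leg a U) f g = ∑ x, Z f (Function.update g a x) * U x (g a) := by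
  rw [Matrix.mul_apply]
  symm
  refine Finset.sum_of_injOn (fun x => Function.update g a x) ?_ (by simp) ?_ ?_
  · intro i _ j _ hij
    simpa using congrFun hij a
  · intro h _ hh
    rw [leg, if_neg, mul_zero]
    intro hb
    refine hh ⟨h a, by simp, ?_⟩
    ext1 b
    by_cases h : b = a
    · subst h; simp
    · simp [h, hb b h]
  · intro x _
    rw [leg, if_pos]
    · simp
    · intro b hb
      simp [hb]

theorem mul_leg_twistMatrix_apply {k : ℕ} (a : Fin k)
    (Z : Matrix (Fin k → Idx K) (Fin k → Idx K) R⟦X⟧) (f g : Fin k → Idx K) :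
    (Z * leg a (twistMatrix t K R)) f g =
      sgn t (-(g a)).1 • Z f (Function.update g a (-(g a))) := by
  rw [mul_leg_apply, Finset.sum_eq_single (-(g a))]
  · rw [twistMatrix, if_pos rfl, (coeffCommute_scal _ _).commute, scal_mul_eq_smul, smul_const_eq]
  · intro x _ hx
    rw [twistMatrix, if_neg hx, mul_zero]
  · simp

theorem leg_twistMatrix_mul_Rt (hK : t = Kind.symplectic → 0 ∉ K) {k : ℕ} {a b : Fin k}
    (hab : a ≠ b) : leg a (twistMatrix t K R) * Rt t R K a b =
      rSpectral (Idx K) R (fun a : Fin k => ((a : ℕ) : ℂ)) a b * leg a (twistMatrix t K R) := by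
  set Qop : Matrix (Fin k → Idx K) (Fin k → Idx K) R⟦X⟧ :=
    (Qmat t K a b).map fun z => scal R (C z) with hQ
  have e1 : Rt t R K a b = 1 + pole (((a : ℕ) : ℂ) + ((b : ℕ) : ℂ)) • Qop := by
    rw [Rt, hQ]
    congr 1
    ext1 f g
    rw [Matrix.smul_apply, Matrix.map_apply, Matrix.map_apply, ← scal_mul_eq_smul, ← map_mul, pole]
    congr 1
    rw [mul_right_comm, ← map_mul]
    congr 2
    ring
  have e2 : leg a (twistMatrix t K R) * Qop =
      contract (Idx K) R⟦X⟧ a b * leg a (twistMatrix t K R) := by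
    ext1 f g
    rw [mul_leg_twistMatrix_apply]
    refine (leg_mulVec a (twistMatrix t K R) (fun h => Qop h g) f).trans ?_
    rw [Finset.sum_eq_single (-(f a))]
    · rw [twistMatrix, if_pos (Idx.neg_neg _).symm, hQ, Matrix.map_apply, Qmat, contract,
        Function.update_self, Function.update_self, Function.update_of_ne hab.symm,
        Function.update_of_ne hab.symm]
      have h1 : (∀ c, c ≠ a → c ≠ b → Function.update f a (-f a) c = g c) ↔
          ∀ c, c ≠ a → c ≠ b → f c = Function.update g a (-g a) c :=
        forall_congr' fun c => forall_congr' fun hc => by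
          rw [Function.update_of_ne hc, Function.update_of_ne hc]
      have h2 : -f a = -f b ↔ f a = f b :=
        ⟨fun h => by rw [← Idx.neg_neg (f a), h, Idx.neg_neg], fun h => by rw [h]⟩
      have h3 : g a = -g b ↔ -g a = g b :=
        ⟨fun h => by rw [h, Idx.neg_neg], fun h => by rw [← h, Idx.neg_neg]⟩
      simp only [h1, h2, h3]
      split_ifs with h
      · rw [theta_eq, h.2.1, h.2.2, ← map_mul, ← map_mul, ← smul_const_eq, ← scal_mul_eq_smul, mul_one]
        congr 2
        linear_combination sgn t (g b).1 * sgn_mul_self hK (f b)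
      · rw [map_zero, map_zero, mul_zero, smul_zero]
    · intro x _ hx
      rw [twistMatrix, if_neg, zero_mul]
      intro h
      exact hx (by rw [h, Idx.neg_neg])
    · simp
  rw [e1, rSpectral, rContract, mul_add, add_mul, mul_one, one_mul, Matrix.mul_smul, e2,
    Matrix.smul_mul]

theorem leg_twistMatrix_commute {k : ℕ} {a b : Fin k} (hab : a ≠ b)
    (U : Matrix (Idx K) (Idx K) R⟦X⟧) : Commute (leg a (twistMatrix t K R)) (leg b U) := by
  show leg a (twistMatrix t K R) * leg b U = leg b U * leg a (twistMatrix t K R)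
  ext1 f g
  rw [mul_leg_twistMatrix_apply]
  refine (leg_mulVec a (twistMatrix t K R) (fun h => leg b U h g) f).trans ?_
  rw [Finset.sum_eq_single (-(f a))]
  · rw [twistMatrix, if_pos (Idx.neg_neg _).symm, leg, leg, scal_mul_eq_smul, smul_const_eq,
      Function.update_of_ne hab.symm, Function.update_of_ne hab.symm]
    have h1 : (∀ c, c ≠ b → Function.update f a (-f a) c = g c) ↔
        ∀ c, c ≠ b → f c = Function.update g a (-g a) c := by
      refine forall_congr' fun c => forall_congr' fun hc => ?_
      by_cases hca : c = a
      · subst hca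
        rw [Function.update_self, Function.update_self]
        exact ⟨fun h => by rw [← h, Idx.neg_neg], fun h => by rw [h, Idx.neg_neg]⟩
      · rw [Function.update_of_ne hca, Function.update_of_ne hca]
    simp only [h1]
    split_ifs with h
    · rw [h a hab, Function.update_self]
    · rw [smul_zero, smul_zero]
  · intro x _ hx
    rw [twistMatrix, if_neg, zero_mul]
    intro h
    exact hx (by rw [h, Idx.neg_neg])
  · simp

theorem bracket_eq (hK : t = Kind.symplectic → 0 ∉ K) (k : ℕ) (s : Matrix (Idx K) (Idx K) R⟦X⟧) :
    bracket t k s = spectralProd (untwist t s) (fun a : Fin k => ((a : ℕ) : ℂ)) (List.finRange k) *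
      ((List.finRange k).map fun a => leg a (twistMatrix t K R)).prod := by
  rw [bracket, prod_map_filter_lt _ _ (List.pairwise_lt_finRange k), spectralProd,
    ← orderedProd_mul_prod_map _ _ _ (Rt t R K) (List.nodup_finRange k)]
  · congr 1
    ext1 a
    rw [leg_mul]
    have e : (twistMatrix t K R).map (shift (-((a : ℕ) : ℂ))) = twistMatrix t K R := by
      ext1 i j
      rw [Matrix.map_apply, twistMatrix]
      split_ifs
      · rw [shift_scal, shift_C]
      · exact map_zero (shiftHom _)
    conv_rhs => rw [← e]
    rw [← map_shift_mul, untwist_mul_twistMatrix hK]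
    ext1 f g
    rw [onFactor, leg, Matrix.map_apply]
    congr
  · intro a b hab
    exact leg_twistMatrix_mul_Rt hK hab
  · intro a b hab
    exact leg_twistMatrix_commute hab _
  · intro a b c hab hac hbc
    exact (rContract_commute_leg _ hbc hab.symm hac.symm _).symm

theorem mul_prod_leg_twistMatrix {k : ℕ} (l : List (Fin k)) (hl : l.Nodup)
    (Z : Matrix (Fin k → Idx K) (Fin k → Idx K) R⟦X⟧) (f g : Fin k → Idx K) :
    (Z * (l.map fun a => leg a (twistMatrix t K R)).prod) f g =
      (l.map fun a => sgn t (-(g a)).1).prod • Z f (fun a => if a ∈ l then -(g a) else g a) := by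
  induction l generalizing Z with
  | nil => simp
  | cons a l ih =>
    rw [List.nodup_cons] at hl
    rw [List.map_cons, List.prod_cons, ← mul_assoc, ih hl.2, mul_leg_twistMatrix_apply, if_neg hl.1,
      smul_smul, List.map_cons, List.prod_cons, mul_comm]
    congr 2
    ext1 b
    by_cases hb : b = a
    · subst hb
      simp
    · simp [hb]

theorem minor_eq (hK : t = Kind.symplectic → 0 ∉ K) {k : ℕ} (s : Matrix (Idx K) (Idx K) R⟦X⟧)
    (f g : Fin k → Idx K) : minor t s f g =
      (∏ a, sgn t (-(g a)).1) • spectralMinor (untwist t s) f (fun a => -(g a)) := by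
  rw [minor, bracket_eq hK, ← mul_assoc, mul_prod_leg_twistMatrix _ (List.nodup_finRange k)]
  rw [Fin.prod_univ_def, spectralMinor]
  simp only [List.mem_finRange, if_true]
  rfl

end Bracket

/-! ### Signs -/

section Signs

@[to_additive]
theorem Idx.prod_eq {M : Type*} [CommMonoid M] (K : Finset ℕ) (f : ℤ → M) :
    ∏ i : Idx K, f i.1 = ∏ k ∈ K, if k = 0 then f 0 else f k * f (-(k : ℤ)) := by
  rw [← Finset.prod_fiberwise_of_maps_to (s := Finset.univ) (t := K) (g := fun i : Idx K => i.1.natAbs)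
    (fun i _ => i.2)]
  refine Finset.prod_congr rfl fun k hk => ?_
  split_ifs with h
  · subst h
    obtain ⟨z, hz⟩ : ∃ z : Idx K, z.1 = 0 := ⟨⟨0, hk⟩, rfl⟩
    refine Eq.trans (Finset.prod_eq_single z (fun i hi hi' => ?_) fun h0 => ?_) (congrArg f hz)
    · exact absurd (Subtype.ext ((Int.natAbs_eq_zero.1 (Finset.mem_filter.1 hi).2).trans hz.symm)) hi'
    · exact absurd (Finset.mem_filter.2 ⟨Finset.mem_univ z, Int.natAbs_eq_zero.2 hz⟩) h0
  · have hne : (⟨(k : ℤ), by simpa using hk⟩ : Idx K) ≠ ⟨-(k : ℤ), by simpa using hk⟩ := fun h' => by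
      have : (k : ℤ) = -(k : ℤ) := congrArg Subtype.val h'
      omega
    refine Eq.trans (Finset.prod_congr ?_ fun _ _ => rfl)
      (Finset.prod_pair (f := fun i : Idx K => f i.1) hne)
    ext i
    refine Finset.mem_filter.trans (Iff.trans ?_ (Finset.mem_insert.trans
      (or_congr Iff.rfl Finset.mem_singleton)).symm)
    constructor
    · rintro ⟨-, h'⟩
      rcases Int.natAbs_eq_iff.1 h' with h' | h'
      · exact Or.inl (Subtype.ext h')
      · exact Or.inr (Subtype.ext h')
    · rintro (rfl | rfl)
      · exact ⟨Finset.mem_univ _, Int.natAbs_natCast k⟩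
      · exact ⟨Finset.mem_univ _, by rw [Int.natAbs_neg, Int.natAbs_natCast]⟩

theorem Idx.card_eq (K : Finset ℕ) :
    Fintype.card (Idx K) = 2 * (K.erase 0).card + if 0 ∈ K then 1 else 0 := by
  have h := Idx.sum_eq K fun _ => 1
  rw [Finset.sum_const, Finset.card_univ, smul_eq_mul, mul_one] at h
  rw [h]
  split_ifs with h0
  · rw [← Finset.add_sum_erase _ _ h0, if_pos rfl, add_comm,
      Finset.sum_congr rfl fun k hk => if_neg (Finset.ne_of_mem_erase hk), Finset.sum_const,
      smul_eq_mul, mul_comm]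
  · rw [Finset.sum_congr rfl fun k hk => if_neg fun hk0 => h0 (by rwa [← hk0]), Finset.sum_const,
      smul_eq_mul, mul_comm, Finset.erase_eq_of_notMem h0, add_zero]

/-- The permutation `i ↦ -i` of an index set. -/
def negPerm (K : Finset ℕ) : Equiv.Perm (Idx K) := ⟨fun i => -i, fun i => -i, Idx.neg_neg, Idx.neg_neg⟩

theorem sign_negPerm (K : Finset ℕ) :
    Equiv.Perm.sign (negPerm K) = (-1) ^ (K.erase 0).card := by
  have hsupp : (negPerm K).support.card = 2 * (K.erase 0).card := by
    have h1 : (negPerm K).support = Finset.univ.filter fun i : Idx K => i.1 ≠ 0 := by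
      ext i
      rw [Equiv.Perm.mem_support, Finset.mem_filter]
      have : negPerm K i = i ↔ i.1 = 0 := by
        show -i = i ↔ _
        constructor
        · intro h
          have : -i.1 = i.1 := congrArg Subtype.val h
          omega
        · intro h
          refine Subtype.ext ?_
          show -i.1 = i.1
          omega
      simp [this]
    rw [h1, Finset.card_filter, Idx.sum_eq K fun x => if x ≠ 0 then 1 else 0]
    by_cases h0 : 0 ∈ K
    · rw [← Finset.add_sum_erase _ _ h0, Finset.sum_congr rfl fun k hk =>
        (if_neg (Finset.ne_of_mem_erase hk)).trans (c := 2) (by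
          have := Finset.ne_of_mem_erase hk
          simp [this])]
      simp [mul_comm]
    · rw [Finset.sum_congr rfl fun k hk => (if_neg fun hk0 => h0 (by rwa [← hk0])).trans (c := 2) (by
          have : k ≠ 0 := fun hk0 => h0 (by rwa [← hk0])
          simp [this]), Finset.erase_eq_of_notMem h0]
      simp [mul_comm]
  by_cases h1 : negPerm K = 1
  · rw [h1] at hsupp ⊢
    rw [Equiv.Perm.support_one, Finset.card_empty] at hsupp
    rw [Equiv.Perm.sign_one, show (K.erase 0).card = 0 by omega, pow_zero]
  · have h2 : orderOf (negPerm K) = 2 := orderOf_eq_prime (by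
      ext1 i
      exact Idx.neg_neg i) h1
    obtain ⟨n, hn⟩ := Equiv.Perm.cycleType_prime_order (σ := negPerm K) (h2 ▸ Nat.prime_two)
    have h3 := Equiv.Perm.sum_cycleType (negPerm K)
    rw [hn, h2, hsupp, Multiset.sum_replicate, smul_eq_mul] at h3
    rw [Equiv.Perm.sign_of_cycleType, hn, h2, Multiset.sum_replicate, Multiset.card_replicate,
      smul_eq_mul, pow_add, mul_comm (n + 1), pow_mul, show n + 1 = (K.erase 0).card by omega]
    simp

theorem prod_sgn {t : Kind} {K : Finset ℕ} (hK : t = Kind.symplectic → 0 ∉ K) :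
    ∏ i : Idx K, sgn t (-i).1 = t.pm ^ (K.erase 0).card := by
  have h := Idx.prod_eq K fun x => sgn t (-x)
  refine h.trans ?_
  have h1 : ∀ k ∈ K, k ≠ 0 → (if k = 0 then sgn t (-0) else sgn t (-(k : ℤ)) * sgn t (-(-(k : ℤ)))) =
      t.pm := fun k hk hk0 => by
    have := sgn_mul_self hK (⟨(k : ℤ), by simpa using hk⟩ : Idx K)
    rw [if_neg hk0, _root_.neg_neg, sgn_neg, mul_assoc, this, mul_one]
  by_cases h0 : 0 ∈ K
  · have ht : t = Kind.orthogonal := by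
      cases t
      · rfl
      · exact absurd h0 (hK rfl)
    rw [← Finset.mul_prod_erase _ _ h0, Finset.prod_congr rfl fun k hk =>
      h1 k (Finset.mem_of_mem_erase hk) (Finset.ne_of_mem_erase hk), if_pos rfl, Finset.prod_const, ht]
    simp [sgn]
  · rw [Finset.prod_congr rfl fun k hk => h1 k hk fun hk0 => h0 (by rwa [← hk0]), Finset.prod_const,
      Finset.erase_eq_of_notMem h0]

/-- The sign relating a Sklyanin determinant to the minor without sign factors. -/
theorem exists_perm_neg {t : Kind} {K : Finset ℕ} (hK : t = Kind.symplectic → 0 ∉ K) {n : ℕ}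
    {b : Fin n → Idx K} (hb : Function.Bijective b) :
    ∃ τ : Equiv.Perm (Fin n), (∀ a, -(b a) = b (τ a)) ∧
      (∏ a, sgn t (-(b a)).1) * ((Equiv.Perm.sign τ : ℤ) : ℂ) = (-t.pm) ^ (K.erase 0).card := by
  set e := Equiv.ofBijective b hb with he
  refine ⟨e.symm.permCongr (negPerm K), fun a => ?_, ?_⟩
  · rw [Equiv.permCongr_apply]
    exact (e.apply_symm_apply _).symm
  · rw [Equiv.Perm.sign_permCongr, sign_negPerm]
    have h1 : ∏ a, sgn t (-(b a)).1 = t.pm ^ (K.erase 0).card :=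
      (e.prod_comp fun i => sgn t (-i).1).trans (prod_sgn hK)
    refine (congrArg (· * _) h1).trans ?_
    rw [mul_comm]
    simp only [Units.val_pow_eq_pow_val, Units.val_neg, Units.val_one, Int.cast_pow, Int.cast_neg,
      Int.cast_one]
    rw [← mul_pow, neg_one_mul]

theorem Idx.enum_bijective (K : Finset ℕ) : Function.Bijective (Idx.enum K) := by
  rw [Fintype.bijective_iff_injective_and_card]
  refine ⟨(Finset.orderEmbOfFin _ _).injective, by simp⟩

variable {R : Type*} [Ring R] [Algebra ℂ R] {t : Kind} {K : Finset ℕ}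

theorem zsmul_eq_const_smul (z : ℤ) (f : R⟦X⟧) : z • f = (z : ℂ) • f := (Int.cast_smul_eq_zsmul ℂ z f).symm

theorem sdet_eq (hK : t = Kind.symplectic → 0 ∉ K) {s : Matrix (Idx K) (Idx K) R⟦X⟧}
    (h : SeriesReflection 0 (untwist t s)) : sdet t s =
      (-t.pm) ^ (K.erase 0).card • spectralMinor (untwist t s) (Idx.enum K) (Idx.enum K) := by
  obtain ⟨τ, h1, h2⟩ := exists_perm_neg hK (Idx.enum_bijective K)
  rw [sdet, minor_eq hK, funext h1, ← h2, mul_smul]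
  have := h.spectralMinor_comp (Idx.enum K) (Idx.enum K) 1 τ
  rw [Equiv.Perm.sign_one, one_mul, zsmul_eq_const_smul] at this
  rw [← this]
  rfl

end Signs

/-! ### The universal property of the twisted Yangian -/

section Naturality

variable {A B : Type*} [Ring A] [Algebra ℂ A] [Ring B] [Algebra ℂ B] (φ : A →ₐ[ℂ] B) {t : Kind}
  {K : Finset ℕ}

theorem map_map_inU (f : A⟦X⟧) :
    PowerSeries.map (PowerSeries.map (φ : A →+* B)) (inU f) = inU (PowerSeries.map (φ : A →+* B) f) :=
  map_C _ _

theorem map_map_inV (f : A⟦X⟧) :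
    PowerSeries.map (PowerSeries.map (φ : A →+* B)) (inV f) = inV (PowerSeries.map (φ : A →+* B) f) := by
  ext p q
  simp [inV]

theorem map_map_const₂ (c : ℂ) :
    PowerSeries.map (PowerSeries.map (φ : A →+* B)) (const₂ A c) = const₂ B c := by
  simp [const₂]

theorem map_scal (c : ℂ⟦X⟧) : PowerSeries.map (φ : A →+* B) (scal A c) = scal B c := by
  ext p
  simp [scal]

theorem map_reflect (f : A⟦X⟧) :
    PowerSeries.map (φ : A →+* B) (reflect f) = reflect (PowerSeries.map (φ : A →+* B) f) := by
  ext p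
  simp [reflect]

theorem map_quadLHS (s : Matrix (Idx K) (Idx K) A⟦X⟧) (i j k l : Idx K) :
    PowerSeries.map (PowerSeries.map (φ : A →+* B)) (quadLHS s i j k l) =
      quadLHS (s.map (PowerSeries.map (φ : A →+* B))) i j k l := by
  simp only [quadLHS, map_mul, map_sub, map_pow, map_map_inU, map_map_inV, map_X, Matrix.map_apply]

theorem map_quadRHS (s : Matrix (Idx K) (Idx K) A⟦X⟧) (i j k l : Idx K) :
    PowerSeries.map (PowerSeries.map (φ : A →+* B)) (quadRHS t s i j k l) =
      quadRHS t (s.map (PowerSeries.map (φ : A →+* B))) i j k l := by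
  simp only [quadRHS, map_mul, map_sub, map_add, map_pow, map_map_inU, map_map_inV, map_X,
    Matrix.map_apply, map_map_const₂]

theorem map_symLHS (s : Matrix (Idx K) (Idx K) A⟦X⟧) (i j : Idx K) :
    PowerSeries.map (φ : A →+* B) (symLHS t s i j) =
      symLHS t (s.map (PowerSeries.map (φ : A →+* B))) i j := by
  simp only [symLHS, map_mul, map_scal, map_reflect, Matrix.map_apply]

theorem map_symRHS (s : Matrix (Idx K) (Idx K) A⟦X⟧) (i j : Idx K) :
    PowerSeries.map (φ : A →+* B) (symRHS t s i j) =
      symRHS t (s.map (PowerSeries.map (φ : A →+* B))) i j := by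
  rw [symRHS, map_add, map_mul, map_scal, map_sub, map_reflect]
  rfl

variable (t K) in
theorem isTwisted_S (hK : t = Kind.symplectic → 0 ∉ K) : IsTwisted t.pm (untwist t (S t K)) := by
  have hS : S t K = (freeS K).map (PowerSeries.map (mkY t K : Free K →+* Y t K)) := rfl
  rw [isTwisted_untwist_iff hK, hS]
  constructor
  · intro i j k l
    rw [← map_quadLHS, ← map_quadRHS]
    ext q p
    rw [coeff_map, coeff_map, coeff_map, coeff_map]
    exact RingQuot.mkAlgHom_rel ℂ (Rel.quad i j k l p q)
  · intro i j
    rw [← map_symLHS, ← map_symRHS]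
    ext p
    rw [coeff_map, coeff_map]
    exact RingQuot.mkAlgHom_rel ℂ (Rel.symm i j p)

theorem constantCoeff_S (i j : Idx K) :
    constantCoeff (S t K i j) = if i = j then 1 else 0 := by
  rw [S, ← coeff_zero_eq_constantCoeff_apply, coeff_map, freeS, coeff_mk]
  split_ifs
  · exact map_one _
  · exact map_zero _

theorem coeff_succ_S (i j : Idx K) (r : ℕ) :
    coeff (r + 1) (S t K i j) = mkY t K (FreeAlgebra.ι ℂ (i, j, r)) := by
  rw [S, coeff_map, freeS, coeff_mk]
  rfl

theorem existsUnique_hom (T : Matrix (Idx K) (Idx K) B⟦X⟧)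
    (h0 : ∀ i j, constantCoeff (T i j) = if i = j then 1 else 0)
    (hq : ∀ i j k l, quadLHS T i j k l = quadRHS t T i j k l)
    (hs : ∀ i j, symLHS t T i j = symRHS t T i j) :
    ∃! Φ : Y t K →ₐ[ℂ] B, ∀ a b, PowerSeries.map (Φ : Y t K →+* B) (S t K a b) = T a b := by
  set φ₀ : Free K →ₐ[ℂ] B := FreeAlgebra.lift ℂ fun x => coeff (x.2.2 + 1) (T x.1 x.2.1) with hφ
  have hT : (freeS K).map (PowerSeries.map (φ₀ : Free K →+* B)) = T := by
    ext i j p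
    rw [Matrix.map_apply, coeff_map, freeS, coeff_mk]
    cases p with
    | zero =>
      rw [coeff_zero_eq_constantCoeff_apply, h0]
      show φ₀ (if i = j then 1 else 0) = _
      split_ifs <;> simp
    | succ r => exact FreeAlgebra.lift_ι_apply _ _
  have hrel : ∀ ⦃x y⦄, Rel t K x y → φ₀ x = φ₀ y := by
    rintro _ _ (⟨i, j, k, l, p, q⟩ | ⟨i, j, p⟩)
    · have := hq i j k l
      rw [← hT, ← map_quadLHS, ← map_quadRHS] at this
      have := congrArg (fun F => coeff p (coeff q F)) this
      simp only [coeff_map] at this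
      exact this
    · have := hs i j
      rw [← hT, ← map_symLHS, ← map_symRHS] at this
      have := congrArg (fun F => coeff p F) this
      simp only [coeff_map] at this
      exact this
  refine ⟨RingQuot.liftAlgHom ℂ ⟨φ₀, hrel⟩, fun a b => ?_, fun Ψ hΨ => ?_⟩
  · rw [← hT]
    ext p
    rw [S, coeff_map, coeff_map, Matrix.map_apply, coeff_map]
    exact RingQuot.liftAlgHom_mkAlgHom_apply ℂ φ₀ hrel _
  · refine RingQuot.ringQuot_ext' ℂ _ _ (FreeAlgebra.hom_ext (funext fun ⟨i, j, r⟩ => ?_))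
    have h1 := congrArg (coeff (r + 1)) (hΨ i j)
    rw [coeff_map, coeff_succ_S] at h1
    refine Eq.trans h1 ?_
    show _ = RingQuot.liftAlgHom ℂ ⟨φ₀, hrel⟩ (RingQuot.mkAlgHom ℂ (Rel t K) (FreeAlgebra.ι ℂ (i, j, r)))
    rw [RingQuot.liftAlgHom_mkAlgHom_apply]
    exact (FreeAlgebra.lift_ι_apply (R := ℂ) (fun x : Idx K × Idx K × ℕ =>
      coeff (x.2.2 + 1) (T x.1 x.2.1)) (i, j, r)).symm

end Naturality

/-! ### The chain of index sets `{-m, …, m}` -/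

section Chain

variable {t : Kind} {e m n : ℕ}

theorem mem_absIdx {a : ℕ} : a ∈ absIdx e n ↔ a ≤ n ∧ (a = 0 → e = 1) := by
  rw [absIdx, Finset.mem_filter, Finset.mem_range, Nat.lt_succ_iff]

theorem mem_absCompl {a : ℕ} : a ∈ absCompl e m n ↔ m < a ∧ a ≤ n := by
  rw [absCompl, Finset.mem_sdiff, mem_absIdx, mem_absIdx]
  by_cases h : a = 0
  · subst h
    simp
  · simp only [h, false_imp_iff, and_true]
    omega

theorem zero_notMem_absIdx (hsymp : t = Kind.symplectic → e = 0) (n : ℕ) :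
    t = Kind.symplectic → 0 ∉ absIdx e n := fun ht h => by
  have := (mem_absIdx.1 h).2 rfl
  rw [hsymp ht] at this
  exact zero_ne_one this

theorem card_erase_absIdx : ((absIdx e n).erase 0).card = n := by
  have : (absIdx e n).erase 0 = (Finset.range (n + 1)).erase 0 := by
    ext a
    rw [Finset.mem_erase, Finset.mem_erase, mem_absIdx, Finset.mem_range, Nat.lt_succ_iff]
    constructor
    · exact fun h => ⟨h.1, h.2.1⟩
    · exact fun h => ⟨h.1, h.2, fun h0 => absurd h0 h.1⟩
  rw [this, Finset.card_erase_of_mem (by simp), Finset.card_range, Nat.add_sub_cancel]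

theorem card_idx_absIdx (he : e = 0 ∨ e = 1) : Fintype.card (Idx (absIdx e n)) = 2 * n + e := by
  rw [Idx.card_eq, card_erase_absIdx]
  congr 1
  rcases he with rfl | rfl <;> simp [mem_absIdx]

theorem absCompl_erase : (absCompl e m n).erase 0 = Finset.Ioc m n := by
  ext a
  rw [Finset.mem_erase, mem_absCompl, Finset.mem_Ioc]
  omega

theorem card_erase_absCompl : ((absCompl e m n).erase 0).card = n - m := by
  rw [absCompl_erase, Nat.card_Ioc]

theorem card_idx_absCompl : Fintype.card (Idx (absCompl e m n)) = 2 * (n - m) := by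
  rw [Idx.card_eq, card_erase_absCompl, if_neg fun h => by simpa using (mem_absCompl.1 h).1, add_zero]

theorem Idx.incl_injective {K L : Finset ℕ} (h : K ⊆ L) : Function.Injective (Idx.incl h) :=
  fun _ _ hij => Subtype.ext (congrArg (fun i : Idx L => i.1) hij)

theorem Idx.incl_neg {K L : Finset ℕ} (h : K ⊆ L) (i : Idx K) : Idx.incl h (-i) = -Idx.incl h i := rfl

end Chain

/-! ### Invertibility -/

section Invertibility

variable {t : Kind} {K : Finset ℕ} {A : Type*} [Ring A] [Algebra ℂ A]

/-- The matrix of the form preserved by `𝔤_N`. -/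
def formMatrix (t : Kind) (K : Finset ℕ) (A : Type*) [Ring A] [Algebra ℂ A] :
    Matrix (Idx K) (Idx K) A := fun i j => if i = -j then algebraMap ℂ A (sgn t j.1) else 0

/-- The inverse of the matrix of the form. -/
def formInverse (t : Kind) (K : Finset ℕ) (A : Type*) [Ring A] [Algebra ℂ A] :
    Matrix (Idx K) (Idx K) A := fun i j => if i = -j then algebraMap ℂ A (sgn t i.1) else 0

theorem formMatrix_mul_formInverse (hK : t = Kind.symplectic → 0 ∉ K) :
    formMatrix t K A * formInverse t K A = 1 := by
  ext1 i j
  rw [Matrix.mul_apply, Finset.sum_eq_single (-i), formMatrix, formInverse, if_pos (Idx.neg_neg i).symm,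
    Matrix.one_apply]
  · by_cases h : i = j
    · subst h
      rw [if_pos rfl, if_pos rfl, ← map_mul, sgn_mul_self hK, map_one]
    · rw [if_neg h, if_neg fun h' => h (by rw [← Idx.neg_neg i, h', Idx.neg_neg]), mul_zero]
  · intro k _ hk
    rw [formMatrix, if_neg, zero_mul]
    exact fun h => hk (by rw [h, Idx.neg_neg])
  · simp

theorem formInverse_mul_formMatrix (hK : t = Kind.symplectic → 0 ∉ K) :
    formInverse t K A * formMatrix t K A = 1 := by
  ext1 i j
  rw [Matrix.mul_apply, Finset.sum_eq_single (-i), formMatrix, formInverse, if_pos (Idx.neg_neg i).symm,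
    Matrix.one_apply]
  · by_cases h : i = j
    · subst h
      rw [if_pos rfl, if_pos rfl, ← map_mul, sgn_mul_self hK, map_one]
    · rw [if_neg h, if_neg fun h' => h (by rw [← Idx.neg_neg i, h', Idx.neg_neg]), mul_zero]
  · intro k _ hk
    rw [formInverse, if_neg, zero_mul]
    exact fun h => hk (by rw [h, Idx.neg_neg])
  · simp

theorem constantCoeff_untwist {s : Matrix (Idx K) (Idx K) A⟦X⟧}
    (h0 : ∀ i j, constantCoeff (s i j) = if i = j then 1 else 0) :
    (untwist t s).map constantCoeff = formMatrix t K A := by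
  ext1 i j
  rw [Matrix.map_apply, untwist_apply, ← coeff_zero_eq_constantCoeff_apply, coeff_smul,
    coeff_zero_eq_constantCoeff_apply, h0, formMatrix, Algebra.algebraMap_eq_smul_one]
  split_ifs
  · rfl
  · exact smul_zero _

theorem exists_untwist_inverse (hK : t = Kind.symplectic → 0 ∉ K) {s : Matrix (Idx K) (Idx K) A⟦X⟧}
    (h0 : ∀ i j, constantCoeff (s i j) = if i = j then 1 else 0) :
    ∃ Z, untwist t s * Z = 1 ∧ Z * untwist t s = 1 ∧ ∀ {L : Finset ℕ} (h : L ⊆ K),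
      ∃ q, q * Z.submatrix (Idx.incl h) (Idx.incl h) = 1 ∧
        Z.submatrix (Idx.incl h) (Idx.incl h) * q = 1 := by
  have hs := constantCoeff_untwist (t := t) h0
  obtain ⟨Z, h1, h2⟩ := exists_matrix_inverse (untwist t s) (formInverse t K A)
    (by rw [hs, formMatrix_mul_formInverse hK]) (by rw [hs, formInverse_mul_formMatrix hK])
  refine ⟨Z, h1, h2, fun {L} h => ?_⟩
  have hZ : Z.map constantCoeff = formInverse t K A := by
    have := congrArg (fun V => formInverse t K A * V.map constantCoeff) h1
    beta_reduce at this
    rw [Matrix.map_mul, Matrix.map_one _ (map_zero _) (map_one _), hs, ← Matrix.mul_assoc,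
      formInverse_mul_formMatrix hK, Matrix.one_mul, Matrix.mul_one] at this
    exact this
  have hZL : (Z.submatrix (Idx.incl h) (Idx.incl h)).map constantCoeff = formInverse t L A := by
    ext1 i j
    refine (congrFun (congrFun hZ (Idx.incl h i)) (Idx.incl h j)).trans ?_
    rw [formInverse, formInverse, ← Idx.incl_neg]
    simp only [(Idx.incl_injective h).eq_iff]
    rfl
  have hL : t = Kind.symplectic → 0 ∉ L := fun ht h' => hK ht (h h')
  obtain ⟨q, h3, h4⟩ := exists_matrix_inverse (Z.submatrix (Idx.incl h) (Idx.incl h)) (formMatrix t L A)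
    (by rw [hZL, formInverse_mul_formMatrix hL]) (by rw [hZL, formMatrix_mul_formInverse hL])
  exact ⟨q, h4, h3⟩

end Invertibility

/-! ### The constant terms of Sklyanin minors -/

section ConstantTerm

variable {t : Kind} {K : Finset ℕ} {R : Type*} [Ring R] [Algebra ℂ R]

theorem constantCoeff_bracket {s : Matrix (Idx K) (Idx K) R⟦X⟧}
    (h0 : ∀ i j, constantCoeff (s i j) = if i = j then 1 else 0) (k : ℕ) :
    (constantCoeff (R := R)).mapMatrix (bracket t k s) = 1 := by
  have hl : ∀ l : List (Matrix (Fin k → Idx K) (Fin k → Idx K) R⟦X⟧),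
      (∀ V ∈ l, (constantCoeff (R := R)).mapMatrix V = 1) →
        (constantCoeff (R := R)).mapMatrix l.prod = 1 := fun l hl => by
    rw [map_list_prod]
    exact List.prod_eq_one (by simpa using hl)
  rw [bracket]
  refine hl _ fun V hV => ?_
  obtain ⟨a, -, rfl⟩ := List.mem_map.1 hV
  have h1 : (constantCoeff (R := R)).mapMatrix (onFactor s a) = 1 := by
    ext1 f g
    show constantCoeff (onFactor s a f g) = _
    rw [onFactor, Matrix.one_apply]
    by_cases hfg : f = g
    · subst hfg
      simp [constantCoeff_shift, h0]
    · rw [if_neg hfg]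
      split_ifs with h
      · rw [constantCoeff_shift, h0, if_neg]
        refine fun ha => hfg (funext fun b => ?_)
        by_cases hb : b = a
        · rw [hb, ha]
        · exact h b hb
      · exact map_zero _
  rw [map_mul, h1, one_mul]
  refine hl _ fun V hV => ?_
  obtain ⟨b, -, rfl⟩ := List.mem_map.1 hV
  ext1 f g
  show constantCoeff (Rt t R K a b f g) = _
  rw [Rt, Matrix.add_apply, map_add, Matrix.map_apply, scal, ← coeff_zero_eq_constantCoeff_apply
    (PowerSeries.map _ _), coeff_map, coeff_zero_eq_constantCoeff_apply, map_mul,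
    constantCoeff_invLin, mul_zero, map_zero, add_zero, Matrix.one_apply, Matrix.one_apply]
  split_ifs
  · exact map_one _
  · exact map_zero _

theorem constantCoeff_minor {s : Matrix (Idx K) (Idx K) R⟦X⟧}
    (h0 : ∀ i j, constantCoeff (s i j) = if i = j then 1 else 0) {k : ℕ} (f g : Fin k → Idx K) :
    constantCoeff (minor t s f g) =
      ∑ σ : Equiv.Perm (Fin k), if f = g ∘ σ.symm then ((Equiv.Perm.sign σ : ℤ) : R) else 0 := by
  have h1 : (constantCoeff (R := R)).mapMatrix (antisymmetrizer R K k * bracket t k s) =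
      (constantCoeff (R := R)).mapMatrix (antisymmetrizer R K k) := by
    rw [map_mul, constantCoeff_bracket h0, mul_one]
  refine (congrFun (congrFun h1 f) g).trans ?_
  show constantCoeff (antisymmetrizer R K k f g) = _
  rw [antisymmetrizer, map_sum]
  refine Finset.sum_congr rfl fun σ _ => ?_
  split_ifs
  · exact map_intCast _ _
  · exact map_zero _

theorem constantCoeff_minor_self {s : Matrix (Idx K) (Idx K) R⟦X⟧}
    (h0 : ∀ i j, constantCoeff (s i j) = if i = j then 1 else 0) {k : ℕ} {f : Fin k → Idx K}
    (hf : Function.Injective f) : constantCoeff (minor t s f f) = 1 := by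
  rw [constantCoeff_minor h0, Finset.sum_eq_single 1]
  · rw [if_pos (show f = f ∘ (1 : Equiv.Perm (Fin k)).symm from rfl), Equiv.Perm.sign_one, Units.val_one,
      Int.cast_one]
  · intro σ _ hσ
    rw [if_neg]
    refine fun h => hσ ?_
    ext1 i
    have := hf ((congrFun h (σ i)).trans (congrArg f (σ.symm_apply_apply i)))
    exact this
  · simp

theorem constantCoeff_minor_of_range {s : Matrix (Idx K) (Idx K) R⟦X⟧}
    (h0 : ∀ i j, constantCoeff (s i j) = if i = j then 1 else 0) {k : ℕ} {f g : Fin k → Idx K}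
    {i : Fin k} (h : ∀ j, f i ≠ g j) : constantCoeff (minor t s f g) = 0 := by
  rw [constantCoeff_minor h0]
  refine Finset.sum_eq_zero fun σ _ => ?_
  rw [if_neg]
  exact fun h' => h _ (congrFun h' i)

end ConstantTerm

/-! ### The normalizing series -/

section Normalization

variable (t : Kind) (m : ℕ)

/-- The ratio of the series produced by eliminating the indices `-m, …, m` and the shifted minor
without sign factors on these indices. -/
def eliminationFactor : ℂ⟦X⟧ := C ((-t.pm) ^ m) * alpha t (-(m : ℤ))

theorem one_add_mul_alpha_symplectic : (1 + C (1 / 2 + (m : ℂ)) * X) * alpha .symplectic (-(m : ℤ)) =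
    1 + C (1 / 2 : ℂ) * X := by
  rw [alpha, mul_left_comm, Int.cast_neg, Int.cast_natCast, sub_neg_eq_add,
    PowerSeries.mul_inv_cancel _ (by simp), mul_one]

theorem constantCoeff_alpha : constantCoeff (alpha t (-(m : ℤ))) = 1 := by
  cases t
  · exact map_one _
  · simp [alpha]

theorem eliminationFactor_zero : eliminationFactor t 0 = 1 := by
  rw [eliminationFactor, pow_zero, map_one, one_mul]
  cases t
  · rfl
  · have := one_add_mul_alpha_symplectic 0
    rw [Nat.cast_zero, add_zero] at this
    exact mul_left_cancel₀ (one_add_C_mul_X_ne_zero _) (this.trans (mul_one _).symm)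

theorem eliminationFactor_succ : (C (2 * t.pm) - invLin 1) * eliminationFactor t (m + 1) =
    -((2 - invLin 1) * shift 1 (eliminationFactor t m)) := by
  have h2 : (C (2 : ℂ) : ℂ⟦X⟧) = 2 := map_ofNat _ 2
  cases t
  · have h : eliminationFactor .orthogonal (m + 1) = -shift 1 (eliminationFactor .orthogonal m) := by
      simp only [eliminationFactor, alpha, mul_one, shift_C, pow_succ, Kind.pm, mul_neg, map_neg]
    rw [h, Kind.pm, mul_one, h2, mul_neg]
  · have e : ∀ k, eliminationFactor .symplectic k = alpha .symplectic (-(k : ℤ)) := fun k => by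
      simp [eliminationFactor, Kind.pm]
    have hx : (1 + X) * invLin 1 = X := by
      simpa using one_add_C_mul_X_mul_invLin 1
    have h1 := one_add_mul_alpha_symplectic (m + 1)
    have h0 := congrArg (shift 1) (one_add_mul_alpha_symplectic m)
    rw [shift_mul, shift_add, shift_add, shift_one, shift_mul, shift_mul, shift_C, shift_C, shift_X] at h0
    rw [e, e, Kind.pm, mul_neg, mul_one, map_neg, h2]
    set a := alpha .symplectic (-((m + 1 : ℕ) : ℤ))
    set b := shift 1 (alpha .symplectic (-(m : ℤ)))
    set x := invLin 1
    have hc : (C (1 / 2 + ((m + 1 : ℕ) : ℂ)) : ℂ⟦X⟧) = 1 + C (1 / 2 + (m : ℂ)) := by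
      rw [← map_one C, ← map_add]
      congr 1
      push_cast
      ring
    rw [hc] at h1
    set c : ℂ⟦X⟧ := C (1 / 2 + (m : ℂ)) with hcdef
    have hd : (2 : ℂ⟦X⟧) * C (1 / 2 : ℂ) = 1 := by
      rw [← h2, ← map_mul]
      norm_num
    set d : ℂ⟦X⟧ := C (1 / 2 : ℂ)
    have hne1 : (1 + X : ℂ⟦X⟧) ≠ 0 := by simpa using one_add_C_mul_X_ne_zero 1
    have hne2 : (1 + (1 + c) * X : ℂ⟦X⟧) ≠ 0 := by
      rw [hcdef, ← map_one C, ← map_add, map_one]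
      exact one_add_C_mul_X_ne_zero _
    refine mul_left_cancel₀ (mul_ne_zero (mul_ne_zero hne1 hne1) hne2) ?_
    have k1 : (1 + X) * (2 + x) = 2 + 3 * X := by linear_combination hx
    have k2 : (1 + X) * (2 - x) = 2 + X := by linear_combination -hx
    have k3 : (1 + (1 + c) * X) * b = 1 + (1 + d) * X := by
      linear_combination (1 + X) * h0 + (d - c * b) * hx
    calc (1 + X) * (1 + X) * (1 + (1 + c) * X) * ((-2 - x) * a)
        = -((1 + X) * ((1 + X) * (2 + x)) * ((1 + (1 + c) * X) * a)) := by ring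
      _ = -((1 + X) * (2 + 3 * X) * (1 + d * X)) := by rw [k1, h1]
      _ = -((1 + X) * (2 + X) * (1 + (1 + d) * X)) := by
        linear_combination -((1 + X) * X ^ 2) * hd
      _ = -((1 + X) * ((1 + X) * (2 - x)) * ((1 + (1 + c) * X) * b)) := by rw [k2, k3]
      _ = _ := by ring

end Normalization

/-! ### The elimination of the indices `-m, …, m` -/

section EliminationChain

variable {t : Kind} {e m n : ℕ}

theorem mem_range_append {I : Type*} {k l : ℕ} {f : Fin k → I} {g : Fin l → I} {i : I} :
    i ∈ Set.range (Fin.append f g) ↔ (∃ b, f b = i) ∨ ∃ b, g b = i := by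
  constructor
  · rintro ⟨b, rfl⟩
    refine Fin.addCases (fun b => ?_) (fun b => ?_) b
    · exact Or.inl ⟨b, (Fin.append_left _ _ _).symm⟩
    · exact Or.inr ⟨b, (Fin.append_right _ _ _).symm⟩
  · rintro (⟨b, rfl⟩ | ⟨b, rfl⟩)
    · exact ⟨_, Fin.append_left _ _ b⟩
    · exact ⟨_, Fin.append_right _ _ b⟩

theorem exists_incl_enum_iff (h : m ≤ n) (i : Idx (absIdx e n)) :
    (∃ b, Idx.incl (absIdx_mono e h) (Idx.enum (absIdx e m) b) = i) ↔ i.1.natAbs ≤ m := by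
  constructor
  · rintro ⟨b, rfl⟩
    exact (mem_absIdx.1 (Idx.enum (absIdx e m) b).2).1
  · intro hi
    obtain ⟨b, hb⟩ := (Idx.enum_bijective (absIdx e m)).2
      ⟨i.1, mem_absIdx.2 ⟨hi, (mem_absIdx.1 i.2).2⟩⟩
    exact ⟨b, by rw [hb]; rfl⟩

theorem exists_incl_compl_iff (i : Idx (absIdx e n)) :
    (∃ a : Idx (absCompl e m n), Idx.incl Finset.sdiff_subset a = i) ↔ m < i.1.natAbs := by
  constructor
  · rintro ⟨a, rfl⟩
    exact (mem_absCompl.1 a.2).1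
  · intro hi
    exact ⟨⟨i.1, mem_absCompl.2 ⟨hi, (mem_absIdx.1 i.2).1⟩⟩, rfl⟩

/-- The complement of `{-m, …, m}`, decomposed as `{-(m + 1), m + 1}` and the complement of
`{-(m + 1), …, m + 1}`. -/
def complSplit (h : m + 1 ≤ n) : Fin 2 ⊕ Idx (absCompl e (m + 1) n) → Idx (absCompl e m n) :=
  Sum.elim ![⟨-((m + 1 : ℕ) : ℤ), mem_absCompl.2 (by omega)⟩, ⟨((m + 1 : ℕ) : ℤ), mem_absCompl.2 (by omega)⟩]
    (Idx.incl fun _ ha => mem_absCompl.2 ⟨by have := (mem_absCompl.1 ha).1; omega, (mem_absCompl.1 ha).2⟩)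

theorem complSplit_bijective (h : m + 1 ≤ n) : Function.Bijective (complSplit (e := e) h) := by
  have hv : ∀ x y : Idx (absCompl e m n), x = y ↔ x.1 = y.1 := fun x y => Subtype.ext_iff
  constructor
  · rintro (i | a) (j | b) hij
    · fin_cases i <;> fin_cases j <;> first | rfl | (have := (hv _ _).1 hij; simp [complSplit] at this; omega)
    · have := (hv _ _).1 hij
      have hb := (mem_absCompl.1 b.2).1
      fin_cases i <;> simp [complSplit, Idx.incl] at this <;> omega
    · have := (hv _ _).1 hij
      have ha := (mem_absCompl.1 a.2).1
      fin_cases j <;> simp [complSplit, Idx.incl] at this <;> omega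
    · have := (hv _ _).1 hij
      exact congrArg Sum.inr (Subtype.ext this)
  · intro a
    obtain ⟨h1, h2⟩ := mem_absCompl.1 a.2
    by_cases h3 : m + 1 < a.1.natAbs
    · exact ⟨Sum.inr ⟨a.1, mem_absCompl.2 ⟨h3, h2⟩⟩, rfl⟩
    · rcases Int.natAbs_eq_iff.1 (show a.1.natAbs = m + 1 by omega) with h4 | h4
      · exact ⟨Sum.inl 1, (hv _ _).2 h4.symm⟩
      · exact ⟨Sum.inl 0, (hv _ _).2 h4.symm⟩

variable {R : Type*} [Ring R] [Algebra ℂ R]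

theorem elimination_absIdx (he : e = 0 ∨ e = 1) (hsymp : t = Kind.symplectic → e = 0)
    {S Z : Matrix (Idx (absIdx e n)) (Idx (absIdx e n)) R⟦X⟧} (hS : IsTwisted t.pm S)
    (h1 : S * Z = 1) (h2 : Z * S = 1)
    (h3 : ∀ {L : Finset ℕ} (h : L ⊆ absIdx e n), ∃ q,
      q * Z.submatrix (Idx.incl h) (Idx.incl h) = 1 ∧ Z.submatrix (Idx.incl h) (Idx.incl h) * q = 1)
    {m : ℕ} (hmn : m ≤ n) {M : ℕ} (hM : M = 2 * m + e) {β : Fin M → Idx (absIdx e n)}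
    (hβ : Function.Injective β) (hr : ∀ i, (∃ b, β b = i) ↔ i.1.natAbs ≤ m)
    {q : Matrix (Idx (absCompl e m n)) (Idx (absCompl e m n)) R⟦X⟧}
    (hq : q * Z.submatrix (Idx.incl Finset.sdiff_subset) (Idx.incl Finset.sdiff_subset) = 1)
    (hq' : Z.submatrix (Idx.incl Finset.sdiff_subset) (Idx.incl Finset.sdiff_subset) * q = 1) :
    Elimination t.pm Z M (Idx.incl Finset.sdiff_subset)
      (eliminationFactor t m • shift ((M : ℂ) / 2) (spectralMinor S β β)) q := by
  induction m generalizing M with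
  | zero =>
    rw [eliminationFactor_zero, one_smul]
    have hinj := Idx.incl_injective (Finset.sdiff_subset (s := absIdx e n) (t := absIdx e 0))
    rcases he with rfl | rfl
    · obtain rfl : M = 0 := hM
      have hbij : Function.Bijective (Idx.incl (Finset.sdiff_subset (s := absIdx 0 n) (t := absIdx 0 0))) := by
        refine ⟨hinj, fun i => (exists_incl_compl_iff i).2 ?_⟩
        have := (mem_absIdx.1 i.2).2
        omega
      have E := Elimination.zero hS h1 h2 (Equiv.ofBijective _ hbij)
      have : q = S.submatrix (Equiv.ofBijective _ hbij) (Equiv.ofBijective _ hbij) :=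
        left_inv_eq_right_inv hq E.mul_right
      rw [this, spectralMinor_zero, shift_one]
      exact E
    · obtain rfl : M = 1 := hM
      have ht : t = Kind.orthogonal := by
        cases t
        · rfl
        · exact absurd (hsymp rfl) one_ne_zero
      subst ht
      have hβ0 : (β 0).1.natAbs = 0 := Nat.le_zero.1 ((hr _).1 ⟨0, rfl⟩)
      have hbij : Function.Bijective (Sum.elim β
          (Idx.incl (Finset.sdiff_subset (s := absIdx 1 n) (t := absIdx 1 0)))) := by
        constructor
        · refine hβ.sumElim hinj fun b a hab => ?_
          have h4 := (hr _).1 ⟨b, rfl⟩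
          have h5 := (exists_incl_compl_iff (m := 0) (β b)).1 ⟨a, hab.symm⟩
          omega
        · intro i
          rcases Nat.eq_zero_or_pos i.1.natAbs with h | h
          · obtain ⟨b, hb⟩ := (hr i).2 h.le
            exact ⟨Sum.inl b, hb⟩
          · obtain ⟨a, ha⟩ := (exists_incl_compl_iff (m := 0) i).2 h
            exact ⟨Sum.inr a, ha⟩
      have E := Elimination.one hS h1 h2 (Equiv.ofBijective _ hbij) (q := q) hq hq'
      rw [spectralMinor_one, Nat.cast_one]
      exact E
  | succ m ih =>
    have hm : m ≤ n := by omega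
    obtain ⟨q₀, h4, h5⟩ := h3 (Finset.sdiff_subset (s := absIdx e n) (t := absIdx e m))
    set α : Idx (absCompl e m n) → Idx (absIdx e n) := Idx.incl Finset.sdiff_subset with hα
    set β₀ : Fin (Fintype.card (Idx (absIdx e m))) → Idx (absIdx e n) := fun i =>
      Idx.incl (absIdx_mono e hm) (Idx.enum (absIdx e m) i) with hβ₀
    have hM₀ : Fintype.card (Idx (absIdx e m)) = 2 * m + e := card_idx_absIdx he
    have hr₀ : ∀ i, (∃ b, β₀ b = i) ↔ i.1.natAbs ≤ m := exists_incl_enum_iff hm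
    have hβ₀i : Function.Injective β₀ :=
      (Idx.incl_injective (absIdx_mono e hm)).comp (Idx.enum_bijective _).1
    have hαi : Function.Injective α := Idx.incl_injective _
    have E := ih hm hM₀ hβ₀i hr₀ h4 h5
    set γ := Equiv.ofBijective _ (complSplit_bijective (e := e) hmn) with hγ
    obtain ⟨D', hD', E'⟩ := E.step γ (q' := q) hq hq'
    have hdisj : ∀ b a, β₀ b ≠ α a := fun b a hab => by
      have h6 := (hr₀ _).1 ⟨b, rfl⟩
      have h7 := (exists_incl_compl_iff (m := m) (β₀ b)).1 ⟨a, hab.symm⟩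
      omega
    have hcov : ∀ i, (∃ b, β₀ b = i) ∨ ∃ a, α a = i := fun i => by
      rcases le_or_gt i.1.natAbs m with h | h
      · exact Or.inl ((hr₀ i).2 h)
      · exact Or.inr ((exists_incl_compl_iff i).2 h)
    have hpi : Function.Injective (γ ∘ Sum.inl) := γ.injective.comp Sum.inl_injective
    have hstep := E.spectralMinor_step hS.refl h1 hβ₀i hαi hdisj hcov hpi hD'
      (eliminationFactor_succ t m) rfl
    obtain rfl : M = Fintype.card (Idx (absIdx e m)) + 2 := by omega
    rw [hS.refl.spectralMinor_eq_of_range (f := β) (g := Fin.append β₀ (α ∘ γ ∘ Sum.inl)) hβ, ← hstep]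
    · exact E'
    · exact Fin.append_injective_iff.2 ⟨hβ₀i, hαi.comp hpi, fun i j => hdisj _ _⟩
    · ext i
      rw [mem_range_append]
      refine Iff.trans (hr i) ?_
      constructor
      · intro h
        rcases Nat.lt_or_ge i.1.natAbs (m + 1) with h6 | h6
        · exact Or.inl ((hr₀ i).2 (by omega))
        · refine Or.inr ?_
          rcases Int.natAbs_eq_iff.1 (show i.1.natAbs = m + 1 by omega) with h7 | h7
          · exact ⟨1, Subtype.ext h7.symm⟩
          · exact ⟨0, Subtype.ext h7.symm⟩
      · rintro (⟨b, rfl⟩ | ⟨b, rfl⟩)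
        · have := (hr₀ _).1 ⟨b, rfl⟩
          omega
        · fin_cases b
          · show (-((m + 1 : ℕ) : ℤ)).natAbs ≤ m + 1
            omega
          · show (((m + 1 : ℕ) : ℤ)).natAbs ≤ m + 1
            omega

end EliminationChain

/-! ### The matrix of Sklyanin minors -/

section SharpMatrix

variable {t : Kind} {e m n : ℕ}

theorem extend_eq_append (h : m ≤ n) (a : Idx (absCompl e m n)) : extend e h a =
    Fin.append (fun i => Idx.incl (absIdx_mono e h) (Idx.enum (absIdx e m) i))
      ((Idx.incl Finset.sdiff_subset : Idx (absCompl e m n) → _) ∘ fun _ : Fin 1 => a) := by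
  rw [Fin.append_right_eq_snoc]
  rfl

theorem minor_extend (hsymp : t = Kind.symplectic → e = 0) (h : m ≤ n) {R : Type*} [Ring R] [Algebra ℂ R]
    {s : Matrix (Idx (absIdx e n)) (Idx (absIdx e n)) R⟦X⟧} (hs : SeriesReflection 0 (untwist t s))
    (a b : Idx (absCompl e m n)) : minor t s (extend e h a) (extend e h b) =
      ((-t.pm) ^ m * sgn t (-b).1) •
        spectralMinor (untwist t s) (extend e h a) (extend e h (-b)) := by
  obtain ⟨τ, h1, h2⟩ := exists_perm_neg (zero_notMem_absIdx hsymp m) (Idx.enum_bijective (absIdx e m))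
  rw [card_erase_absIdx] at h2
  set σ : Equiv.Perm (Fin (Fintype.card (Idx (absIdx e m)) + 1)) :=
    finSumFinEquiv.permCongr (Equiv.Perm.sumCongr τ 1) with hσ
  have hsσ : Equiv.Perm.sign σ = Equiv.Perm.sign τ := by
    rw [hσ, Equiv.Perm.sign_permCongr, Equiv.Perm.sign_sumCongr, Equiv.Perm.sign_one, mul_one]
  have h3 : (fun i => -(extend e h b i)) = extend e h (-b) ∘ σ := by
    rw [extend_eq_append, extend_eq_append]
    ext1 i
    refine Fin.addCases (fun i => ?_) (fun i => ?_) i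
    · have : σ (Fin.castAdd 1 i) = Fin.castAdd 1 (τ i) := by
        rw [hσ, Equiv.permCongr_apply, finSumFinEquiv_symm_apply_castAdd]
        exact finSumFinEquiv_apply_left _
      rw [Function.comp_apply, this, Fin.append_left, Fin.append_left, ← h1, Idx.incl_neg]
    · have : σ (Fin.natAdd _ i) = Fin.natAdd _ i := by
        rw [hσ, Equiv.permCongr_apply, finSumFinEquiv_symm_apply_natAdd]
        exact finSumFinEquiv_apply_right _
      rw [Function.comp_apply, this, Fin.append_right, Fin.append_right]
      rfl
  have h4 : ∏ i, sgn t (-(extend e h b i)).1 = (∏ i, sgn t (-(Idx.enum (absIdx e m) i)).1) * sgn t (-b).1 := by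
    rw [Fin.prod_univ_castSucc]
    congr 1
    · refine Finset.prod_congr rfl fun i _ => ?_
      rw [extend, Fin.snoc_castSucc]
      rfl
    · rw [extend, Fin.snoc_last]
      rfl
  have h5 := hs.spectralMinor_comp (extend e h a) (extend e h (-b)) 1 σ
  rw [Equiv.Perm.sign_one, one_mul, hsσ, zsmul_eq_const_smul] at h5
  rw [minor_eq (zero_notMem_absIdx hsymp n), h3, h4, ← h2]
  refine (congrArg _ h5).trans ?_
  rw [smul_smul]
  congr 1
  ring

theorem smul_scal_mul_shift {R : Type*} [Ring R] [Algebra ℂ R] (c : ℂ) {z : ℂ} (hz : z * z = 1) (A : ℂ⟦X⟧)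
    (a : ℂ) (W x : R⟦X⟧) :
    z • (scal R A * shift a ((c * z) • (W * shift (-a) (shift (-a) x)))) =
      ((C c * A) • shift a W) * shift (-a) x := by
  rw [scal_mul_eq_smul, ← smul_const_eq, ← smul_const_eq, shift_smul, shift_mul, shift_shift,
    add_neg_cancel, shift_zero, shift_C, smul_smul, smul_smul, smul_mul_assoc]
  congr 1
  calc C z * A * C (c * z) = C (z * z) * (C c * A) := by rw [map_mul, map_mul]; ring
    _ = _ := by rw [hz, map_one, one_mul]

/-- The elimination of `-m, …, m` produces the matrix `α_{-m}(u) S♯(u)`. -/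
theorem untwist_imageMatrix (hsymp : t = Kind.symplectic → e = 0) (h : m ≤ n)
    {Z : Matrix (Idx (absIdx e n)) (Idx (absIdx e n)) (Y t (absIdx e n))⟦X⟧}
    (h1 : untwist t (S t (absIdx e n)) * Z = 1) (hM : Fintype.card (Idx (absIdx e m)) = 2 * m + e)
    {q : Matrix (Idx (absCompl e m n)) (Idx (absCompl e m n)) (Y t (absIdx e n))⟦X⟧}
    (hq : Z.submatrix (Idx.incl Finset.sdiff_subset) (Idx.incl Finset.sdiff_subset) * q = 1) :
    untwist t (imageMatrix t e h) =
      (eliminationFactor t m • shift (((2 * m + e : ℕ) : ℂ) / 2) (spectralMinor (untwist t (S t (absIdx e n)))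
        (fun i => Idx.incl (absIdx_mono e h) (Idx.enum (absIdx e m) i))
        (fun i => Idx.incl (absIdx_mono e h) (Idx.enum (absIdx e m) i)))) •
      q.map (shift (-(((2 * m + e : ℕ) : ℂ) / 2))) := by
  have hs := (isTwisted_S t (absIdx e n) (zero_notMem_absIdx hsymp n)).refl
  set β : Fin (Fintype.card (Idx (absIdx e m))) → Idx (absIdx e n) := fun i =>
    Idx.incl (absIdx_mono e h) (Idx.enum (absIdx e m) i) with hβ
  have hr : ∀ i, (∃ b, β b = i) ↔ i.1.natAbs ≤ m := exists_incl_enum_iff h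
  have happ := hs.spectralMinor_append (k := 1) h1 (β := β)
    (α := (Idx.incl Finset.sdiff_subset : Idx (absCompl e m n) → Idx (absIdx e n)))
    ((Idx.incl_injective (absIdx_mono e h)).comp (Idx.enum_bijective _).1)
    (Idx.incl_injective Finset.sdiff_subset) (fun b a hab => by
      have h6 := (hr _).1 ⟨b, rfl⟩
      have h7 := (exists_incl_compl_iff (m := m) (β b)).1 ⟨a, hab.symm⟩
      omega) (fun i => by
      rcases le_or_gt i.1.natAbs m with h | h
      · exact Or.inl ((hr i).2 h)
      · exact Or.inr ((exists_incl_compl_iff i).2 h)) hq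
  have hK : t = Kind.symplectic → 0 ∉ absCompl e m n := fun _ h0 => by
    simpa using (mem_absCompl.1 h0).1
  refine Matrix.ext fun a b => ?_
  have hsg := sgn_mul_self hK b
  have hM' := congrArg (Nat.cast : ℕ → ℂ) hM
  have h8 := minor_extend hsymp h hs a (-b)
  have h9 := happ (fun _ => a) (fun _ => b)
  rw [spectralMinor_one, hM', Matrix.map_apply] at h9
  rw [Idx.neg_neg, extend_eq_append h a, extend_eq_append h b, h9, ← extend_eq_append h a] at h8
  rw [untwist_apply, imageMatrix, Ssharp, h8]
  exact smul_scal_mul_shift _ hsg _ _ _ _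

end SharpMatrix

/-! ### Products of shifted series -/

section ShiftedProducts

variable {R : Type*} [Ring R] [Algebra ℂ R]

theorem prod_map_smul_range (k : ℕ) (z : ℕ → ℂ⟦X⟧) (x : ℕ → R⟦X⟧) :
    ((List.range k).map fun a => z a • x a).prod =
      (∏ a ∈ Finset.range k, z a) • ((List.range k).map x).prod := by
  induction k with
  | zero => simp
  | succ k ih =>
    rw [List.range_succ, List.map_append, List.map_append, List.prod_append, List.prod_append, ih,
      Finset.prod_range_succ, List.map_singleton, List.map_singleton, List.prod_singleton,
      List.prod_singleton, smul_mul_smul_comm]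

theorem prod_map_finRange (k : ℕ) (x : ℕ → R⟦X⟧) :
    ((List.finRange (k + 1)).map fun a : Fin (k + 1) => x (a : ℕ)).prod =
      x 0 * ((List.range k).map fun a => x (a + 1)).prod := by
  have : ((List.finRange (k + 1)).map fun a : Fin (k + 1) => x (a : ℕ)) =
      (List.range (k + 1)).map x := by
    rw [← List.map_coe_finRange_eq_range, List.map_map]
    rfl
  rw [this, List.range_succ_eq_map, List.map_cons, List.map_map, List.prod_cons]
  rfl

/-- A normalized minor as an ordered product. -/
theorem spectralMinor_smul_succ {I : Type*} [Fintype I] [DecidableEq I] {q : Matrix I I R⟦X⟧}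
    {A : ℂ⟦X⟧} {B : R⟦X⟧} (h : ∀ i j, CoeffCommute (A • B) (q i j)) {l k : ℕ} (hl : l = k + 1) (f g : Fin l → I) :
    spectralMinor ((A • B) • q) f g = (∏ i ∈ Finset.range (k + 1), shift (-(i : ℂ)) A) •
      (B * spectralMinor q f g * ((List.range k).map fun a : ℕ => shift (-((a : ℂ) + 1)) B).prod) := by
  subst hl
  rw [spectralMinor_smul h, prod_map_finRange k fun a => shift (-(a : ℂ)) (A • B), mul_assoc,
    (Commute.list_prod_left _ (spectralMinor q f g) _).eq, ← mul_assoc]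
  · have h1 : ((List.range k).map fun a : ℕ => shift (-((a + 1 : ℕ) : ℂ)) (A • B)) =
        (List.range k).map fun a : ℕ => shift (-((a : ℂ) + 1)) A • shift (-((a : ℂ) + 1)) B :=
      List.map_congr_left fun a _ => by rw [shift_smul, Nat.cast_add, Nat.cast_one]
    rw [h1, prod_map_smul_range, Finset.prod_range_succ', Nat.cast_zero, neg_zero, shift_zero, shift_zero,
      smul_mul_assoc, smul_mul_smul_comm, mul_comm A]
    simp only [Nat.cast_add, Nat.cast_one]
  · intro x hx
    obtain ⟨a, -, rfl⟩ := List.mem_map.1 hx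
    exact ((CoeffCommute.spectralMinor h f g).shift_left _).commute

end ShiftedProducts

/-! ### The quantum Sylvester theorem -/

section QuantumSylvester

variable {t : Kind} {e m n : ℕ}

theorem constantCoeff_imageMatrix (h : m ≤ n) (a b : Idx (absCompl e m n)) :
    constantCoeff (imageMatrix t e h a b) = if a = b then 1 else 0 := by
  have hinj := Idx.incl_injective (absIdx_mono e h)
  have hne : ∀ (a : Idx (absCompl e m n)) i,
      (Idx.incl Finset.sdiff_subset a : Idx (absIdx e n)) ≠
        Idx.incl (absIdx_mono e h) (Idx.enum (absIdx e m) i) := fun a i hai => by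
    have h1 := (exists_incl_enum_iff h _).1 ⟨i, rfl⟩
    have h2 := (exists_incl_compl_iff (m := m) _).1 ⟨a, hai⟩
    omega
  have hα : constantCoeff (scal (Y t (absIdx e n)) (alpha t (-(m : ℤ)))) = 1 := by
    rw [scal, ← coeff_zero_eq_constantCoeff_apply, coeff_map, coeff_zero_eq_constantCoeff_apply,
      constantCoeff_alpha, map_one]
  rw [imageMatrix, map_mul, hα, one_mul, Ssharp, constantCoeff_shift]
  split_ifs with hab
  · subst hab
    refine constantCoeff_minor_self constantCoeff_S ?_
    rw [extend_eq_append, Fin.append_injective_iff]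
    exact ⟨hinj.comp (Idx.enum_bijective _).1, Function.injective_of_subsingleton _,
      fun i j => (hne a i).symm⟩
  · refine constantCoeff_minor_of_range constantCoeff_S (i := Fin.last _) fun j => ?_
    rw [extend, Fin.snoc_last, extend]
    refine Fin.lastCases ?_ (fun j => ?_) j
    · rw [Fin.snoc_last]
      exact fun h' => hab (Idx.incl_injective _ h')
    · rw [Fin.snoc_castSucc]
      exact hne a j

theorem smul_smul_mul_mul {R : Type*} [Ring R] [Algebra ℂ R] {c d : ℂ} (A : ℂ⟦X⟧) (B V P : R⟦X⟧) (a : ℂ) :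
    c • (A • (shift a (d • B) * V * P)) =
      scal R A * shift a ((c * d) • (B * shift (-a) V)) * P := by
  rw [scal_mul_eq_smul, ← smul_const_eq, ← smul_const_eq, ← smul_const_eq, shift_smul, shift_smul,
    shift_mul, shift_shift, add_neg_cancel, shift_zero, shift_C, shift_C, smul_smul, smul_mul_assoc,
    smul_mul_assoc, smul_smul, smul_smul, smul_mul_assoc, map_mul]
  congr 1
  ring

theorem sdet_SBB (hsymp : t = Kind.symplectic → e = 0) (h : m ≤ n) : sdet t (SBB t e h) = (-t.pm) ^ m • spectralMinor (untwist t (S t (absIdx e n)))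
    (fun i => Idx.incl (absIdx_mono e h) (Idx.enum (absIdx e m) i))
    (fun i => Idx.incl (absIdx_mono e h) (Idx.enum (absIdx e m) i)) := by
  have hS := isTwisted_S t (absIdx e n) (zero_notMem_absIdx hsymp n)
  have hu : untwist t (SBB t e h) = (untwist t (S t (absIdx e n))).submatrix
      (Idx.incl (absIdx_mono e h)) (Idx.incl (absIdx_mono e h)) := rfl
  rw [sdet_eq (zero_notMem_absIdx hsymp m) (hu ▸ hS.refl.submatrix _), card_erase_absIdx, hu,
    spectralMinor_submatrix (Idx.incl_injective _)]
  rfl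

theorem sdet_S_eq_mul (hsymp : t = Kind.symplectic → e = 0) (h : m ≤ n)
    {Z : Matrix (Idx (absIdx e n)) (Idx (absIdx e n)) (Y t (absIdx e n))⟦X⟧}
    (h1 : untwist t (S t (absIdx e n)) * Z = 1) (hcard : Fintype.card (Idx (absIdx e m)) = 2 * m + e)
    {q : Matrix (Idx (absCompl e m n)) (Idx (absCompl e m n)) (Y t (absIdx e n))⟦X⟧}
    (hq : Z.submatrix (Idx.incl Finset.sdiff_subset) (Idx.incl Finset.sdiff_subset) * q = 1) :
    sdet t (S t (absIdx e n)) = ((-t.pm) ^ (n - m) * (-t.pm) ^ m) •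
      (spectralMinor (untwist t (S t (absIdx e n)))
        (fun i => Idx.incl (absIdx_mono e h) (Idx.enum (absIdx e m) i))
        (fun i => Idx.incl (absIdx_mono e h) (Idx.enum (absIdx e m) i)) *
        shift (-(((2 * m + e : ℕ) : ℂ) / 2)) (spectralMinor
          (q.map (shift (-(((2 * m + e : ℕ) : ℂ) / 2)))) (Idx.enum (absCompl e m n))
            (Idx.enum (absCompl e m n)))) := by
  have hK := zero_notMem_absIdx hsymp n
  have hS := (isTwisted_S t (absIdx e n) hK).refl
  set β : Fin (Fintype.card (Idx (absIdx e m))) → Idx (absIdx e n) :=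
    fun i => Idx.incl (absIdx_mono e h) (Idx.enum (absIdx e m) i) with hβ
  have hβi : Function.Injective β := (Idx.incl_injective (absIdx_mono e h)).comp (Idx.enum_bijective _).1
  have hr : ∀ i, (∃ b, β b = i) ↔ i.1.natAbs ≤ m := exists_incl_enum_iff h
  set α : Idx (absCompl e m n) → Idx (absIdx e n) := Idx.incl Finset.sdiff_subset with hα
  have hαi : Function.Injective α := Idx.incl_injective _
  have hdisj : ∀ b a, β b ≠ α a := fun b a hab => by
    have h6 := (hr _).1 ⟨b, rfl⟩
    have h7 := (exists_incl_compl_iff (m := m) (β b)).1 ⟨a, hab.symm⟩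
    omega
  have hcov : ∀ i, (∃ b, β b = i) ∨ ∃ a, α a = i := fun i => by
    rcases le_or_gt i.1.natAbs m with h | h
    · exact Or.inl ((hr i).2 h)
    · exact Or.inr ((exists_incl_compl_iff i).2 h)
  have happ := hS.spectralMinor_append h1 hβi hαi hdisj hcov hq (Idx.enum (absCompl e m n))
    (Idx.enum (absCompl e m n))
  rw [congrArg (Nat.cast : ℕ → ℂ) hcard] at happ
  rw [sdet_eq hK hS, card_erase_absIdx, ← pow_add, Nat.sub_add_cancel h]
  refine congrArg _ (Eq.trans (hS.spectralMinor_eq_of_range (Idx.enum_bijective _).1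
    (Fin.append_injective_iff.2 ⟨hβi, hαi.comp (Idx.enum_bijective _).1, fun i j => hdisj _ _⟩) ?_) happ)
  rw [(Idx.enum_bijective _).2.range_eq]
  refine (Set.eq_univ_of_forall fun i => mem_range_append.2 ((hcov i).imp_right ?_)).symm
  rintro ⟨a, rfl⟩
  obtain ⟨b, rfl⟩ := (Idx.enum_bijective (absCompl e m n)).2 a
  exact ⟨b, rfl⟩

/-- The elimination of the indices `-m, …, m` from the generator matrix. -/
theorem exists_elimination (hsymp : t = Kind.symplectic → e = 0) (h : m ≤ n) (he : e = 0 ∨ e = 1) :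
    ∃ q : Matrix (Idx (absCompl e m n)) (Idx (absCompl e m n)) (Y t (absIdx e n))⟦X⟧,
      (∀ i j, CoeffCommute
        (alpha t (-(m : ℤ)) • shift (((2 * m + e : ℕ) : ℂ) / 2) (sdet t (SBB t e h))) (q i j)) ∧
      IsTwisted t.pm (untwist t (imageMatrix t e h)) ∧
      untwist t (imageMatrix t e h) = (alpha t (-(m : ℤ)) • shift (((2 * m + e : ℕ) : ℂ) / 2)
        (sdet t (SBB t e h))) • q ∧
      ∃ w : (Y t (absIdx e n))⟦X⟧, sdet t (SBB t e h) = (-t.pm) ^ m • w ∧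
        sdet t (S t (absIdx e n)) = ((-t.pm) ^ (n - m) * (-t.pm) ^ m) •
          (w * shift (-(((2 * m + e : ℕ) : ℂ) / 2))
            (spectralMinor q (Idx.enum (absCompl e m n)) (Idx.enum (absCompl e m n)))) := by
  have hK := zero_notMem_absIdx hsymp n
  have hS := isTwisted_S t (absIdx e n) hK
  obtain ⟨Z, h1, h2, h3⟩ := exists_untwist_inverse hK (constantCoeff_S (t := t) (K := absIdx e n))
  obtain ⟨q, hq, hq'⟩ := h3 (Finset.sdiff_subset (s := absIdx e n) (t := absIdx e m))
  have hcard : Fintype.card (Idx (absIdx e m)) = 2 * m + e := card_idx_absIdx he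
  have hcard' := congrArg (Nat.cast : ℕ → ℂ) hcard
  have E := elimination_absIdx he hsymp hS h1 h2 h3 h hcard
    ((Idx.incl_injective (absIdx_mono e h)).comp (Idx.enum_bijective _).1) (exists_incl_enum_iff h) hq hq'
  have hT := untwist_imageMatrix hsymp h h1 hcard hq'
  have hdet := sdet_S_eq_mul hsymp h h1 hcard hq'
  have hW := sdet_SBB hsymp h
  set w := spectralMinor (untwist t (S t (absIdx e n)))
    (fun i => Idx.incl (absIdx_mono e h) (Idx.enum (absIdx e m) i))
    (fun i => Idx.incl (absIdx_mono e h) (Idx.enum (absIdx e m) i)) with hw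
  have hD : eliminationFactor t m • shift (((2 * m + e : ℕ) : ℂ) / 2) w =
      alpha t (-(m : ℤ)) • shift (((2 * m + e : ℕ) : ℂ) / 2) (sdet t (SBB t e h)) := by
    rw [hW, ← smul_const_eq, shift_smul, shift_C, smul_smul, eliminationFactor, mul_comm]
  have hE := E.twisted
  have hc := E.commute
  change IsTwisted t.pm ((eliminationFactor t m • shift _ w) • _) at hE
  change ∀ i j, CoeffCommute (eliminationFactor t m • shift _ w) _ at hc
  rw [hcard', hD] at hE hc
  rw [hD] at hT
  exact ⟨q.map (shift (-(((2 * m + e : ℕ) : ℂ) / 2))), fun i j => (hc i j).shift_right _, hT ▸ hE, hT,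
    w, hW, hdet⟩

end QuantumSylvester

end TwistedYangian

end

open PowerSeries TwistedYangian in
theorem theorem3p1 (t : Kind) (e m n M N : ℕ) (he : e = 0 ∨ e = 1)
    (hsymp : t = Kind.symplectic → e = 0) (hM : M = 2 * m + e) (hN : N = 2 * n + e)
    (hmn : m < n) :
    (∃! Φ : Y t (absCompl e m n) →ₐ[ℂ] Y t (absIdx e n),
      ∀ a b, PowerSeries.map (Φ : Y t (absCompl e m n) →+* Y t (absIdx e n))
          (S t (absCompl e m n) a b) =
        scal (Y t (absIdx e n)) (alpha t (-(m : ℤ))) * Ssharp t e hmn.le a b) ∧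
    sdet t (imageMatrix t e hmn.le) =
      scal (Y t (absIdx e n))
          (∏ i ∈ Finset.range (N - M), shift (-(i : ℂ)) (alpha t (-(m : ℤ)))) *
        shift ((M : ℂ) / 2) (sdet t (S t (absIdx e n))) *
        ((List.range (N - M - 1)).map fun k : ℕ =>
          shift ((M : ℂ) / 2 - ((k : ℂ) + 1)) (sdet t (SBB t e hmn.le))).prod := by
  subst hM hN
  have hQ : t = Kind.symplectic → 0 ∉ absCompl e m n := fun _ h0 => by
    simpa using (mem_absCompl.1 h0).1
  obtain ⟨q, hc, hE, hT, w, hW, hdet⟩ := exists_elimination hsymp hmn.le he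
  constructor
  · exact existsUnique_hom (imageMatrix t e hmn.le) (constantCoeff_imageMatrix hmn.le)
      ((isTwisted_untwist_iff hQ).1 hE).1 ((isTwisted_untwist_iff hQ).1 hE).2
  have hsub : 2 * n + e - (2 * m + e) = 2 * (n - m) := by omega
  have hk : Fintype.card (Idx (absCompl e m n)) = 2 * (n - m) - 1 + 1 := by
    rw [card_idx_absCompl]
    omega
  have hlist : ((List.range (2 * (n - m) - 1)).map fun k : ℕ =>
      shift (-((k : ℂ) + 1)) (shift (((2 * m + e : ℕ) : ℂ) / 2) (sdet t (SBB t e hmn.le)))) =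
        (List.range (2 * (n - m) - 1)).map fun k : ℕ =>
          shift (((2 * m + e : ℕ) : ℂ) / 2 - ((k : ℂ) + 1)) (sdet t (SBB t e hmn.le)) :=
    List.map_congr_left fun k _ => by rw [shift_shift, neg_add_eq_sub]
  rw [sdet_eq hQ hE.refl, card_erase_absCompl, hT, spectralMinor_smul_succ hc hk, hlist, hsub, hdet,
    Nat.sub_add_cancel (show 1 ≤ 2 * (n - m) by omega), hW]
  exact smul_smul_mul_mul _ _ _ _ _
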